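/- Manifolds are smooth, finite-dimensional, Hausdorff, second countable and without boundary. A cosymplectic structure on a manifold $M$ is a pair of closed forms $\omega\in\Omega^2(M)$, $\eta\in\Omega^1(M)$ with $\eta$ nowhere vanishing and $TM=\ker\omega\oplus\ker\eta$. For a Lie groupoid $G\rightrightarrows B$ with source $s$, target $t$, Lie algebroid $A=\ker(ds)|_B$ and anchor $\rho=dt|_A$, a form $\alpha$ on $B$ is basic if $s^*\alpha=t^*\alpha$. A $0$-shifted cosymplectic structure on $G\rightrightarrows B$ is a pair of closed basic forms $\omega\in\Omega^2(B)$, $\eta\in\Omega^1(B)$ with $\eta$ nowhere vanishing such that, for all $x\in B$, the map $\flat_x:T_xB\to T_x^*B$, $\flat_x(v)=\iota_v\omega+\eta(v)\eta$, induces a quasi-isomorphism from the complex $A_x\xrightarrow{\rho_x}T_xB\to 0$ to the complex $0\to T^*_xB\xrightarrow{\rho_x^*}A_x^*$ (both in degrees $-1,0,1$). The stack presented by a Lie groupoid with such a structure is called a cosymplectic stack. **Corollary.** Let $K$ be a Lie group with Lie algebra $\mathfrak k$, acting smoothly on a cosymplectic manifold $(M,\omega,\eta)$, preserving $\omega$ and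 $\eta$, and Hamiltonian with moment map $\mu:M\to\mathfrak k^*$; that is, $\mu$ is smooth and $\mathrm{Ad}^*$-equivariant, and $\eta(\xi_M)=0$ and $d\mu^\xi=\iota_{\xi_M}\omega$ for all $\xi\in\mathfrak k$, where $\xi_M$ is the fundamental vector field of $\xi$ and $\mu^\xi=\langle\mu,\xi\rangle$. Suppose that $0$ is a regular value of $\mu$. Then $Z=\mu^{-1}(0)$ is an embedded submanifold of $M$, $K$ acts smoothly on it, and the restrictions $\omega_0=\omega|_Z$, $\eta_0=\eta|_Z$ form a $0$-shifted cosymplectic structure on the action groupoid $K\ltimes Z\rightrightarrows Z$; so the quotient stack $\mu^{-1}(0)/K$ is a cosymplectic stack. Moreover: * If the action of $K$ on $Z$ is proper, then $\mu^{-1}(0)/K$ is a cosymplectic orbifold: $K\ltimes Z\rightrightarrows Z$ is Morita equivalent to a proper étale Lie groupoid $A\rightrightarrows X$ whose object manifold carries a cosymplectic structure that is a $0$-shifted cosymplectic structure on $A\rightrightarrows X$ and corresponds to $(\omega_0,\eta_0)$ under the Morita equivalence. * If the action of $K$ on $Z$ is free and proper, then $\mu^{-1}(0)/K$ is a cosymplectic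 manifold: the orbit space $Z/K$, with the quotient topology, is Hausdorff and second countable and has a smooth manifold structure and a cosymplectic structure $(\omega^{\mathrm{red}},\eta^{\mathrm{red}})$ for which the projection $\pi:Z\to Z/K$ is a submersion with $\pi^*\omega^{\mathrm{red}}=\omega_0$ and $\pi^*\eta^{\mathrm{red}}=\eta_0$; and $\pi$ induces a Morita map from $K\ltimes Z\rightrightarrows Z$ to the unit groupoid of $Z/K$, that is, the manifold $Z/K$ represents the quotient stack. -/

import Mathlib

open Set Topology
open scoped Manifold ContDiff

noncomputable section

namespace Cosymp

universe u v

/-! ### Differential forms on manifolds -/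

section Forms

variable {E : Type*} [NormedAddCommGroup E] [NormedSpace ℝ E] {H : Type*} [TopologicalSpace H]
  {E' : Type*} [NormedAddCommGroup E'] [NormedSpace ℝ E'] {H' : Type*} [TopologicalSpace H']

/-- A (not necessarily smooth) differential `k`-form: an alternating `k`-linear form on every
tangent space. -/
abbrev Form (I : ModelWithCorners ℝ E H) (M : Type*) [TopologicalSpace M] [ChartedSpace H M]
    (k : ℕ) := ∀ x : M, (TangentSpace I x) [⋀^Fin k]→L[ℝ] ℝ

/-- The pullback `f^* α` of a form. -/
def Form.pullback {I : ModelWithCorners ℝ E H} {I' : ModelWithCorners ℝ E' H'}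
    {M : Type*} [TopologicalSpace M] [ChartedSpace H M]
    {N : Type*} [TopologicalSpace N] [ChartedSpace H' N] {k : ℕ}
    (f : M → N) (α : Form I' N k) : Form I M k :=
  fun x => (α (f x)).compContinuousLinearMap (mfderiv I I' f x)

variable {M : Type*} [TopologicalSpace M] [ChartedSpace E M]

/-- The expression of a form in the chart centred at `x₀`: its pullback by the inverse chart,
meaningful on the (open) target of the chart. -/
def Form.inChart {k : ℕ} (α : Form 𝓘(ℝ, E) M k) (x₀ : M) : E → E [⋀^Fin k]→L[ℝ] ℝ :=
  Form.pullback (I := 𝓘(ℝ, E)) (chartAt E x₀).symm α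

/-- A form is smooth if it is so in every chart. -/
def Form.IsSmooth {k : ℕ} (α : Form 𝓘(ℝ, E) M k) : Prop :=
  ∀ x₀ : M, ContDiffOn ℝ ∞ (α.inChart x₀) (chartAt E x₀).target

/-- A form is closed if its exterior derivative vanishes in every chart. -/
def Form.IsClosed {k : ℕ} (α : Form 𝓘(ℝ, E) M k) : Prop :=
  ∀ x₀ : M, ∀ y ∈ (chartAt E x₀).target, extDeriv (α.inChart x₀) y = 0

/-- `ker σ_x = {v | σ_x(v, w) = 0 for all w}`. -/
def ker₂ (σ : Form 𝓘(ℝ, E) M 2) (x : M) : Submodule ℝ (TangentSpace 𝓘(ℝ, E) x) where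
  carrier := {v | ∀ w, σ x ![v, w] = 0}
  zero_mem' := fun w => (σ x).map_coord_zero (m := ![0, w]) 0 rfl
  add_mem' := by
    intro a b ha hb w
    have h := (σ x).toMultilinearMap.cons_add ![w] a b
    exact h.trans (by
      change σ x ![a, w] + σ x ![b, w] = 0
      rw [ha w, hb w, add_zero])
  smul_mem' := by
    intro c a ha w
    have h := (σ x).toMultilinearMap.cons_smul ![w] c a
    exact h.trans (by
      change c • σ x ![a, w] = 0
      rw [ha w, smul_zero])

/-- `ker η_x = {v | η_x(v) = 0}`. -/
def ker₁ (η : Form 𝓘(ℝ, E) M 1) (x : M) : Submodule ℝ (TangentSpace 𝓘(ℝ, E) x) where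
  carrier := {v | η x ![v] = 0}
  zero_mem' := (η x).map_coord_zero (m := ![0]) 0 rfl
  add_mem' := by
    intro a b ha hb
    have h := (η x).toMultilinearMap.cons_add ![] a b
    exact h.trans (by
      change η x ![a] + η x ![b] = 0
      rw [show η x ![a] = 0 from ha, show η x ![b] = 0 from hb, add_zero])
  smul_mem' := by
    intro c a ha
    have h := (η x).toMultilinearMap.cons_smul ![] c a
    exact h.trans (by
      change c • η x ![a] = 0
      rw [show η x ![a] = 0 from ha, smul_zero])

/-- The Lichnerowicz map `♭_x : T_x M → T_x^* M`, `♭(v) = ι_v σ + η(v) η`. -/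
def flat (σ : Form 𝓘(ℝ, E) M 2) (η : Form 𝓘(ℝ, E) M 1) (x : M) :
    TangentSpace 𝓘(ℝ, E) x →ₗ[ℝ] Module.Dual ℝ (TangentSpace 𝓘(ℝ, E) x) :=
  LinearMap.mk₂ ℝ (fun v w => σ x ![v, w] + η x ![v] * η x ![w])
    (by
      intro a b w
      have h1 : σ x ![a + b, w] = σ x ![a, w] + σ x ![b, w] :=
        (σ x).toMultilinearMap.cons_add ![w] a b
      have h2 : η x ![a + b] = η x ![a] + η x ![b] := (η x).toMultilinearMap.cons_add ![] a b
      rw [h1, h2]; ring)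
    (by
      intro c a w
      have h1 : σ x ![c • a, w] = c • σ x ![a, w] := (σ x).toMultilinearMap.cons_smul ![w] c a
      have h2 : η x ![c • a] = c • η x ![a] := (η x).toMultilinearMap.cons_smul ![] c a
      rw [h1, h2]; simp only [smul_eq_mul]; ring)
    (by
      intro v a b
      have h1 : σ x ![v, a + b] = σ x ![v, a] + σ x ![v, b] := by
        have e : ∀ c : TangentSpace 𝓘(ℝ, E) x, Function.update ![v, 0] 1 c = ![v, c] := by
          intro c; ext i; fin_cases i <;> rfl
        have := (σ x).toMultilinearMap.map_update_add ![v, 0] 1 a b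
        rw [e, e, e] at this
        exact this
      have h2 : η x ![a + b] = η x ![a] + η x ![b] := (η x).toMultilinearMap.cons_add ![] a b
      rw [h1, h2]; ring)
    (by
      intro c v a
      have h1 : σ x ![v, c • a] = c • σ x ![v, a] := by
        have e : ∀ c : TangentSpace 𝓘(ℝ, E) x, Function.update ![v, 0] 1 c = ![v, c] := by
          intro c; ext i; fin_cases i <;> rfl
        have := (σ x).toMultilinearMap.map_update_smul ![v, 0] 1 c a
        rw [e, e] at this
        exact this
      have h2 : η x ![c • a] = c • η x ![a] := (η x).toMultilinearMap.cons_smul ![] c a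
      rw [h1, h2]; simp only [smul_eq_mul]; ring)

/-- `(σ, η)` is a cosymplectic structure on `M`: both forms are smooth and closed, `η` vanishes
nowhere, and `TM = ker σ ⊕ ker η`. -/
structure IsCosymplectic (σ : Form 𝓘(ℝ, E) M 2) (η : Form 𝓘(ℝ, E) M 1) : Prop where
  smooth_two : σ.IsSmooth
  smooth_one : η.IsSmooth
  closed_two : σ.IsClosed
  closed_one : η.IsClosed
  one_ne_zero : ∀ x, η x ≠ 0
  isCompl_ker : ∀ x, IsCompl (ker₂ σ x) (ker₁ η x)

end Forms

/-! ### Submersions and embeddings between finite-dimensional manifolds -/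

section Maps

variable {E : Type*} [NormedAddCommGroup E] [NormedSpace ℝ E] {H : Type*} [TopologicalSpace H]
  {E' : Type*} [NormedAddCommGroup E'] [NormedSpace ℝ E'] {H' : Type*} [TopologicalSpace H']
  (I : ModelWithCorners ℝ E H) (I' : ModelWithCorners ℝ E' H')
  {M : Type*} [TopologicalSpace M] [ChartedSpace H M]
  {N : Type*} [TopologicalSpace N] [ChartedSpace H' N]

/-- A smooth map with surjective differentials. -/
structure IsSubmersion (f : M → N) : Prop where
  contMDiff : ContMDiff I I' ∞ f
  surjective_mfderiv : ∀ x, Function.Surjective (mfderiv I I' f x)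

/-- A smooth map with injective differentials which is a homeomorphism onto its image. -/
structure IsEmbedding (f : M → N) : Prop where
  contMDiff : ContMDiff I I' ∞ f
  injective_mfderiv : ∀ x, Function.Injective (mfderiv I I' f x)
  isEmbedding : Topology.IsEmbedding f

/-- The differential of `f` at `x`, with values in the tangent space at `y`, where `y = f x`. -/
def derivTo (f : M → N) (x : M) (y : N) : TangentSpace I x →L[ℝ] TangentSpace I' y :=
  mfderiv I I' f x

end Maps

/-! ### Lie groupoids -/

/-- The structure maps of a groupoid `G ⇉ B`. The product `m g h` ("first `h`, then `g`") is
meaningful only if `s g = t h`. -/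
structure GroupoidData (B : Type*) (G : Type*) where
  /-- source -/
  s : G → B
  /-- target -/
  t : G → B
  /-- units -/
  u : B → G
  /-- inversion -/
  i : G → G
  /-- composition -/
  m : G → G → G

namespace GroupoidData

section

variable {E : Type*} [NormedAddCommGroup E] [NormedSpace ℝ E] {H : Type*} [TopologicalSpace H]
  {F : Type*} [NormedAddCommGroup F] [NormedSpace ℝ F] {L : Type*} [TopologicalSpace L]
  (I : ModelWithCorners ℝ E H) (J : ModelWithCorners ℝ F L)
  {B : Type*} [TopologicalSpace B] [ChartedSpace H B]
  {G : Type*} [TopologicalSpace G] [ChartedSpace L G]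

/-- The structure maps define a Lie groupoid. The composition is smooth on the submanifold
`{(g, h) | s g = t h}` of `G × G`. -/
structure IsLieGroupoid (𝒢 : GroupoidData B G) : Prop where
  s_u : ∀ x, 𝒢.s (𝒢.u x) = x
  t_u : ∀ x, 𝒢.t (𝒢.u x) = x
  s_m : ∀ g h, 𝒢.s g = 𝒢.t h → 𝒢.s (𝒢.m g h) = 𝒢.s h
  t_m : ∀ g h, 𝒢.s g = 𝒢.t h → 𝒢.t (𝒢.m g h) = 𝒢.t g
  m_assoc : ∀ g h k, 𝒢.s g = 𝒢.t h → 𝒢.s h = 𝒢.t k →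
    𝒢.m (𝒢.m g h) k = 𝒢.m g (𝒢.m h k)
  m_u : ∀ g, 𝒢.m g (𝒢.u (𝒢.s g)) = g
  u_m : ∀ g, 𝒢.m (𝒢.u (𝒢.t g)) g = g
  s_i : ∀ g, 𝒢.s (𝒢.i g) = 𝒢.t g
  t_i : ∀ g, 𝒢.t (𝒢.i g) = 𝒢.s g
  m_i : ∀ g, 𝒢.m g (𝒢.i g) = 𝒢.u (𝒢.t g)
  i_m : ∀ g, 𝒢.m (𝒢.i g) g = 𝒢.u (𝒢.s g)
  submersion_s : IsSubmersion J I 𝒢.s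
  submersion_t : IsSubmersion J I 𝒢.t
  smooth_u : ContMDiff I J ∞ 𝒢.u
  smooth_i : ContMDiff J J ∞ 𝒢.i
  smooth_m : ContMDiffOn (J.prod J) J ∞ (fun p : G × G => 𝒢.m p.1 p.2) {p | 𝒢.s p.1 = 𝒢.t p.2}

/-- The fibre `A_x = ker (ds)` at the unit of `x` of the Lie algebroid. -/
abbrev algebroid (𝒢 : GroupoidData B G) (x : B) : Submodule ℝ (TangentSpace J (𝒢.u x)) :=
  LinearMap.ker (mfderiv J I 𝒢.s (𝒢.u x)).toLinearMap

/-- The anchor `ρ_x = dt : A_x → T_x B` (recall that `t (u x) = x`). -/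
def anchor (𝒢 : GroupoidData B G) (x : B) : 𝒢.algebroid I J x →ₗ[ℝ] TangentSpace I x :=
  (derivTo J I 𝒢.t (𝒢.u x) x).toLinearMap ∘ₗ (𝒢.algebroid I J x).subtype

end

end GroupoidData

/-- The map `T / im ρ → ker ρ^*` induced by `f : T → T^*` on the cohomology in degree `0`. -/
def inducedMap {A T : Type*} [AddCommGroup A] [Module ℝ A] [AddCommGroup T] [Module ℝ T]
    (ρ : A →ₗ[ℝ] T) (f : T →ₗ[ℝ] Module.Dual ℝ T)
    (h : LinearMap.range ρ ≤ LinearMap.ker f) (h' : ∀ v, f v ∈ LinearMap.ker ρ.dualMap) :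
    (T ⧸ LinearMap.range ρ) →ₗ[ℝ] LinearMap.ker ρ.dualMap :=
  Submodule.liftQ (M₂ := LinearMap.ker ρ.dualMap) (τ₁₂ := RingHom.id ℝ) (LinearMap.range ρ)
    (LinearMap.codRestrict (LinearMap.ker ρ.dualMap) f h')
    (fun _ hv => LinearMap.mem_ker.mpr (Subtype.ext (LinearMap.mem_ker.mp (h hv))))

/-- For `0 → A → T → 0 → 0` (with differential `ρ`) and `0 → 0 → T^* → A^* → 0` (with
differential `ρ^*`), in degrees `-1, 0, 1`, the map which is `f : T → T^*` in degree `0` and zero in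
the other degrees is a cochain map and induces isomorphisms on cohomology: `ker ρ → 0` in degree
`-1`, `T / im ρ → ker ρ^*` in degree `0`, and `0 → coker ρ^*` in degree `1`. -/
structure IsQuasiIso {A T : Type*} [AddCommGroup A] [Module ℝ A] [AddCommGroup T] [Module ℝ T]
    (ρ : A →ₗ[ℝ] T) (f : T →ₗ[ℝ] Module.Dual ℝ T) : Prop where
  range_le_ker : LinearMap.range ρ ≤ LinearMap.ker f
  map_mem_ker_dual : ∀ v, f v ∈ LinearMap.ker ρ.dualMap
  degree_neg_one : LinearMap.ker ρ = ⊥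
  degree_zero : Function.Bijective (inducedMap ρ f range_le_ker map_mem_ker_dual)
  degree_one : LinearMap.range ρ.dualMap = ⊤

namespace GroupoidData

section

variable {E : Type*} [NormedAddCommGroup E] [NormedSpace ℝ E]
  {F : Type*} [NormedAddCommGroup F] [NormedSpace ℝ F] {L : Type*} [TopologicalSpace L]
  (J : ModelWithCorners ℝ F L)
  {B : Type*} [TopologicalSpace B] [ChartedSpace E B]
  {G : Type*} [TopologicalSpace G] [ChartedSpace L G]

/-- A form on the objects is basic if its pullbacks by source and target agree. -/
def IsBasic {k : ℕ} (𝒢 : GroupoidData B G) (α : Form 𝓘(ℝ, E) B k) : Prop :=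
  (Form.pullback 𝒢.t α : Form J G k) = Form.pullback 𝒢.s α

/-- A `0`-shifted cosymplectic structure on a groupoid `G ⇉ B`: closed basic smooth forms `σ` and
`η` of degrees 2 and 1, with `η` nowhere vanishing, whose Lichnerowicz map induces a
quasi-isomorphism between the tangent and the cotangent complex at each point of `B`. -/
structure IsZeroShiftedCosymplectic (𝒢 : GroupoidData B G)
    (σ : Form 𝓘(ℝ, E) B 2) (η : Form 𝓘(ℝ, E) B 1) : Prop where
  smooth_two : σ.IsSmooth
  smooth_one : η.IsSmooth
  closed_two : σ.IsClosed
  closed_one : η.IsClosed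
  basic_two : 𝒢.IsBasic J σ
  basic_one : 𝒢.IsBasic J η
  one_ne_zero : ∀ x, η x ≠ 0
  quasiIso : ∀ x, IsQuasiIso (𝒢.anchor 𝓘(ℝ, E) J x) (flat σ η x)

end

section Morita

variable {E₁ : Type*} [NormedAddCommGroup E₁] [NormedSpace ℝ E₁] {H₁ : Type*} [TopologicalSpace H₁]
  {F₁ : Type*} [NormedAddCommGroup F₁] [NormedSpace ℝ F₁] {L₁ : Type*} [TopologicalSpace L₁]
  {E₂ : Type*} [NormedAddCommGroup E₂] [NormedSpace ℝ E₂] {H₂ : Type*} [TopologicalSpace H₂]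
  {F₂ : Type*} [NormedAddCommGroup F₂] [NormedSpace ℝ F₂] {L₂ : Type*} [TopologicalSpace L₂]
  (I₁ : ModelWithCorners ℝ E₁ H₁) (J₁ : ModelWithCorners ℝ F₁ L₁)
  (I₂ : ModelWithCorners ℝ E₂ H₂) (J₂ : ModelWithCorners ℝ F₂ L₂)
  {B₁ : Type*} [TopologicalSpace B₁] [ChartedSpace H₁ B₁]
  {G₁ : Type*} [TopologicalSpace G₁] [ChartedSpace L₁ G₁]
  {B₂ : Type*} [TopologicalSpace B₂] [ChartedSpace H₂ B₂]
  {G₂ : Type*} [TopologicalSpace G₂] [ChartedSpace L₂ G₂]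

/-- `(φ₀, φ₁)` is a Morita map from the Lie groupoid `𝒢₁` to the Lie groupoid `𝒢₂`: a smooth
functor which is

* essentially surjective: the map `(x, g) ↦ t g` from the fibre product `B₁ ×_{B₂} G₂` (taken with
  respect to `φ₀` and `s`) to `B₂` is a surjective submersion; as `s` is a submersion, the tangent
  space of the fibre product at `(x, g)` consists of the pairs `(v, w)` with `dφ₀ v = ds w`;
* fully faithful: `G₁` is, through `(s, t, φ₁)`, the fibre product
  `{(x, y, g) | φ₀ x = s g, φ₀ y = t g}`, a submanifold of `B₁ × B₁ × G₂`. -/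
structure IsMoritaMap (𝒢₁ : GroupoidData B₁ G₁) (𝒢₂ : GroupoidData B₂ G₂)
    (φ₀ : B₁ → B₂) (φ₁ : G₁ → G₂) : Prop where
  smooth_obj : ContMDiff I₁ I₂ ∞ φ₀
  smooth_arr : ContMDiff J₁ J₂ ∞ φ₁
  map_s : ∀ g, 𝒢₂.s (φ₁ g) = φ₀ (𝒢₁.s g)
  map_t : ∀ g, 𝒢₂.t (φ₁ g) = φ₀ (𝒢₁.t g)
  map_u : ∀ x, φ₁ (𝒢₁.u x) = 𝒢₂.u (φ₀ x)
  map_m : ∀ g h, 𝒢₁.s g = 𝒢₁.t h → φ₁ (𝒢₁.m g h) = 𝒢₂.m (φ₁ g) (φ₁ h)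
  ess_surjective : ∀ y : B₂, ∃ (x : B₁) (g : G₂), φ₀ x = 𝒢₂.s g ∧ 𝒢₂.t g = y
  ess_submersion : ∀ (x : B₁) (g : G₂), φ₀ x = 𝒢₂.s g →
    ∀ z : TangentSpace I₂ (𝒢₂.t g), ∃ (v : TangentSpace I₁ x) (w : TangentSpace J₂ g),
      derivTo I₁ I₂ φ₀ x (𝒢₂.s g) v = mfderiv J₂ I₂ 𝒢₂.s g w ∧ mfderiv J₂ I₂ 𝒢₂.t g w = z
  ff_embedding : IsEmbedding J₁ (I₁.prod (I₁.prod J₂)) fun g => (𝒢₁.s g, 𝒢₁.t g, φ₁ g)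
  ff_range : range (fun g => (𝒢₁.s g, 𝒢₁.t g, φ₁ g)) =
    {p : B₁ × B₁ × G₂ | φ₀ p.1 = 𝒢₂.s p.2.2 ∧ φ₀ p.2.1 = 𝒢₂.t p.2.2}

end Morita

end GroupoidData

/-- A smooth manifold without boundary, Hausdorff and second countable, of dimension `dim`. -/
structure SmoothManifold where
  carrier : Type u
  dim : ℕ
  [topology : TopologicalSpace carrier]
  [charted : ChartedSpace (EuclideanSpace ℝ (Fin dim)) carrier]
  [isManifold : IsManifold (𝓡 dim) ∞ carrier]
  [t2 : T2Space carrier]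
  [secondCountable : SecondCountableTopology carrier]

attribute [instance] SmoothManifold.topology SmoothManifold.charted SmoothManifold.isManifold
  SmoothManifold.t2 SmoothManifold.secondCountable

/-- The stack presented by the Lie groupoid `𝒢 : G ⇉ B`, with the structure given by the basic forms
`σ` and `η`, is a cosymplectic orbifold: `𝒢` is Morita equivalent, through some Lie groupoid `𝒬` and
Morita maps `𝒢 ← 𝒬 → ℰ`, to a proper étale Lie groupoid `ℰ : A ⇉ X`, and `X` carries a cosymplectic
structure, which is `0`-shifted cosymplectic for `ℰ` (in particular invariant), and which
corresponds to `(σ, η)` under the Morita equivalence. -/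
def IsCosymplecticOrbifold {E : Type*} [NormedAddCommGroup E] [NormedSpace ℝ E]
    {F : Type*} [NormedAddCommGroup F] [NormedSpace ℝ F] {L : Type*} [TopologicalSpace L]
    (J : ModelWithCorners ℝ F L)
    {B : Type u} [TopologicalSpace B] [ChartedSpace E B]
    {G : Type v} [TopologicalSpace G] [ChartedSpace L G]
    (𝒢 : GroupoidData B G) (σ : Form 𝓘(ℝ, E) B 2) (η : Form 𝓘(ℝ, E) B 1) : Prop :=
  ∃ (X : SmoothManifold.{u}) (A : SmoothManifold.{v}) (ℰ : GroupoidData X.carrier A.carrier)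
    (σX : Form (𝓡 X.dim) X.carrier 2) (ηX : Form (𝓡 X.dim) X.carrier 1)
    (Y : SmoothManifold.{u}) (P : SmoothManifold.{v}) (𝒬 : GroupoidData Y.carrier P.carrier)
    (φ₀ : Y.carrier → B) (φ₁ : P.carrier → G)
    (ψ₀ : Y.carrier → X.carrier) (ψ₁ : P.carrier → A.carrier),
    ℰ.IsLieGroupoid (𝓡 X.dim) (𝓡 A.dim) ∧
    IsLocalDiffeomorph (𝓡 A.dim) (𝓡 X.dim) ∞ ℰ.s ∧
    IsProperMap (fun g => (ℰ.s g, ℰ.t g)) ∧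
    IsCosymplectic σX ηX ∧
    ℰ.IsZeroShiftedCosymplectic (𝓡 A.dim) σX ηX ∧
    𝒬.IsLieGroupoid (𝓡 Y.dim) (𝓡 P.dim) ∧
    𝒬.IsMoritaMap (𝓡 Y.dim) (𝓡 P.dim) 𝓘(ℝ, E) J 𝒢 φ₀ φ₁ ∧
    𝒬.IsMoritaMap (𝓡 Y.dim) (𝓡 P.dim) (𝓡 X.dim) (𝓡 A.dim) ℰ ψ₀ ψ₁ ∧
    (Form.pullback φ₀ σ : Form (𝓡 Y.dim) Y.carrier 2) = Form.pullback ψ₀ σX ∧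
    (Form.pullback φ₀ η : Form (𝓡 Y.dim) Y.carrier 1) = Form.pullback ψ₀ ηX

/-- The unit groupoid `B ⇉ B`, presenting the manifold `B` as a stack. -/
def unitGroupoid (B : Type*) : GroupoidData B B := ⟨id, id, id, id, fun g _ => g⟩

/-- The action groupoid `K ⋉ Z ⇉ Z`, with arrows `(k, x) : x → k • x`, presenting the quotient stack
`Z / K`. -/
def actionGroupoid (K Z : Type*) [Group K] [MulAction K Z] : GroupoidData Z (K × Z) where
  s p := p.2
  t p := p.1 • p.2
  u x := (1, x)
  i p := (p.1⁻¹, p.1 • p.2)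
  m p q := (p.1 * q.1, q.2)

/-- The quotient of `Z` by `K` is a cosymplectic manifold: the topological orbit space `Z / K` is a
(Hausdorff, second countable) manifold carrying a cosymplectic structure, the projection
`π : Z → Z / K` is a submersion which pulls back this structure to `(σ, η)`, and `π` defines a Morita
map from the action groupoid to the unit groupoid of `Z / K`, that is, the manifold `Z / K`
represents the quotient stack. -/
def QuotientIsCosymplecticManifold {E : Type*} [NormedAddCommGroup E] [NormedSpace ℝ E]
    {F : Type*} [NormedAddCommGroup F] [NormedSpace ℝ F]
    (K : Type*) [Group K] [TopologicalSpace K] [ChartedSpace F K]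
    (Z : Type*) [TopologicalSpace Z] [ChartedSpace E Z] [MulAction K Z]
    (σ : Form 𝓘(ℝ, E) Z 2) (η : Form 𝓘(ℝ, E) Z 1) : Prop :=
  let π : Z → MulAction.orbitRel.Quotient K Z := Quotient.mk _
  T2Space (MulAction.orbitRel.Quotient K Z) ∧
  SecondCountableTopology (MulAction.orbitRel.Quotient K Z) ∧
  ∃ (d : ℕ) (_ : ChartedSpace (EuclideanSpace ℝ (Fin d)) (MulAction.orbitRel.Quotient K Z))
    (_ : IsManifold (𝓡 d) ∞ (MulAction.orbitRel.Quotient K Z))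
    (σQ : Form (𝓡 d) (MulAction.orbitRel.Quotient K Z) 2)
    (ηQ : Form (𝓡 d) (MulAction.orbitRel.Quotient K Z) 1),
    IsCosymplectic σQ ηQ ∧
    IsSubmersion 𝓘(ℝ, E) (𝓡 d) π ∧
    σ = Form.pullback π σQ ∧
    η = Form.pullback π ηQ ∧
    (actionGroupoid K Z).IsMoritaMap 𝓘(ℝ, E) (𝓘(ℝ, F).prod 𝓘(ℝ, E)) (𝓡 d) (𝓡 d)
      (unitGroupoid (MulAction.orbitRel.Quotient K Z)) π (fun p => π p.2)

/-! ### Hamiltonian actions -/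

section Hamiltonian

variable {E : Type*} [NormedAddCommGroup E] [NormedSpace ℝ E]
  {F : Type*} [NormedAddCommGroup F] [NormedSpace ℝ F]
  {K : Type*} [Group K] [TopologicalSpace K] [ChartedSpace F K]
  {M : Type*} [TopologicalSpace M] [ChartedSpace E M] [MulAction K M]

variable (M) in
/-- The fundamental vector field `ξ_M` of `ξ ∈ 𝔨 = T_1 K`: at `x`, the image of `ξ` under the
differential at `1` of `k ↦ k • x`. -/
def fundamentalField (ξ : GroupLieAlgebra 𝓘(ℝ, F) K) (x : M) : TangentSpace 𝓘(ℝ, E) x :=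
  derivTo 𝓘(ℝ, F) 𝓘(ℝ, E) (fun k : K => k • x) 1 x ξ

variable (F) in
/-- The adjoint representation: `Ad_k` is the differential at `1` of `h ↦ k h k⁻¹`. -/
def Ad (k : K) : GroupLieAlgebra 𝓘(ℝ, F) K →L[ℝ] GroupLieAlgebra 𝓘(ℝ, F) K :=
  derivTo 𝓘(ℝ, F) 𝓘(ℝ, F) (fun h : K => k * h * k⁻¹) 1 1

variable (F) in
/-- The dual `𝔨^*` of the Lie algebra `𝔨 = T_1 K`, as a normed space. The vector space underlying
`T_1 K` is `F`, the model space of `K`. -/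
abbrev LieAlgebraDual : Type _ := F →L[ℝ] ℝ

/-- The pairing of `𝔨^*` with `𝔨`. -/
def pair (α : LieAlgebraDual F) (ξ : GroupLieAlgebra 𝓘(ℝ, F) K) : ℝ := α (show F from ξ)

variable (K) in
/-- The (smooth) action of `K` on `M` preserves `σ` and `η` and is Hamiltonian with moment map
`μ : M → 𝔨^*`: for each `ξ ∈ 𝔨` one has `η(ξ_M) = 0` and `dμ^ξ = ι_{ξ_M} σ`, and `μ` is
`Ad^*`-equivariant. -/
structure IsHamiltonian (σ : Form 𝓘(ℝ, E) M 2) (η : Form 𝓘(ℝ, E) M 1)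
    (μ : M → LieAlgebraDual F) : Prop where
  preserves_two : ∀ k : K, Form.pullback (fun x : M => k • x) σ = σ
  preserves_one : ∀ k : K, Form.pullback (fun x : M => k • x) η = η
  smooth : ContMDiff 𝓘(ℝ, E) 𝓘(ℝ, LieAlgebraDual F) ∞ μ
  horizontal : ∀ (ξ : GroupLieAlgebra 𝓘(ℝ, F) K) (x : M), η x ![fundamentalField M ξ x] = 0
  hamilton : ∀ (ξ : GroupLieAlgebra 𝓘(ℝ, F) K) (x : M) (v : TangentSpace 𝓘(ℝ, E) x),
    mfderiv 𝓘(ℝ, E) 𝓘(ℝ, ℝ) (fun y => pair (μ y) ξ) x v = σ x ![fundamentalField M ξ x, v]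
  equivariant : ∀ (k : K) (x : M) (ξ : GroupLieAlgebra 𝓘(ℝ, F) K),
    pair (μ (k • x)) ξ = pair (μ x) (Ad F k⁻¹ ξ)

/-- The zero level `μ⁻¹(0)`, as a `K`-invariant subset of `M`. -/
def zeroLevel {σ : Form 𝓘(ℝ, E) M 2} {η : Form 𝓘(ℝ, E) M 1} {μ : M → LieAlgebraDual F}
    (h : IsHamiltonian K σ η μ) : SubMulAction K M where
  carrier := {x | μ x = 0}
  smul_mem' := by
    intro k x hx
    refine ContinuousLinearMap.ext fun ξ => ?_
    have := h.equivariant k x ξ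
    rw [show μ x = 0 from hx] at this
    exact this

end Hamiltonian

end Cosymp

end

/-!
The theorem rests on one linear-algebraic fact. At a point of `Z = μ⁻¹(0)` the moment map condition
`⟨dμ(v), ξ⟩ = ω(ξ_M, v)` identifies the `ω`-annihilator of `TZ = ker dμ` with the span of the
fundamental vectors `ξ_M` (`IsHamiltonian.exists_two_fundamentalField_eq`), up to the kernel of `ω`,
which the condition `η = 0` removes. So the common kernel of `ω|_Z` and `η|_Z` is the tangent space
of the orbit. Moreover the action is locally free, because `dμ` is onto, and the Reeb vectors of `M`
are tangent to `Z`. These properties make up `IsTransverselyCosymplectic`, proved for the zero level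
in `IsHamiltonian.isTransverselyCosymplectic_zeroLevel`; everything else follows from them for an
arbitrary manifold `Z` with a smooth action.

* *The zero level.* `Z` is an embedded submanifold by the regular value theorem
  `exists_isRegularEmbedding_of_regular`, which rests on the inverse function theorem
  `isLocalDiffeomorphAt_of_bijective_mfderiv`. The same theorem produces all other submanifolds that
  are needed.
* *The action groupoid.* Invariant forms which annihilate the orbit directions are basic. The anchor
  is injective, and its image is the kernel of the Lichnerowicz map `♭`; as `♭` takes values in the
  annihilator of this image, equality of dimensions makes it a quasi-isomorphism
  (`isQuasiIso_of_range_eq_ker`, `IsTransverselyCosymplectic.isZeroShiftedCosymplectic`).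
* *Proper actions.* A locally free action has slices (`exists_slice`). The disjoint union `X` of
  countably many of them is a complete transversal to the orbits (`exists_isCompleteTransversal`).
  The groupoid of triples `(x, k, y)` with `k • x = y` in `Z` is étale by transversality, proper as a
  pullback of the action groupoid, and Morita equivalent to it, and the forms restricted to `X` are
  nondegenerate (`IsCompleteTransversal.isCosymplecticOrbifold`).
* *Free and proper actions.* Small slices meet each orbit at most once, and are charts of the orbit
  space (`exists_isQuotientChart`, `exists_isOrbitManifold`). Two local lifts of a map to `Z/K` differ
  by a smooth map to `K` (`exists_contMDiffAt_smul_eq`), so that a basic form has the same pullback by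
  both and descends (`IsOrbitManifold.exists_pullback_eq`). The action groupoid is the groupoid of
  pairs with the same projection, hence Morita equivalent to the unit groupoid of `Z/K`
  (`IsOrbitManifold.isMoritaMap`).
-/

noncomputable section

set_option linter.unusedSectionVars false

namespace Cosymp

/-! ### Pullbacks of differential forms -/

section Alternating

variable {E F G X : Type*} [NormedAddCommGroup E] [NormedSpace ℝ E]
  [NormedAddCommGroup F] [NormedSpace ℝ F] [NormedAddCommGroup G] [NormedSpace ℝ G]
  [NormedAddCommGroup X] [NormedSpace ℝ X] {k : ℕ}

variable (E F k) in
/-- The alternatization of continuous multilinear maps, as a continuous linear map. -/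
def alternatizationCLM :
    ContinuousMultilinearMap ℝ (fun _ : Fin k => E) F →L[ℝ] E [⋀^Fin k]→L[ℝ] F :=
  LinearMap.mkContinuous
    { toFun := ContinuousMultilinearMap.alternatization
      map_add' := map_add _
      map_smul' := by
        intro c f
        ext v
        simp [ContinuousMultilinearMap.alternatization_apply_apply, Finset.smul_sum,
          smul_comm c] }
    (Fintype.card (Equiv.Perm (Fin k)))
    (by
      intro f
      refine ContinuousAlternatingMap.opNorm_le_bound _ (by positivity) fun v => ?_
      simp only [LinearMap.coe_mk, AddHom.coe_mk,
        ContinuousMultilinearMap.alternatization_apply_apply]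
      refine (norm_sum_le _ _).trans ?_
      refine (Finset.sum_le_card_nsmul _ _ (‖f‖ * ∏ i, ‖v i‖) fun τ _ => ?_).trans_eq ?_
      · have h1 : ‖Equiv.Perm.sign τ • f (v ∘ τ)‖ = ‖f (v ∘ τ)‖ := by
          rcases Int.units_eq_one_or (Equiv.Perm.sign τ) with h | h <;> simp [h]
        rw [h1, ← Equiv.prod_comp τ fun i => ‖v i‖]
        exact f.le_opNorm _
      · rw [nsmul_eq_mul, Finset.card_univ, mul_assoc])

/-- The pullback of an alternating map along a linear map depends smoothly on both: after the
inclusion into multilinear maps, which has a continuous left inverse, it is multilinear. -/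
theorem _root_.ContDiffAt.continuousAlternatingMapCompContinuousLinearMap
    {f : X → F [⋀^Fin k]→L[ℝ] G} {g : X → E →L[ℝ] F} {x : X} {n : WithTop ℕ∞}
    (hf : ContDiffAt ℝ n f x) (hg : ContDiffAt ℝ n g x) :
    ContDiffAt ℝ n (fun x => (f x).compContinuousLinearMap (g x)) x := by
  have h1 : ContDiffAt ℝ n (fun x => (ContinuousMultilinearMap.compContinuousLinearMapL
      (fun _ : Fin k => g x) (F := G)) ((f x).toContinuousMultilinearMap)) x := by
    refine ContDiffAt.clm_apply ?_ ?_
    · exact ((ContinuousMultilinearMap.compContinuousLinearMapContinuousMultilinear ℝ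
        (fun _ : Fin k => E) (fun _ : Fin k => F) G).contDiff).contDiffAt.comp x
        (contDiffAt_pi.2 fun _ => hg)
    · exact ((ContinuousAlternatingMap.toContinuousMultilinearMapCLM ℝ :
        F [⋀^Fin k]→L[ℝ] G →L[ℝ] _)).contDiff.contDiffAt.comp x hf
  have h2 := (((k.factorial : ℝ)⁻¹ • alternatizationCLM E G k).contDiff
    (n := n)).contDiffAt.comp x h1
  refine h2.congr_of_eventuallyEq (Filter.Eventually.of_forall fun y => ?_)
  ext v
  have hσ : ∀ τ : Equiv.Perm (Fin k), Equiv.Perm.sign τ • f y (g y ∘ v ∘ τ) = f y (g y ∘ v) := by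
    intro τ
    have := (f y).toAlternatingMap.map_perm (g y ∘ v) τ
    change Equiv.Perm.sign τ • (f y).toAlternatingMap ((g y ∘ v) ∘ τ) = _
    rw [this, smul_smul]
    simp
  have : (k.factorial : ℝ) ≠ 0 := by positivity
  change f y (g y ∘ v) = (k.factorial : ℝ)⁻¹ • (ContinuousMultilinearMap.alternatization _) v
  rw [ContinuousMultilinearMap.alternatization_apply_apply]
  change _ = (k.factorial : ℝ)⁻¹ • ∑ τ : Equiv.Perm (Fin k),
    Equiv.Perm.sign τ • f y (g y ∘ v ∘ τ)
  rw [Finset.sum_congr rfl fun τ _ => hσ τ, Finset.sum_const, Finset.card_univ,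
    Fintype.card_perm, Fintype.card_fin, ← Nat.cast_smul_eq_nsmul ℝ, smul_smul,
    inv_mul_cancel₀ this, one_smul]

end Alternating

section Pullback

variable {E : Type*} [NormedAddCommGroup E] [NormedSpace ℝ E] {H : Type*} [TopologicalSpace H]
  {E' : Type*} [NormedAddCommGroup E'] [NormedSpace ℝ E'] {H' : Type*} [TopologicalSpace H']
  {E'' : Type*} [NormedAddCommGroup E''] [NormedSpace ℝ E''] {H'' : Type*} [TopologicalSpace H'']
  {I : ModelWithCorners ℝ E H} {I' : ModelWithCorners ℝ E' H'} {I'' : ModelWithCorners ℝ E'' H''}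
  {M : Type*} [TopologicalSpace M] [ChartedSpace H M]
  {N : Type*} [TopologicalSpace N] [ChartedSpace H' N]
  {P : Type*} [TopologicalSpace P] [ChartedSpace H'' P] {k : ℕ}

theorem Form.pullback_apply (f : M → N) (α : Form I' N k) (x : M) (v : Fin k → TangentSpace I x) :
    Form.pullback f α x v = α (f x) (fun i => mfderiv I I' f x (v i)) := rfl

theorem Form.pullback_congr {f g : M → N} {x : M} (h : f =ᶠ[𝓝 x] g) (α : Form I' N k) :
    (Form.pullback f α : Form I M k) x = Form.pullback g α x := by
  have hd : derivTo I I' f x (f x) = derivTo I I' g x (f x) := h.mfderiv_eq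
  have hx : f x = g x := h.eq_of_nhds
  have key : ∀ y : N, f x = y →
      (α (f x)).compContinuousLinearMap (derivTo I I' g x (f x)) =
        (α y).compContinuousLinearMap (derivTo I I' g x y) := by
    rintro y rfl; rfl
  refine Eq.trans ?_ (key (g x) hx)
  exact congrArg (fun L => (α (f x)).compContinuousLinearMap L) hd

theorem Form.pullback_comp_apply {f : M → N} {g : N → P} {x : M}
    (hg : MDifferentiableAt I' I'' g (f x)) (hf : MDifferentiableAt I I' f x)
    (α : Form I'' P k) :
    (Form.pullback (g ∘ f) α : Form I M k) x
      = Form.pullback f (Form.pullback g α : Form I' N k) x := by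
  ext v
  rw [Form.pullback_apply, Form.pullback_apply, Form.pullback_apply, mfderiv_comp x hg hf]
  rfl

theorem Form.pullback_comp {f : M → N} {g : N → P}
    (hg : MDifferentiable I' I'' g) (hf : MDifferentiable I I' f) (α : Form I'' P k) :
    (Form.pullback (g ∘ f) α : Form I M k) = Form.pullback f (Form.pullback g α : Form I' N k) :=
  funext fun x => Form.pullback_comp_apply (hg _) (hf x) α

theorem Form.pullback_id (α : Form I M k) : (Form.pullback id α : Form I M k) = α := by
  funext x
  ext v
  rw [Form.pullback_apply, mfderiv_id]
  rfl

end Pullback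

section Closed

variable {E : Type*} [NormedAddCommGroup E] [NormedSpace ℝ E]
  {E' : Type*} [NormedAddCommGroup E'] [NormedSpace ℝ E']
  {M : Type*} [TopologicalSpace M] [ChartedSpace E M] [IsManifold 𝓘(ℝ, E) ∞ M]
  {M' : Type*} [TopologicalSpace M'] [ChartedSpace E' M'] [IsManifold 𝓘(ℝ, E') ∞ M'] {k : ℕ}

/-- Locally, the pullback of a form along a map defined on a vector space is the pullback of its
expression in a chart. -/
theorem Form.pullback_eventuallyEq_inChart {f : E' → M} {y : E'}
    (hf : ContMDiffAt 𝓘(ℝ, E') 𝓘(ℝ, E) ∞ f y) (α : Form 𝓘(ℝ, E) M k) :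
    (Form.pullback f α : Form 𝓘(ℝ, E') E' k) =ᶠ[𝓝 y]
      fun z => (α.inChart (f y) ((chartAt E (f y) ∘ f) z)).compContinuousLinearMap
        (fderiv ℝ (chartAt E (f y) ∘ f) z) := by
  have hev := (contMDiffAt_iff_contMDiffAt_nhds (n := 1) (by simp)).1
    (hf.of_le (by simp))
  have hsrc : ∀ᶠ z in 𝓝 y, f z ∈ (chartAt E (f y)).source :=
    hf.continuousAt.eventually ((chartAt E (f y)).open_source.mem_nhds (mem_chart_source _ _))
  filter_upwards [hev, hsrc.eventually_nhds] with z hz hs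
  have h1 : (Form.pullback f α : Form 𝓘(ℝ, E') E' k) z =
      Form.pullback ((chartAt E (f y)).symm ∘ (chartAt E (f y) ∘ f)) α z := by
    refine Form.pullback_congr ?_ α
    filter_upwards [hs] with w hw
    exact ((chartAt E (f y)).left_inv hw).symm
  have hs0 := hs.self_of_nhds
  have hc : MDifferentiableAt 𝓘(ℝ, E) 𝓘(ℝ, E) (chartAt E (f y)) (f z) :=
    mdifferentiableAt_atlas (chart_mem_atlas _ _) hs0
  have hcs : MDifferentiableAt 𝓘(ℝ, E) 𝓘(ℝ, E) (chartAt E (f y)).symm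
      ((chartAt E (f y) ∘ f) z) :=
    mdifferentiableAt_atlas_symm (chart_mem_atlas _ _) ((chartAt E (f y)).map_source hs0)
  have h2 := Form.pullback_comp_apply (x := z) (f := chartAt E (f y) ∘ f) hcs
    (hc.comp z (hz.mdifferentiableAt (by simp))) α
  rw [h1]
  refine h2.trans ?_
  ext v
  rw [Form.pullback_apply, mfderiv_eq_fderiv]
  rfl

theorem Form.IsSmooth.contDiffOn_pullback {α : Form 𝓘(ℝ, E) M k} (hα : α.IsSmooth)
    {f : E' → M} {U : Set E'} (hU : IsOpen U) (hf : ContMDiffOn 𝓘(ℝ, E') 𝓘(ℝ, E) ∞ f U) :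
    ContDiffOn ℝ ∞ (show E' → E' [⋀^Fin k]→L[ℝ] ℝ from (Form.pullback f α : Form 𝓘(ℝ, E') E' k)) U := by
  intro y hy
  have hfy := hf.contMDiffAt (hU.mem_nhds hy)
  refine ContDiffAt.contDiffWithinAt (ContDiffAt.congr_of_eventuallyEq ?_
    (Form.pullback_eventuallyEq_inChart hfy α))
  have hg : ContDiffAt ℝ ∞ (chartAt E (f y) ∘ f) y := by
    rw [← contMDiffAt_iff_contDiffAt]
    exact ((contMDiffOn_chart (I := 𝓘(ℝ, E))).contMDiffAt
      ((chartAt E (f y)).open_source.mem_nhds (mem_chart_source _ _))).comp y hfy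
  have hα' : ContDiffAt ℝ ∞ (α.inChart (f y)) ((chartAt E (f y) ∘ f) y) :=
    (hα (f y)).contDiffAt ((chartAt E (f y)).open_target.mem_nhds (mem_chart_target _ _))
  have h1 := hα'.comp y hg
  have h2 : ContDiffAt ℝ ∞ (fderiv ℝ (chartAt E (f y) ∘ f)) y := hg.fderiv_right (by simp)
  exact h1.continuousAlternatingMapCompContinuousLinearMap h2

/-- As pullback commutes with the exterior derivative of forms on vector spaces, the pullback of a
closed form by a map defined on a vector space is closed wherever that map is smooth. -/
theorem Form.IsClosed.extDeriv_pullback {α : Form 𝓘(ℝ, E) M k} (hα : α.IsSmooth)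
    (hcl : α.IsClosed)
    {f : E' → M} {y : E'} (hfy : ContMDiffAt 𝓘(ℝ, E') 𝓘(ℝ, E) ∞ f y) :
    extDeriv (show E' → E' [⋀^Fin k]→L[ℝ] ℝ from (Form.pullback f α : Form 𝓘(ℝ, E') E' k)) y = 0 := by
  rw [(Form.pullback_eventuallyEq_inChart hfy α).extDeriv_eq]
  have hg : ContDiffAt ℝ ∞ (chartAt E (f y) ∘ f) y := by
    rw [← contMDiffAt_iff_contDiffAt]
    exact ((contMDiffOn_chart (I := 𝓘(ℝ, E))).contMDiffAt
      ((chartAt E (f y)).open_source.mem_nhds (mem_chart_source _ _))).comp y hfy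
  have hα' : ContDiffAt ℝ ∞ (α.inChart (f y)) ((chartAt E (f y) ∘ f) y) :=
    (hα (f y)).contDiffAt ((chartAt E (f y)).open_target.mem_nhds (mem_chart_target _ _))
  have h0 : extDeriv (α.inChart (f y)) ((chartAt E (f y) ∘ f) y) = 0 :=
    hcl (f y) _ (mem_chart_target _ _)
  rw [_root_.extDeriv_pullback (hα'.differentiableAt (by simp)) hg
    (by simpa using (WithTop.coe_le_coe.2 (le_top (a := (2 : ℕ∞))))), h0]
  rfl

/-- The coordinate expression of a pulled back form is the pullback by the coordinate expression of
the map. -/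
theorem Form.inChart_pullback {α : Form 𝓘(ℝ, E) M k} {f : M' → M}
    (hf : ContMDiff 𝓘(ℝ, E') 𝓘(ℝ, E) ∞ f) (x₀ : M') {y : E'} (hy : y ∈ (chartAt E' x₀).target) :
    (Form.pullback f α : Form 𝓘(ℝ, E') M' k).inChart x₀ y =
      (Form.pullback (f ∘ (chartAt E' x₀).symm) α : Form 𝓘(ℝ, E') E' k) y :=
  (Form.pullback_comp_apply (hf.mdifferentiable (by simp) _)
    (mdifferentiableAt_atlas_symm (chart_mem_atlas _ _) hy) α).symm

theorem contMDiffOn_comp_chartAt_symm {f : M' → M} (hf : ContMDiff 𝓘(ℝ, E') 𝓘(ℝ, E) ∞ f)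
    (x₀ : M') :
    ContMDiffOn 𝓘(ℝ, E') 𝓘(ℝ, E) ∞ (f ∘ (chartAt E' x₀).symm) (chartAt E' x₀).target :=
  hf.comp_contMDiffOn contMDiffOn_chart_symm

theorem Form.IsSmooth.pullback {α : Form 𝓘(ℝ, E) M k} (hα : α.IsSmooth) {f : M' → M}
    (hf : ContMDiff 𝓘(ℝ, E') 𝓘(ℝ, E) ∞ f) :
    (Form.pullback f α : Form 𝓘(ℝ, E') M' k).IsSmooth := fun x₀ =>
  (hα.contDiffOn_pullback (chartAt E' x₀).open_target
    (contMDiffOn_comp_chartAt_symm hf x₀)).congr fun _ hy => Form.inChart_pullback hf x₀ hy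

theorem Form.IsClosed.pullback {α : Form 𝓘(ℝ, E) M k} (hα : α.IsSmooth) (hcl : α.IsClosed)
    {f : M' → M} (hf : ContMDiff 𝓘(ℝ, E') 𝓘(ℝ, E) ∞ f) :
    (Form.pullback f α : Form 𝓘(ℝ, E') M' k).IsClosed := by
  intro x₀ y hy
  have hnhds := (chartAt E' x₀).open_target.mem_nhds hy
  have h : (Form.pullback f α : Form 𝓘(ℝ, E') M' k).inChart x₀ =ᶠ[𝓝 y]
      (Form.pullback (f ∘ (chartAt E' x₀).symm) α : Form 𝓘(ℝ, E') E' k) := by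
    filter_upwards [hnhds] with z hz
    exact Form.inChart_pullback hf x₀ hz
  rw [h.extDeriv_eq]
  exact Form.IsClosed.extDeriv_pullback hα hcl
    ((contMDiffOn_comp_chartAt_symm hf x₀).contMDiffAt hnhds)

end Closed

/-! ### The inverse function theorem on manifolds -/

section InverseFunction

/-- The inverse function theorem, giving an inverse that is smooth on an open set: a map which is
smooth on an open set and has an invertible derivative at one of its points is a local
diffeomorphism there. -/
theorem exists_openPartialHomeomorph_of_bijective_fderiv {E F : Type*} [NormedAddCommGroup E]
    [NormedSpace ℝ E] [FiniteDimensional ℝ E] [NormedAddCommGroup F] [NormedSpace ℝ F]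
    {f : E → F} {U : Set E} (hU : IsOpen U)
    (hf : ContDiffOn ℝ ∞ f U) {a : E} (ha : a ∈ U)
    (hb : Function.Bijective (fderiv ℝ f a)) :
    ∃ Φ : OpenPartialHomeomorph E F, a ∈ Φ.source ∧ Φ.source ⊆ U ∧ (∀ x, Φ x = f x) ∧
      ContDiffOn ℝ ∞ Φ.symm Φ.target := by
  have hFfin : FiniteDimensional ℝ F :=
    Module.Finite.of_surjective (fderiv ℝ f a).toLinearMap hb.2
  have hfa : ContDiffAt ℝ ∞ f a := hf.contDiffAt (hU.mem_nhds ha)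
  let e : E ≃L[ℝ] F := (LinearEquiv.ofBijective (fderiv ℝ f a).toLinearMap hb).toContinuousLinearEquiv
  have he : (e : E →L[ℝ] F) = fderiv ℝ f a := by ext; rfl
  have hd : HasFDerivAt f (e : E →L[ℝ] F) a := by
    rw [he]; exact (hfa.differentiableAt (by simp)).hasFDerivAt
  let Φ₀ := hfa.toOpenPartialHomeomorph f hd (by simp)
  -- near `a` the derivative stays invertible
  have hcont : ContinuousOn (fderiv ℝ f) U := hf.continuousOn_fderiv_of_isOpen hU (by simp)
  have hnear : ∀ᶠ x in 𝓝 a, x ∈ U ∧ fderiv ℝ f x ∈ range ((↑) : (E ≃L[ℝ] F) → E →L[ℝ] F) := by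
    have h1 := (hcont.continuousAt (hU.mem_nhds ha)).eventually
      (he ▸ ContinuousLinearEquiv.nhds e)
    filter_upwards [hU.mem_nhds ha, h1] with x hx hx' using ⟨hx, hx'⟩
  obtain ⟨W, hWsub, hWo, haW⟩ := mem_nhds_iff.1 hnear
  refine ⟨Φ₀.restrOpen W hWo, ⟨hfa.mem_toOpenPartialHomeomorph_source hd (by simp), haW⟩,
    fun x hx => (hWsub hx.2).1, fun x => rfl, ?_⟩
  intro y hy
  have hy' : (Φ₀.restrOpen W hWo).symm y ∈ (Φ₀.restrOpen W hWo).source :=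
    (Φ₀.restrOpen W hWo).map_target hy
  obtain ⟨hU', e', he'⟩ := hWsub hy'.2
  have hfy := hf.contDiffAt (hU.mem_nhds hU')
  have hd' : HasFDerivAt f (e' : E →L[ℝ] F) ((Φ₀.restrOpen W hWo).symm y) := by
    rw [he']; exact (hfy.differentiableAt (by simp)).hasFDerivAt
  exact ((Φ₀.restrOpen W hWo).contDiffAt_symm hy hd' hfy).contDiffWithinAt

variable {E : Type*} [NormedAddCommGroup E] [NormedSpace ℝ E] [FiniteDimensional ℝ E]
  {H : Type*} [TopologicalSpace H]
  {E' : Type*} [NormedAddCommGroup E'] [NormedSpace ℝ E'] {H' : Type*} [TopologicalSpace H']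
  {I : ModelWithCorners ℝ E H} {I' : ModelWithCorners ℝ E' H'}
  [I.Boundaryless] [I'.Boundaryless]
  {M : Type*} [TopologicalSpace M] [ChartedSpace H M] [IsManifold I ∞ M]
  {N : Type*} [TopologicalSpace N] [ChartedSpace H' N] [IsManifold I' ∞ N]

/-- The extended chart at a point of a manifold without boundary is a partial diffeomorphism. -/
def extChartDiffeo (I : ModelWithCorners ℝ E H) [I.Boundaryless] [IsManifold I ∞ M] (x : M) :
    PartialDiffeomorph I 𝓘(ℝ, E) M E ∞ where
  toPartialEquiv := extChartAt I x
  open_source := isOpen_extChartAt_source x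
  open_target := isOpen_extChartAt_target x
  contMDiffOn_toFun := by
    rw [extChartAt_source]
    exact contMDiffOn_extChartAt
  contMDiffOn_invFun := contMDiffOn_extChartAt_symm x

/-- The inverse function theorem for maps between manifolds without boundary. -/
theorem isLocalDiffeomorphAt_of_bijective_mfderiv {f : M → N} {U : Set M} (hU : IsOpen U)
    (hf : ContMDiffOn I I' ∞ f U) {x : M} (hx : x ∈ U)
    (hb : Function.Bijective (mfderiv I I' f x)) : IsLocalDiffeomorphAt I I' ∞ f x := by
  let φ := extChartDiffeo I x
  have hxφ : x ∈ φ.source := mem_extChartAt_source x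
  have hφs : φ.symm (φ x) = x := φ.left_inv hxφ
  have hfx := hf.contMDiffAt (hU.mem_nhds hx)
  have hmf := hfx.mdifferentiableAt (by simp)
  let ψ := extChartDiffeo I' (f x)
  have hfψ : f x ∈ ψ.source := mem_extChartAt_source (f x)
  let g : E → E' := fun z => ψ (f (φ.symm z))
  let V : Set E := φ.target ∩ φ.symm ⁻¹' (U ∩ f ⁻¹' ψ.source)
  have hUf : IsOpen (U ∩ f ⁻¹' ψ.source) :=
    hf.continuousOn.isOpen_inter_preimage hU ψ.open_source
  have hV : IsOpen V :=
    φ.symm.contMDiffOn.continuousOn.isOpen_inter_preimage φ.open_target hUf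
  have hgV : ContDiffOn ℝ ∞ g V := by
    rw [← contMDiffOn_iff_contDiffOn]
    refine ψ.contMDiffOn.comp (hf.comp (φ.symm.contMDiffOn.mono inter_subset_left) ?_) ?_
    · exact fun z hz => hz.2.1
    · exact fun z hz => hz.2.2
  have haV : φ x ∈ V := by
    refine ⟨φ.map_source hxφ, ?_⟩
    rw [mem_preimage, hφs]
    exact ⟨hx, hfψ⟩
  have hbij : Function.Bijective (fderiv ℝ g (φ x)) := by
    rw [← mfderiv_eq_fderiv]
    have h1 : IsLocalDiffeomorphAt 𝓘(ℝ, E) I ∞ φ.symm (φ x) :=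
      φ.symm.isLocalDiffeomorphAt _ _ _ (φ.map_source hxφ)
    have h2 : IsLocalDiffeomorphAt I' 𝓘(ℝ, E') ∞ ψ (f x) := ψ.isLocalDiffeomorphAt _ _ _ hfψ
    have h1b : Function.Bijective (mfderiv 𝓘(ℝ, E) I φ.symm (φ x)) := by
      rw [← h1.mfderivToContinuousLinearEquiv_coe (by simp)]
      exact (h1.mfderivToContinuousLinearEquiv (by simp)).bijective
    have h2b : Function.Bijective (mfderiv I' 𝓘(ℝ, E') ψ (f x)) := by
      rw [← h2.mfderivToContinuousLinearEquiv_coe (by simp)]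
      exact (h2.mfderivToContinuousLinearEquiv (by simp)).bijective
    have e1 : mfderiv 𝓘(ℝ, E) 𝓘(ℝ, E') g (φ x) = (mfderiv I' 𝓘(ℝ, E') ψ (f x)).comp
        ((mfderiv I I' f x).comp (mfderiv 𝓘(ℝ, E) I φ.symm (φ x))) := by
      have hf' : HasMFDerivAt I I' f (φ.symm (φ x)) (mfderiv I I' f x) := by
        rw [hφs]; exact hmf.hasMFDerivAt
      have hψ' : HasMFDerivAt I' 𝓘(ℝ, E') ψ (f (φ.symm (φ x))) (mfderiv I' 𝓘(ℝ, E') ψ (f x)) := by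
        rw [hφs]; exact (h2.mdifferentiableAt (by simp)).hasMFDerivAt
      exact (hψ'.comp (f := f ∘ φ.symm) _ (hf'.comp _ (h1.mdifferentiableAt (by simp)).hasMFDerivAt)).mfderiv
    rw [e1]
    exact h2b.comp (hb.comp h1b)
  obtain ⟨Φ, haΦ, hΦV, hΦg, hΦs⟩ := exists_openPartialHomeomorph_of_bijective_fderiv hV hgV haV hbij
  let Φ' : PartialDiffeomorph 𝓘(ℝ, E) 𝓘(ℝ, E') E E' ∞ :=
    { Φ.toPartialEquiv with
      open_source := Φ.open_source
      open_target := Φ.open_target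
      contMDiffOn_toFun := by
        rw [contMDiffOn_iff_contDiffOn]
        exact (hgV.mono hΦV).congr fun z _ => hΦg z
      contMDiffOn_invFun := by
        rw [contMDiffOn_iff_contDiffOn]
        exact hΦs }
  refine ⟨(φ.trans Φ').trans ψ.symm, ⟨⟨hxφ, haΦ⟩, ?_⟩, ?_⟩
  · change Φ (φ x) ∈ ψ.target
    rw [hΦg]
    change ψ (f (φ.symm (φ x))) ∈ _
    rw [hφs]
    exact ψ.map_source hfψ
  · intro z hz
    have hz1 : z ∈ φ.source := hz.1.1
    have hz2 : φ z ∈ Φ.source := hz.1.2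
    change f z = ψ.symm (Φ (φ z))
    rw [hΦg]
    change f z = ψ.symm (ψ (f (φ.symm (φ z))))
    have h3 := (hΦV hz2).2.2
    change f (φ.symm (φ z)) ∈ ψ.source at h3
    have : φ.symm (φ z) = z := φ.left_inv hz1
    rw [this] at h3 ⊢
    exact (ψ.left_inv h3).symm

end InverseFunction

/-! ### Embedded submanifolds -/

section Submanifold

instance {E : Type*} [NormedAddCommGroup E] [NormedSpace ℝ E] [FiniteDimensional ℝ E]
    {H : Type*} [TopologicalSpace H] (I : ModelWithCorners ℝ E H)
    {M : Type*} [TopologicalSpace M] [ChartedSpace H M] (x : M) :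
    FiniteDimensional ℝ (TangentSpace I x) :=
  inferInstanceAs (FiniteDimensional ℝ E)

variable {E : Type*} [NormedAddCommGroup E] [NormedSpace ℝ E]
  {H : Type*} [TopologicalSpace H]
  {E' : Type*} [NormedAddCommGroup E'] [NormedSpace ℝ E'] {H' : Type*} [TopologicalSpace H']
  {E'' : Type*} [NormedAddCommGroup E''] [NormedSpace ℝ E''] {H'' : Type*} [TopologicalSpace H'']
  {I : ModelWithCorners ℝ E H} {I' : ModelWithCorners ℝ E' H'} {I'' : ModelWithCorners ℝ E'' H''}
  {M : Type*} [TopologicalSpace M] [ChartedSpace H M]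
  {N : Type*} [TopologicalSpace N] [ChartedSpace H' N]
  {P : Type*} [TopologicalSpace P] [ChartedSpace H'' P]

/-- Bijectivity of the differential of a local diffeomorphism. -/
theorem bijective_mfderiv_of_isLocalDiffeomorphAt {f : M → N} {x : M}
    (h : IsLocalDiffeomorphAt I I' ∞ f x) : Function.Bijective (mfderiv I I' f x) := by
  rw [← h.mfderivToContinuousLinearEquiv_coe (by simp)]
  exact (h.mfderivToContinuousLinearEquiv (by simp)).bijective

/-- The restriction of a partial diffeomorphism to an open set. -/
def restrDiffeo (Φ : PartialDiffeomorph I I' M N ∞) (s : Set M) (hs : IsOpen s) :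
    PartialDiffeomorph I I' M N ∞ :=
  { (Φ.toOpenPartialHomeomorph.restrOpen s hs).toPartialEquiv with
    open_source := (Φ.toOpenPartialHomeomorph.restrOpen s hs).open_source
    open_target := (Φ.toOpenPartialHomeomorph.restrOpen s hs).open_target
    contMDiffOn_toFun := Φ.contMDiffOn_toFun.mono inter_subset_left
    contMDiffOn_invFun := Φ.contMDiffOn_invFun.mono inter_subset_left }

theorem restrDiffeo_source (Φ : PartialDiffeomorph I I' M N ∞) (s : Set M) (hs : IsOpen s) :
    (restrDiffeo Φ s hs).source = Φ.source ∩ s := rfl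

/-- The charted space given by one chart around each point. -/
abbrev chartedSpaceOfCharts {S : Type*} [TopologicalSpace S]
    (c : S → OpenPartialHomeomorph S E) (hc : ∀ x, x ∈ (c x).source) : ChartedSpace E S where
  atlas := range c
  chartAt := c
  mem_chart_source := hc
  chart_mem_atlas := mem_range_self

theorem isManifold_chartedSpaceOfCharts {S : Type*} [TopologicalSpace S]
    (c : S → OpenPartialHomeomorph S E) (hc : ∀ x, x ∈ (c x).source)
    (h : ∀ x y, ContDiffOn ℝ ∞ (c y ∘ (c x).symm) ((c x).target ∩ (c x).symm ⁻¹' (c y).source)) :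
    let := chartedSpaceOfCharts c hc
    IsManifold 𝓘(ℝ, E) ∞ S := by
  let := chartedSpaceOfCharts c hc
  refine isManifold_of_contDiffOn _ _ _ ?_
  rintro _ _ ⟨x, rfl⟩ ⟨y, rfl⟩
  simpa using h x y

/-- An embedding `ι : P → N` which locally has smooth left inverses: every chart of `P` is locally
of the form `p ∘ ι` with `p` smooth on an open set of `N`. -/
structure IsRegularEmbedding (I'' : ModelWithCorners ℝ E'' H'') (I' : ModelWithCorners ℝ E' H')
    (ι : P → N) : Prop where
  contMDiff : ContMDiff I'' I' ∞ ι
  isEmbedding : Topology.IsEmbedding ι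
  retraction : ∀ x, ∃ p : N → E'', ContMDiffAt I' 𝓘(ℝ, E'') ∞ p (ι x) ∧
    p ∘ ι =ᶠ[𝓝 x] extChartAt I'' x

/-- A map into a regularly embedded manifold is smooth as soon as its composite with the embedding
is: continuity comes from the embedding, and smoothness from the local retractions. -/
theorem IsRegularEmbedding.contMDiffWithinAt {ι : P → N} (h : IsRegularEmbedding I'' I' ι)
    {f : M → P} {s : Set M} {x : M} (hf : ContMDiffWithinAt I I' ∞ (ι ∘ f) s x) :
    ContMDiffWithinAt I I'' ∞ f s x := by
  rw [contMDiffWithinAt_iff_target]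
  have hc : ContinuousWithinAt f s x := h.isEmbedding.continuousWithinAt_iff.2 hf.continuousWithinAt
  refine ⟨hc, ?_⟩
  obtain ⟨p, hp, he⟩ := h.retraction (f x)
  have h1 : ContMDiffWithinAt I 𝓘(ℝ, E'') ∞ (p ∘ (ι ∘ f)) s x :=
    ContMDiffAt.comp_contMDiffWithinAt x hp hf
  refine h1.congr_of_eventuallyEq ?_ ?_
  · filter_upwards [hc.eventually he] with y hy using hy.symm
  · exact he.eq_of_nhds.symm

theorem IsRegularEmbedding.contMDiffAt {ι : P → N} (h : IsRegularEmbedding I'' I' ι)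
    {f : M → P} {x : M} (hf : ContMDiffAt I I' ∞ (ι ∘ f) x) : ContMDiffAt I I'' ∞ f x :=
  h.contMDiffWithinAt hf

theorem IsRegularEmbedding.contMDiff_of_comp {ι : P → N} (h : IsRegularEmbedding I'' I' ι)
    {f : M → P} (hf : ContMDiff I I' ∞ (ι ∘ f)) : ContMDiff I I'' ∞ f :=
  fun x => h.contMDiffAt (hf x)

theorem IsRegularEmbedding.injective_mfderiv [FiniteDimensional ℝ E''] [I''.Boundaryless]
    [IsManifold I'' ∞ P]
    {ι : P → N} (h : IsRegularEmbedding I'' I' ι) (x : P) :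
    Function.Injective (mfderiv I'' I' ι x) := by
  obtain ⟨p, hp, he⟩ := h.retraction x
  have h1 := mfderiv_comp x (hp.mdifferentiableAt (by simp))
    ((h.contMDiff x).mdifferentiableAt (by simp))
  have h2 : Function.Bijective (mfderiv I'' 𝓘(ℝ, E'') (extChartAt I'' x) x) :=
    bijective_mfderiv_of_isLocalDiffeomorphAt
      ((extChartDiffeo I'' x).isLocalDiffeomorphAt _ _ _ (mem_extChartAt_source x))
  intro v w hvw
  apply h2.1
  have h3 : ∀ u, mfderiv I'' 𝓘(ℝ, E'') (extChartAt I'' x) x u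
      = mfderiv I' 𝓘(ℝ, E'') p (ι x) (mfderiv I'' I' ι x u) := by
    intro u
    have := he.mfderiv_eq (I := I'') (I' := 𝓘(ℝ, E''))
    exact (DFunLike.congr_fun this u).symm.trans (DFunLike.congr_fun h1 u)
  rw [h3, h3, hvw]

theorem IsRegularEmbedding.toIsEmbedding [FiniteDimensional ℝ E''] [I''.Boundaryless]
    [IsManifold I'' ∞ P]
    {ι : P → N} (h : IsRegularEmbedding I'' I' ι) : IsEmbedding I'' I' ι :=
  ⟨h.contMDiff, h.injective_mfderiv, h.isEmbedding⟩

section SliceChart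

variable {V : Type*} [NormedAddCommGroup V] [NormedSpace ℝ V] {S : Set N}

open Classical in
/-- The chart of a subset `S` induced by a partial diffeomorphism `Φ` to `V × E` mapping `S` to
`0 × E`. -/
def sliceChart (Φ : PartialDiffeomorph I' 𝓘(ℝ, V × E) N (V × E) ∞) (x₀ : S)
    (hS : ∀ y ∈ Φ.source, y ∈ S ↔ (Φ y).1 = 0) : OpenPartialHomeomorph S E where
  toFun y := (Φ y).2
  invFun u := if h : Φ.symm (0, u) ∈ S then ⟨Φ.symm (0, u), h⟩ else x₀
  source := Subtype.val ⁻¹' Φ.source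
  target := {u | ((0 : V), u) ∈ Φ.target}
  map_source' := by
    intro y hy
    have h1 : (Φ y).1 = 0 := (hS y hy).1 y.2
    have h2 := Φ.map_source hy
    have h3 : ((0 : V), (Φ y).2) = Φ y := Prod.ext h1.symm rfl
    rw [mem_ofPred_eq, h3]
    exact h2
  map_target' := by
    intro u hu
    have h1 : Φ.symm (0, u) ∈ Φ.source := Φ.map_target hu
    have h2 : Φ.symm (0, u) ∈ S := by
      rw [hS _ h1]
      have : Φ (Φ.symm (0, u)) = (0, u) := Φ.right_inv hu
      rw [this]
    rw [mem_preimage, dif_pos h2]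
    exact h1
  left_inv' := by
    intro y hy
    have h1 : (Φ y).1 = 0 := (hS y hy).1 y.2
    have h3 : ((0 : V), (Φ y).2) = Φ y := Prod.ext h1.symm rfl
    have h4 : Φ.symm (0, (Φ y).2) = y := by rw [h3]; exact Φ.left_inv hy
    have h5 : Φ.symm (0, (Φ y).2) ∈ S := by rw [h4]; exact y.2
    rw [dif_pos h5]
    exact Subtype.ext h4
  right_inv' := by
    intro u hu
    have h1 : Φ.symm (0, u) ∈ Φ.source := Φ.map_target hu
    have h0 : Φ (Φ.symm (0, u)) = (0, u) := Φ.right_inv hu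
    have h2 : Φ.symm (0, u) ∈ S := by
      rw [hS _ h1, h0]
    rw [dif_pos h2, h0]
  open_source := Φ.open_source.preimage continuous_subtype_val
  open_target := Φ.open_target.preimage (by fun_prop)
  continuousOn_toFun := continuous_snd.comp_continuousOn
    (Φ.contMDiffOn.continuousOn.comp continuous_subtype_val.continuousOn fun _ h => h)
  continuousOn_invFun := by
    rw [IsEmbedding.subtypeVal.continuousOn_iff]
    have h1 : ContinuousOn (fun u : E => Φ.symm ((0 : V), u)) {u | ((0 : V), u) ∈ Φ.target} :=
      Φ.symm.contMDiffOn.continuousOn.comp (by fun_prop) fun _ h => h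
    refine h1.congr fun u hu => ?_
    have h1 : Φ.symm (0, u) ∈ Φ.source := Φ.map_target hu
    have h0 : Φ (Φ.symm (0, u)) = (0, u) := Φ.right_inv hu
    have h2 : Φ.symm (0, u) ∈ S := by
      rw [hS _ h1, h0]
    rw [Function.comp_apply, dif_pos h2]

variable (Φ : PartialDiffeomorph I' 𝓘(ℝ, V × E) N (V × E) ∞) (x₀ : S)
    (hS : ∀ y ∈ Φ.source, y ∈ S ↔ (Φ y).1 = 0)

/-- The inverse of a slice chart, followed by the inclusion, is `u ↦ Φ⁻¹ (0, u)`. -/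
theorem contMDiffOn_val_sliceChart_symm :
    ContMDiffOn 𝓘(ℝ, E) I' ∞ (fun u => ((sliceChart Φ x₀ hS).symm u : N))
      (sliceChart Φ x₀ hS).target := by
  have h1 : ContMDiffOn 𝓘(ℝ, E) I' ∞ (fun u : E => Φ.symm ((0 : V), u))
      {u | ((0 : V), u) ∈ Φ.target} := by
    refine Φ.symm.contMDiffOn.comp ?_ fun _ h => h
    rw [contMDiffOn_iff_contDiffOn]
    fun_prop
  refine h1.congr fun u hu => ?_
  have h1 : Φ.symm (0, u) ∈ Φ.source := Φ.map_target hu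
  have h0 : Φ (Φ.symm (0, u)) = (0, u) := Φ.right_inv hu
  have h2 : Φ.symm (0, u) ∈ S := by
    rw [hS _ h1, h0]
  exact congrArg Subtype.val (dif_pos h2)

theorem contMDiffOn_snd_partialDiffeomorph :
    ContMDiffOn I' 𝓘(ℝ, E) ∞ (fun y => (Φ y).2) Φ.source :=
  (contMDiff_iff_contDiff.2 contDiff_snd).comp_contMDiffOn Φ.contMDiffOn

end SliceChart

/-- A subset with slice charts is a submanifold. -/
theorem exists_isRegularEmbedding_of_sliceCharts {V : Type*} [NormedAddCommGroup V]
    [NormedSpace ℝ V] (S : Set N)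
    (h : ∀ x ∈ S, ∃ Φ : PartialDiffeomorph I' 𝓘(ℝ, V × E) N (V × E) ∞, x ∈ Φ.source ∧
      ∀ y ∈ Φ.source, y ∈ S ↔ (Φ y).1 = 0) :
    ∃ (_ : ChartedSpace E S) (_ : IsManifold 𝓘(ℝ, E) ∞ S),
      IsRegularEmbedding 𝓘(ℝ, E) I' (Subtype.val : S → N) := by
  choose Φ hx hΦ using fun x : S => h x x.2
  let c : S → OpenPartialHomeomorph S E := fun x => sliceChart (Φ x) x (hΦ x)
  have hc : ∀ x, x ∈ (c x).source := hx
  let cs : ChartedSpace E S := chartedSpaceOfCharts c hc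
  have hm : IsManifold 𝓘(ℝ, E) ∞ S := by
    refine isManifold_chartedSpaceOfCharts c hc fun x y => ?_
    rw [← contMDiffOn_iff_contDiffOn]
    exact (contMDiffOn_snd_partialDiffeomorph (Φ y)).comp
      ((contMDiffOn_val_sliceChart_symm (Φ x) x (hΦ x)).mono inter_subset_left) fun u hu => hu.2
  refine ⟨cs, hm, ⟨?_, IsEmbedding.subtypeVal, ?_⟩⟩
  · intro x
    have h1 : ContMDiffAt 𝓘(ℝ, E) 𝓘(ℝ, E) ∞ (c x) x :=
      (contMDiffOn_chart (I := 𝓘(ℝ, E)) (x := x)).contMDiffAt ((c x).open_source.mem_nhds (hc x))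
    have h2 := ((contMDiffOn_val_sliceChart_symm (Φ x) x (hΦ x)).contMDiffAt
      ((c x).open_target.mem_nhds ((c x).map_source (hc x)))).comp x h1
    refine h2.congr_of_eventuallyEq ?_
    filter_upwards [(c x).open_source.mem_nhds (hc x)] with y hy
    exact congrArg Subtype.val ((c x).left_inv hy).symm
  · intro x
    exact ⟨fun y => (Φ x y).2, (contMDiffOn_snd_partialDiffeomorph (Φ x)).contMDiffAt
      ((Φ x).open_source.mem_nhds (hx x)), Filter.EventuallyEq.rfl⟩

/-- A surjective linear map can be completed to an isomorphism. -/
theorem exists_bijective_prod {T V G : Type*} [AddCommGroup T] [Module ℝ T]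
    [FiniteDimensional ℝ T] [AddCommGroup V] [Module ℝ V]
    [AddCommGroup G] [Module ℝ G] [FiniteDimensional ℝ G] (D : T →ₗ[ℝ] V)
    (hD : Function.Surjective D)
    (hd : Module.finrank ℝ T = Module.finrank ℝ V + Module.finrank ℝ G) :
    ∃ q : T →ₗ[ℝ] G, Function.Bijective (D.prod q) := by
  have : FiniteDimensional ℝ V := Module.Finite.of_surjective D hD
  have h1 : Module.finrank ℝ (LinearMap.ker D) = Module.finrank ℝ G := by
    have := D.finrank_range_add_finrank_ker
    rw [LinearMap.range_eq_top.2 hD, finrank_top] at this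
    omega
  obtain ⟨p, hp⟩ := (LinearMap.ker D).subtype.exists_leftInverse_of_injective
    (Submodule.ker_subtype _)
  let e : LinearMap.ker D ≃ₗ[ℝ] G := LinearEquiv.ofFinrankEq _ _ h1
  refine ⟨e.toLinearMap ∘ₗ p, ?_⟩
  have hinj : Function.Injective (D.prod (e.toLinearMap ∘ₗ p)) := by
    rw [← LinearMap.ker_eq_bot, LinearMap.ker_eq_bot']
    intro v hv
    have hv1 : D v = 0 := congrArg Prod.fst hv
    have hv2 : e (p v) = 0 := congrArg Prod.snd hv
    have hv3 : p v = 0 := by simpa using hv2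
    have := DFunLike.congr_fun hp ⟨v, hv1⟩
    have hv4 : p v = ⟨v, hv1⟩ := this
    rw [hv3] at hv4
    exact (congrArg Subtype.val hv4).symm
  exact ⟨hinj, (LinearMap.injective_iff_surjective_of_finrank_eq_finrank
    (by rw [hd, Module.finrank_prod])).1 hinj⟩

variable [FiniteDimensional ℝ E] [FiniteDimensional ℝ E'] [I'.Boundaryless] [IsManifold I' ∞ N]

/-- The regular value theorem, in local form: a subset of a manifold which near each of its points
is the zero set of a map to `V` with surjective differential is a submanifold. -/
theorem exists_isRegularEmbedding_of_regular {V : Type*} [NormedAddCommGroup V]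
    [NormedSpace ℝ V] [FiniteDimensional ℝ V]
    (hd : Module.finrank ℝ E' = Module.finrank ℝ V + Module.finrank ℝ E) (S : Set N)
    (h : ∀ x ∈ S, ∃ (f : N → V) (U : Set N), IsOpen U ∧ x ∈ U ∧ ContMDiffOn I' 𝓘(ℝ, V) ∞ f U ∧
      Function.Surjective (mfderiv I' 𝓘(ℝ, V) f x) ∧ ∀ y ∈ U, y ∈ S ↔ f y = 0) :
    ∃ (_ : ChartedSpace E S) (_ : IsManifold 𝓘(ℝ, E) ∞ S),
      IsRegularEmbedding 𝓘(ℝ, E) I' (Subtype.val : S → N) := by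
  refine exists_isRegularEmbedding_of_sliceCharts (V := V) S fun x hxS => ?_
  obtain ⟨f, U, hU, hxU, hf, hsurj, hSf⟩ := h x hxS
  have hφb : Function.Bijective (mfderiv I' 𝓘(ℝ, E') (extChartAt I' x) x) :=
    bijective_mfderiv_of_isLocalDiffeomorphAt
      ((extChartDiffeo I' x).isLocalDiffeomorphAt _ _ _ (mem_extChartAt_source x))
  let eφ : TangentSpace I' x ≃ₗ[ℝ] E' :=
    LinearEquiv.ofBijective (mfderiv I' 𝓘(ℝ, E') (extChartAt I' x) x).toLinearMap hφb
  obtain ⟨q, hq⟩ := exists_bijective_prod (G := E)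
    (mfderiv I' 𝓘(ℝ, V) f x).toLinearMap hsurj hd
  -- complete `f` to a local diffeomorphism `(f, q')` by a linear map in the coordinates of a chart
  let q' : E' →L[ℝ] E := LinearMap.toContinuousLinearMap (q ∘ₗ eφ.symm.toLinearMap)
  let g : N → V × E := fun y => (f y, q' (extChartAt I' x y))
  let W := U ∩ (chartAt H' x).source
  have hW : IsOpen W := hU.inter (chartAt H' x).open_source
  have hxW : x ∈ W := ⟨hxU, mem_chart_source _ _⟩
  have h2 : ContMDiffOn I' 𝓘(ℝ, E) ∞ (fun y => q' (extChartAt I' x y)) W :=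
    q'.contMDiff.comp_contMDiffOn (contMDiffOn_extChartAt.mono inter_subset_right)
  have hg : ContMDiffOn I' 𝓘(ℝ, V × E) ∞ g W := by
    exact (hf.mono inter_subset_left).prodMk_space h2
  have hder : ∀ v, mfderiv I' 𝓘(ℝ, V × E) g x v = (mfderiv I' 𝓘(ℝ, V) f x v, q v) := by
    intro v
    have e1 : HasMFDerivAt I' 𝓘(ℝ, V) f x (mfderiv I' 𝓘(ℝ, V) f x) :=
      ((hf.contMDiffAt (hU.mem_nhds hxU)).mdifferentiableAt (by simp)).hasMFDerivAt
    have e2 : HasMFDerivAt I' 𝓘(ℝ, E') (extChartAt I' x) x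
        (mfderiv I' 𝓘(ℝ, E') (extChartAt I' x) x) :=
      ((contMDiffAt_extChartAt (n := ∞)).mdifferentiableAt (by simp)).hasMFDerivAt
    have e3 := (q'.hasMFDerivAt (x := extChartAt I' x x)).comp x e2
    have e4 : HasMFDerivAt I' 𝓘(ℝ, V × E) g x ((mfderiv I' 𝓘(ℝ, V) f x).prod (q' ∘L
        mfderiv I' 𝓘(ℝ, E') (extChartAt I' x) x)) :=
      ⟨e1.1.prodMk e3.1, e1.2.prodMk e3.2⟩
    rw [e4.mfderiv]
    refine Prod.ext rfl ?_
    change q (eφ.symm (eφ v)) = q v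
    rw [eφ.symm_apply_apply]
  have hb : Function.Bijective (mfderiv I' 𝓘(ℝ, V × E) g x) := by
    have : ⇑(mfderiv I' 𝓘(ℝ, V × E) g x) = (mfderiv I' 𝓘(ℝ, V) f x).toLinearMap.prod q := by
      funext v; rw [hder]; rfl
    rw [this]; exact hq
  obtain ⟨Φ, hxΦ, hΦ⟩ := isLocalDiffeomorphAt_of_bijective_mfderiv hW hg hxW hb
  refine ⟨restrDiffeo Φ U hU, ⟨hxΦ, hxU⟩, fun y hy => ?_⟩
  rw [hSf y hy.2]
  have : Φ y = g y := (hΦ hy.1).symm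
  change _ ↔ (Φ y).1 = 0
  rw [this]

end Submanifold

/-! ### Linear algebra of the Lichnerowicz map -/

section Linear

/-- A map `f : T → T^*` with kernel `im ρ` whose values annihilate `im ρ` is a quasi-isomorphism:
the induced map `T / im ρ → (im ρ)°` is injective, and both sides have the same dimension. -/
theorem isQuasiIso_of_range_eq_ker {A T : Type*} [AddCommGroup A] [Module ℝ A] [AddCommGroup T]
    [Module ℝ T] [FiniteDimensional ℝ T] (ρ : A →ₗ[ℝ] T) (f : T →ₗ[ℝ] Module.Dual ℝ T)
    (hρ : Function.Injective ρ) (hker : LinearMap.range ρ = LinearMap.ker f)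
    (hann : ∀ v a, f v (ρ a) = 0) : IsQuasiIso ρ f := by
  have h' : ∀ v, f v ∈ LinearMap.ker ρ.dualMap := fun v =>
    LinearMap.mem_ker.2 (LinearMap.ext fun a => hann v a)
  refine ⟨hker.le, h', LinearMap.ker_eq_bot.2 hρ, ?_,
    LinearMap.range_eq_top.2 (LinearMap.dualMap_surjective_of_injective hρ)⟩
  have hinj : Function.Injective (inducedMap ρ f hker.le h') := by
    intro a b hab
    obtain ⟨a, rfl⟩ := Submodule.mkQ_surjective _ a
    obtain ⟨b, rfl⟩ := Submodule.mkQ_surjective _ b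
    have h1 : f a = f b := congrArg Subtype.val hab
    refine (Submodule.Quotient.eq _).2 ?_
    rw [hker, LinearMap.mem_ker, map_sub, h1, sub_self]
  have h1 := (LinearMap.range ρ).finrank_quotient_add_finrank
  have h2 := Subspace.finrank_add_finrank_dualAnnihilator_eq (LinearMap.range ρ)
  rw [← LinearMap.ker_dualMap_eq_dualAnnihilator_range] at h2
  have h3 : Module.finrank ℝ (T ⧸ LinearMap.range ρ) =
      Module.finrank ℝ (LinearMap.ker ρ.dualMap) := by omega
  have h4 := LinearMap.injective_iff_surjective_of_finrank_eq_finrank (K := ℝ)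
    (V := T ⧸ LinearMap.range ρ) (V₂ := LinearMap.ker ρ.dualMap) h3
    (f := inducedMap ρ f hker.le h')
  exact ⟨hinj, h4.1 hinj⟩

variable {E : Type*} [NormedAddCommGroup E] [NormedSpace ℝ E]
  {M : Type*} [TopologicalSpace M] [ChartedSpace E M]
  (σ : Form 𝓘(ℝ, E) M 2) (η : Form 𝓘(ℝ, E) M 1) (x : M)

theorem Form.two_add_left (a b w : TangentSpace 𝓘(ℝ, E) x) :
    σ x ![a + b, w] = σ x ![a, w] + σ x ![b, w] :=
  (σ x).toMultilinearMap.cons_add ![w] a b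

theorem Form.two_swap (a b : TangentSpace 𝓘(ℝ, E) x) : σ x ![a, b] = - σ x ![b, a] := by
  have h := (σ x).toAlternatingMap.map_swap ![b, a] (i := 0) (j := 1) (by decide)
  have e : ![b, a] ∘ Equiv.swap (0 : Fin 2) 1 = ![a, b] := by
    ext i; fin_cases i <;> rfl
  rw [e] at h
  exact h

theorem Form.two_add_right (a b w : TangentSpace 𝓘(ℝ, E) x) :
    σ x ![w, a + b] = σ x ![w, a] + σ x ![w, b] := by
  rw [Form.two_swap, Form.two_add_left, Form.two_swap σ x w a, Form.two_swap σ x w b]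
  ring

theorem Form.two_neg_left (a w : TangentSpace 𝓘(ℝ, E) x) :
    σ x ![-a, w] = - σ x ![a, w] := by
  have h := Form.two_add_left σ x a (-a) w
  have h0 : σ x ![0, w] = 0 := (σ x).map_coord_zero (m := ![0, w]) 0 rfl
  rw [add_neg_cancel, h0] at h
  linarith

theorem Form.one_add (a b : TangentSpace 𝓘(ℝ, E) x) :
    η x ![a + b] = η x ![a] + η x ![b] := (η x).toMultilinearMap.cons_add ![] a b

theorem Form.one_neg (a : TangentSpace 𝓘(ℝ, E) x) : η x ![-a] = - η x ![a] := by
  have h := Form.one_add η x a (-a)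
  have h0 : η x ![0] = 0 := (η x).map_coord_zero (m := ![0]) 0 rfl
  rw [add_neg_cancel, h0] at h
  linarith

theorem Form.one_smul (c : ℝ) (a : TangentSpace 𝓘(ℝ, E) x) : η x ![c • a] = c * η x ![a] :=
  (η x).toMultilinearMap.cons_smul ![] c a

theorem Form.two_self (a : TangentSpace 𝓘(ℝ, E) x) : σ x ![a, a] = 0 := by
  have := Form.two_swap σ x a a
  linarith

theorem flat_apply (v w : TangentSpace 𝓘(ℝ, E) x) :
    flat σ η x v w = σ x ![v, w] + η x ![v] * η x ![w] := rfl

theorem mem_ker_flat (v : TangentSpace 𝓘(ℝ, E) x) :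
    v ∈ LinearMap.ker (flat σ η x) ↔ η x ![v] = 0 ∧ ∀ w, σ x ![v, w] = 0 := by
  rw [LinearMap.mem_ker]
  constructor
  · intro h
    have h1 : η x ![v] = 0 := by
      have := DFunLike.congr_fun h v
      rw [flat_apply, Form.two_self, zero_add] at this
      exact mul_self_eq_zero.1 this
    refine ⟨h1, fun w => ?_⟩
    have := DFunLike.congr_fun h w
    rw [flat_apply, h1, zero_mul, add_zero] at this
    exact this
  · rintro ⟨h1, h2⟩
    ext w
    rw [flat_apply, h1, h2, zero_mul, add_zero]
    rfl

/-- If the image of the injective map `ρ` consists of the vectors in the kernel of both forms, the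
Lichnerowicz map induces a quasi-isomorphism. -/
theorem isQuasiIso_flat [FiniteDimensional ℝ E] {A : Type*} [AddCommGroup A] [Module ℝ A]
    (ρ : A →ₗ[ℝ] TangentSpace 𝓘(ℝ, E) x)
    (hρ : Function.Injective ρ)
    (hker : ∀ v, (∃ a, ρ a = v) ↔ η x ![v] = 0 ∧ ∀ w, σ x ![v, w] = 0) :
    IsQuasiIso ρ (flat σ η x) := by
  refine isQuasiIso_of_range_eq_ker ρ _ hρ ?_ fun v a => ?_
  · ext v
    rw [mem_ker_flat, ← hker]
    rfl
  · obtain ⟨h1, h2⟩ := (hker (ρ a)).1 ⟨a, rfl⟩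
    rw [flat_apply, Form.two_swap, h1, h2]
    simp

/-- A pair of forms whose common kernel is trivial is cosymplectic as soon as there are Reeb
vectors. -/
theorem isCompl_ker_of_reeb (R : TangentSpace 𝓘(ℝ, E) x) (hη : η x ![R] = 1)
    (hσ : ∀ w, σ x ![R, w] = 0)
    (hker : ∀ v, η x ![v] = 0 → (∀ w, σ x ![v, w] = 0) → v = 0) :
    IsCompl (ker₂ σ x) (ker₁ η x) := by
  have hR : R ∈ ker₂ σ x := hσ
  constructor
  · rw [Submodule.disjoint_def]
    exact fun v h1 h2 => hker v h2 h1
  · rw [codisjoint_iff, Submodule.eq_top_iff']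
    intro v
    rw [Submodule.mem_sup]
    refine ⟨η x ![v] • R, (ker₂ σ x).smul_mem _ hR, v + -(η x ![v] • R), ?_, by abel⟩
    change η x ![_] = 0
    rw [Form.one_add, Form.one_neg, Form.one_smul, hη]
    ring

/-- The Reeb vectors of a cosymplectic structure. -/
theorem IsCosymplectic.exists_reeb {σ : Form 𝓘(ℝ, E) M 2} {η : Form 𝓘(ℝ, E) M 1}
    (h : IsCosymplectic σ η) (x : M) :
    ∃ R : TangentSpace 𝓘(ℝ, E) x, η x ![R] = 1 ∧ ∀ w, σ x ![R, w] = 0 := by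
  have hc := h.isCompl_ker x
  have h0 : ∃ v, η x ![v] ≠ 0 := by
    by_contra hcon
    push Not at hcon
    refine h.one_ne_zero x (ContinuousAlternatingMap.ext fun v => ?_)
    have : v = ![v 0] := by ext i; fin_cases i; rfl
    rw [this, hcon]
    rfl
  obtain ⟨v, hv⟩ := h0
  have htop : v ∈ ker₂ σ x ⊔ ker₁ η x := by rw [hc.sup_eq_top]; trivial
  obtain ⟨a, ha, b, hb, rfl⟩ := Submodule.mem_sup.1 htop
  have hb' : η x ![b] = 0 := hb
  rw [Form.one_add, hb', add_zero] at hv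
  refine ⟨(η x ![a])⁻¹ • a, ?_, (ker₂ σ x).smul_mem _ ha⟩
  rw [Form.one_smul, inv_mul_cancel₀ hv]

end Linear

/-! ### Differentials with prescribed target -/

section DerivTo

variable {E : Type*} [NormedAddCommGroup E] [NormedSpace ℝ E]
  {H : Type*} [TopologicalSpace H]
  {E' : Type*} [NormedAddCommGroup E'] [NormedSpace ℝ E'] {H' : Type*} [TopologicalSpace H']
  {E'' : Type*} [NormedAddCommGroup E''] [NormedSpace ℝ E''] {H'' : Type*} [TopologicalSpace H'']
  {I : ModelWithCorners ℝ E H} {I' : ModelWithCorners ℝ E' H'} {I'' : ModelWithCorners ℝ E'' H''}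
  {M : Type*} [TopologicalSpace M] [ChartedSpace H M]
  {N : Type*} [TopologicalSpace N] [ChartedSpace H' N]
  {P : Type*} [TopologicalSpace P] [ChartedSpace H'' P] {k : ℕ}

theorem derivTo_comp {f : M → N} {g : N → P} {x : M} {y : N} {z : P} (hy : f x = y)
    (hg : MDifferentiableAt I' I'' g y) (hf : MDifferentiableAt I I' f x)
    (v : TangentSpace I x) :
    derivTo I I'' (g ∘ f) x z v = derivTo I' I'' g y z (derivTo I I' f x y v) := by
  subst hy
  exact DFunLike.congr_fun (mfderiv_comp x hg hf) v

theorem derivTo_congr {f g : M → N} {x : M} (h : f =ᶠ[𝓝 x] g) (y : N) :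
    derivTo I I' f x y = derivTo I I' g x y := h.mfderiv_eq

theorem derivTo_id (x y : M) (v : TangentSpace I x) : derivTo I I id x y v = v := by
  change mfderiv I I id x v = v
  rw [mfderiv_id]; rfl

end DerivTo

/-! ### Smooth actions and the action groupoid -/

section Action

variable {E : Type*} [NormedAddCommGroup E] [NormedSpace ℝ E]
  {F : Type*} [NormedAddCommGroup F] [NormedSpace ℝ F]
  {K : Type*} [Group K] [TopologicalSpace K] [ChartedSpace F K] [LieGroup 𝓘(ℝ, F) ∞ K]
  {Z : Type*} [TopologicalSpace Z] [ChartedSpace E Z] [IsManifold 𝓘(ℝ, E) ∞ Z]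
  [MulAction K Z] [ContMDiffSMul 𝓘(ℝ, F) 𝓘(ℝ, E) ∞ K Z]

variable (E F K Z) in
theorem contMDiff_act :
    ContMDiff (𝓘(ℝ, F).prod 𝓘(ℝ, E)) 𝓘(ℝ, E) ∞ fun p : K × Z => p.1 • p.2 :=
  contMDiff_smul

variable (E F K) in
theorem contMDiff_orbit (z : Z) : ContMDiff 𝓘(ℝ, F) 𝓘(ℝ, E) ∞ fun k : K => k • z :=
  (contMDiff_act E F K Z).comp (contMDiff_id.prodMk contMDiff_const)

variable (F K) in
/-- The differential `ξ ↦ ξ_Z(z)` at `1` of the orbit map `k ↦ k • z`. -/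
def orbitMap (z : Z) : GroupLieAlgebra 𝓘(ℝ, F) K →L[ℝ] TangentSpace 𝓘(ℝ, E) z :=
  derivTo 𝓘(ℝ, F) 𝓘(ℝ, E) (fun k : K => k • z) 1 z

variable (E) in
/-- The differential at `z` of the action of `k`. -/
def translate (k : K) (z : Z) : TangentSpace 𝓘(ℝ, E) z →L[ℝ] TangentSpace 𝓘(ℝ, E) (k • z) :=
  mfderiv 𝓘(ℝ, E) 𝓘(ℝ, E) (fun z : Z => k • z) z

variable (F) in
/-- The left trivialization `T_k K → T_1 K`. -/
def leftTriv (k : K) : TangentSpace 𝓘(ℝ, F) k →L[ℝ] GroupLieAlgebra 𝓘(ℝ, F) K :=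
  derivTo 𝓘(ℝ, F) 𝓘(ℝ, F) (fun h : K => k⁻¹ * h) k 1

theorem bijective_translate (hK : ∀ k : K, ContMDiff 𝓘(ℝ, E) 𝓘(ℝ, E) ∞ fun z : Z => k • z)
    (k : K) (z : Z) : Function.Bijective (translate E k z) := by
  have hk := (hK k).mdifferentiable (by simp)
  have hk' := (hK k⁻¹).mdifferentiable (by simp)
  have h1 : ∀ v, derivTo 𝓘(ℝ, E) 𝓘(ℝ, E) (fun z : Z => k⁻¹ • z) (k • z) z (translate E k z v)
      = v := by
    intro v
    have := derivTo_comp (f := fun z : Z => k • z) (g := fun z : Z => k⁻¹ • z) (x := z)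
      (y := k • z) (z := z) rfl (hk' _) (hk _) v
    refine this.symm.trans ?_
    have e : (fun z : Z => k⁻¹ • z) ∘ (fun z : Z => k • z) = id := by
      funext z; simp
    rw [e, derivTo_id]
  have h2 : ∀ v, translate E k z (derivTo 𝓘(ℝ, E) 𝓘(ℝ, E) (fun z : Z => k⁻¹ • z) (k • z) z v)
      = v := by
    intro v
    have := derivTo_comp (f := fun z : Z => k⁻¹ • z) (g := fun z : Z => k • z) (x := k • z)
      (y := z) (z := k • z) (by simp) (hk _) (hk' _) v
    refine this.symm.trans ?_
    have e : (fun z : Z => k • z) ∘ (fun z : Z => k⁻¹ • z) = id := by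
      funext z; simp
    rw [e, derivTo_id]
  exact ⟨Function.LeftInverse.injective h1, Function.RightInverse.surjective h2⟩

theorem contMDiff_mul_left' (k : K) : ContMDiff 𝓘(ℝ, F) 𝓘(ℝ, F) ∞ fun h : K => k * h :=
  contMDiff_mul_left

theorem bijective_leftTriv (k : K) : Function.Bijective (leftTriv F k) := by
  have hk := (contMDiff_mul_left' (F := F) k).mdifferentiable (by simp)
  have hk' := (contMDiff_mul_left' (F := F) k⁻¹).mdifferentiable (by simp)
  have h1 : ∀ v, derivTo 𝓘(ℝ, F) 𝓘(ℝ, F) (fun h : K => k * h) 1 k (leftTriv F k v) = v := by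
    intro v
    refine (derivTo_comp (f := fun h : K => k⁻¹ * h) (g := fun h : K => k * h) (x := k)
      (y := 1) (z := k) (by simp) (hk _) (hk' _) v).symm.trans ?_
    have e : (fun h : K => k * h) ∘ (fun h : K => k⁻¹ * h) = id := by
      funext h; simp
    rw [e, derivTo_id]
  have h2 : ∀ v, leftTriv F k (derivTo 𝓘(ℝ, F) 𝓘(ℝ, F) (fun h : K => k * h) 1 k v) = v := by
    intro v
    refine (derivTo_comp (f := fun h : K => k * h) (g := fun h : K => k⁻¹ * h) (x := 1)
      (y := k) (z := 1) (by simp) (hk' _) (hk _) v).symm.trans ?_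
    have e : (fun h : K => k⁻¹ * h) ∘ (fun h : K => k * h) = id := by
      funext h; simp
    rw [e, derivTo_id]
  exact ⟨Function.LeftInverse.injective h1, Function.RightInverse.surjective h2⟩

/-- The differential of an orbit map at an arbitrary point of the group, in terms of the fundamental
vector fields. -/
theorem mfderiv_orbit (k : K) (z : Z) (κ : TangentSpace 𝓘(ℝ, F) k) :
    mfderiv 𝓘(ℝ, F) 𝓘(ℝ, E) (fun h : K => h • z) k κ =
      translate E k z (orbitMap F K z (leftTriv F k κ)) := by
  have hk := (ContMDiffSMul.contMDiff_const_smul (I := 𝓘(ℝ, F)) (I' := 𝓘(ℝ, E)) (n := ∞) (M := Z) k).mdifferentiable (by simp)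
  have hl := (contMDiff_mul_left' (F := F) k⁻¹).mdifferentiable (by simp)
  have ho := (contMDiff_orbit E F K z).mdifferentiable (by simp)
  have e : (fun h : K => h • z) =
      (fun z : Z => k • z) ∘ ((fun h : K => h • z) ∘ fun h : K => k⁻¹ * h) := by
    funext h
    simp [smul_smul]
  change derivTo 𝓘(ℝ, F) 𝓘(ℝ, E) (fun h : K => h • z) k (k • z) κ = _
  conv_lhs => rw [e]
  rw [derivTo_comp (y := z) (by simp) (hk z) ((ho.comp hl) k),
    derivTo_comp (y := 1) (by simp) (ho 1) (hl k)]
  rfl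

/-- The first component of a tangent vector of a product. -/
abbrev tangentFst {p : K × Z} (v : TangentSpace (𝓘(ℝ, F).prod 𝓘(ℝ, E)) p) :
    TangentSpace 𝓘(ℝ, F) p.1 := v.1

/-- The second component of a tangent vector of a product. -/
abbrev tangentSnd {p : K × Z} (v : TangentSpace (𝓘(ℝ, F).prod 𝓘(ℝ, E)) p) :
    TangentSpace 𝓘(ℝ, E) p.2 := v.2

theorem mfderiv_act (p : K × Z) (v : TangentSpace (𝓘(ℝ, F).prod 𝓘(ℝ, E)) p) :
    mfderiv (𝓘(ℝ, F).prod 𝓘(ℝ, E)) 𝓘(ℝ, E) (fun p : K × Z => p.1 • p.2) p v =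
      translate E p.1 p.2 (orbitMap F K p.2 (leftTriv F p.1 (tangentFst v)) + tangentSnd v) := by
  rw [mfderiv_prod_eq_add_apply ((contMDiff_act E F K Z).mdifferentiable (by simp) p)]
  have h1 := mfderiv_orbit (E := E) p.1 p.2 (tangentFst v)
  rw [map_add]
  exact congrArg (· + _) h1

theorem leftTriv_one (ξ : GroupLieAlgebra 𝓘(ℝ, F) K) : leftTriv F (1 : K) ξ = ξ := by
  have e : (fun h : K => (1 : K)⁻¹ * h) = id := by funext h; simp
  unfold leftTriv
  rw [e, derivTo_id]

theorem translate_one (z : Z) (v : TangentSpace 𝓘(ℝ, E) z) : translate E (1 : K) z v = v := by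
  have e : (fun z : Z => (1 : K) • z) = id := by funext h; simp
  have h : translate E (1 : K) z v = derivTo 𝓘(ℝ, E) 𝓘(ℝ, E) (fun z : Z => (1 : K) • z) z z v := rfl
  rw [h, e, derivTo_id]

variable (E F K Z) in
/-- The action groupoid of a smooth action is a Lie groupoid. -/
theorem isLieGroupoid_actionGroupoid :
    (actionGroupoid K Z).IsLieGroupoid 𝓘(ℝ, E) (𝓘(ℝ, F).prod 𝓘(ℝ, E)) where
  s_u _ := rfl
  t_u x := one_smul K x
  s_m _ _ _ := rfl
  t_m := by
    rintro ⟨k, x⟩ ⟨l, y⟩ h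
    change x = l • y at h
    change (k * l) • y = k • x
    rw [h, mul_smul]
  m_assoc g h k _ _ := Prod.ext (mul_assoc _ _ _) rfl
  m_u g := Prod.ext (mul_one _) rfl
  u_m g := Prod.ext (one_mul _) rfl
  s_i _ := rfl
  t_i := fun g => inv_smul_smul g.1 g.2
  m_i g := Prod.ext (mul_inv_cancel _) rfl
  i_m g := Prod.ext (inv_mul_cancel _) rfl
  submersion_s := ⟨contMDiff_snd, fun p w => ⟨(0, w), by
    change mfderiv _ _ Prod.snd p _ = w
    rw [mfderiv_snd]; rfl⟩⟩
  submersion_t := ⟨contMDiff_act E F K Z, fun p w => by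
    obtain ⟨w', rfl⟩ := (bijective_translate
      (ContMDiffSMul.contMDiff_const_smul (I := 𝓘(ℝ, F))) p.1 p.2).2 w
    refine ⟨(0, w'), ?_⟩
    refine (mfderiv_act (E := E) p ((0, w') : F × E)).trans ?_
    have h0 : orbitMap (E := E) F K p.2 (leftTriv F p.1 0) + w' = w' := by
      rw [map_zero, map_zero, zero_add]
    exact congrArg (translate E p.1 p.2) h0⟩
  smooth_u := contMDiff_const.prodMk contMDiff_id
  smooth_i := contMDiff_fst.inv.prodMk (contMDiff_act E F K Z)
  smooth_m := by
    refine ContMDiff.contMDiffOn ?_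
    exact ((contMDiff_fst.comp contMDiff_fst).mul (contMDiff_fst.comp contMDiff_snd)).prodMk
      (contMDiff_snd.comp contMDiff_snd)

variable (F K) in
/-- Closed forms on `Z`, invariant under `K`, whose common kernel is spanned by the fundamental
vector fields of a locally free action, and which admit Reeb vectors: a cosymplectic structure
transverse to the orbits. -/
structure IsTransverselyCosymplectic (σ : Form 𝓘(ℝ, E) Z 2) (η : Form 𝓘(ℝ, E) Z 1) : Prop where
  smooth_two : σ.IsSmooth
  smooth_one : η.IsSmooth
  closed_two : σ.IsClosed
  closed_one : η.IsClosed
  preserves_two : ∀ k : K, Form.pullback (fun x : Z => k • x) σ = σ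
  preserves_one : ∀ k : K, Form.pullback (fun x : Z => k • x) η = η
  injective_orbitMap : ∀ z : Z, Function.Injective (orbitMap (E := E) F K z)
  mem_orbit_iff : ∀ (z : Z) (v : TangentSpace 𝓘(ℝ, E) z),
    (∃ ξ, orbitMap F K z ξ = v) ↔ η z ![v] = 0 ∧ ∀ w, σ z ![v, w] = 0
  exists_reeb : ∀ z : Z, ∃ R : TangentSpace 𝓘(ℝ, E) z, η z ![R] = 1 ∧ ∀ w, σ z ![R, w] = 0

namespace IsTransverselyCosymplectic

variable {σ : Form 𝓘(ℝ, E) Z 2} {η : Form 𝓘(ℝ, E) Z 1}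
  (h : IsTransverselyCosymplectic F K σ η)

include h

theorem one_orbit (z : Z) (ξ : GroupLieAlgebra 𝓘(ℝ, F) K) : η z ![orbitMap F K z ξ] = 0 :=
  ((h.mem_orbit_iff z _).1 ⟨ξ, rfl⟩).1

theorem two_orbit (z : Z) (ξ : GroupLieAlgebra 𝓘(ℝ, F) K) (w : TangentSpace 𝓘(ℝ, E) z) :
    σ z ![orbitMap F K z ξ, w] = 0 :=
  ((h.mem_orbit_iff z _).1 ⟨ξ, rfl⟩).2 w

theorem two_translate (k : K) (z : Z) (v w : TangentSpace 𝓘(ℝ, E) z) :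
    σ (k • z) ![translate E k z v, translate E k z w] = σ z ![v, w] := by
  have h1 := DFunLike.congr_fun (congrFun (h.preserves_two k) z) ![v, w]
  rw [← h1, Form.pullback_apply]
  congr 1
  ext i; fin_cases i <;> rfl

theorem one_translate (k : K) (z : Z) (v : TangentSpace 𝓘(ℝ, E) z) :
    η (k • z) ![translate E k z v] = η z ![v] := by
  have h1 := DFunLike.congr_fun (congrFun (h.preserves_one k) z) ![v]
  rw [← h1, Form.pullback_apply]
  congr 1
  ext i; fin_cases i; rfl

theorem two_add_orbit (z : Z) (ξ ζ : GroupLieAlgebra 𝓘(ℝ, F) K) (v w : TangentSpace 𝓘(ℝ, E) z) :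
    σ z ![orbitMap F K z ξ + v, orbitMap F K z ζ + w] = σ z ![v, w] := by
  rw [Form.two_add_left, h.two_orbit, Form.two_add_right, Form.two_swap σ z v, h.two_orbit]
  ring

theorem one_add_orbit (z : Z) (ξ : GroupLieAlgebra 𝓘(ℝ, F) K) (v : TangentSpace 𝓘(ℝ, E) z) :
    η z ![orbitMap F K z ξ + v] = η z ![v] := by
  rw [Form.one_add, h.one_orbit, zero_add]

theorem one_ne_zero (z : Z) : η z ≠ 0 := by
  obtain ⟨R, hR, -⟩ := h.exists_reeb z
  intro h0
  rw [h0] at hR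
  exact zero_ne_one hR

/-- An invariant form annihilating the orbit directions is basic for the action groupoid: `dt` and
`ds` differ by the translation by `k` and a vector tangent to the orbit. -/
theorem isBasic_two : (actionGroupoid K Z).IsBasic (𝓘(ℝ, F).prod 𝓘(ℝ, E)) σ := by
  funext p
  ext v
  rw [Form.pullback_apply, Form.pullback_apply]
  have h1 : (fun i => mfderiv (𝓘(ℝ, F).prod 𝓘(ℝ, E)) 𝓘(ℝ, E) (actionGroupoid K Z).t p (v i)) =
      ![translate E p.1 p.2 (orbitMap F K p.2 (leftTriv F p.1 (tangentFst (v 0))) + tangentSnd (v 0)),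
        translate E p.1 p.2 (orbitMap F K p.2 (leftTriv F p.1 (tangentFst (v 1))) + tangentSnd (v 1))] := by
    ext i; fin_cases i
    · exact mfderiv_act p (v 0)
    · exact mfderiv_act p (v 1)
  have h2 : (fun i => mfderiv (𝓘(ℝ, F).prod 𝓘(ℝ, E)) 𝓘(ℝ, E) (actionGroupoid K Z).s p (v i)) =
      ![(v 0).2, (v 1).2] := by
    have e : mfderiv (𝓘(ℝ, F).prod 𝓘(ℝ, E)) 𝓘(ℝ, E) (actionGroupoid K Z).s p = _ := mfderiv_snd
    rw [e]
    ext i; fin_cases i <;> rfl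
  rw [h1, h2]
  exact (h.two_translate _ _ _ _).trans (h.two_add_orbit _ _ _ _ _)

theorem isBasic_one : (actionGroupoid K Z).IsBasic (𝓘(ℝ, F).prod 𝓘(ℝ, E)) η := by
  funext p
  ext v
  rw [Form.pullback_apply, Form.pullback_apply]
  have h1 : (fun i => mfderiv (𝓘(ℝ, F).prod 𝓘(ℝ, E)) 𝓘(ℝ, E) (actionGroupoid K Z).t p (v i)) =
      ![translate E p.1 p.2 (orbitMap F K p.2 (leftTriv F p.1 (tangentFst (v 0))) + tangentSnd (v 0))] := by
    ext i; fin_cases i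
    exact mfderiv_act p (v 0)
  have h2 : (fun i => mfderiv (𝓘(ℝ, F).prod 𝓘(ℝ, E)) 𝓘(ℝ, E) (actionGroupoid K Z).s p (v i)) =
      ![(v 0).2] := by
    have e : mfderiv (𝓘(ℝ, F).prod 𝓘(ℝ, E)) 𝓘(ℝ, E) (actionGroupoid K Z).s p = _ := mfderiv_snd
    rw [e]
    ext i; fin_cases i; rfl
  rw [h1, h2]
  exact (h.one_translate _ _ _).trans (h.one_add_orbit _ _ _)

/-- The tangent complex of the action groupoid is `ξ ↦ ξ_Z(z)`; its image is the common kernel of the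
two forms, which is what a quasi-isomorphism requires. -/
theorem isZeroShiftedCosymplectic [FiniteDimensional ℝ E] :
    (actionGroupoid K Z).IsZeroShiftedCosymplectic (𝓘(ℝ, F).prod 𝓘(ℝ, E)) σ η where
  smooth_two := h.smooth_two
  smooth_one := h.smooth_one
  closed_two := h.closed_two
  closed_one := h.closed_one
  basic_two := h.isBasic_two
  basic_one := h.isBasic_one
  one_ne_zero := h.one_ne_zero
  quasiIso z := by
    -- the Lie algebroid fibre consists of the pairs `(ξ, 0)`, and the anchor maps it to `ξ_Z(z)`
    have hs := mfderiv_snd (I := 𝓘(ℝ, F)) (I' := 𝓘(ℝ, E)) (x := ((1 : K), z))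
    have ha : ∀ a : (actionGroupoid K Z).algebroid 𝓘(ℝ, E) (𝓘(ℝ, F).prod 𝓘(ℝ, E)) z,
        tangentSnd a.1 = 0 := by
      intro a
      exact (DFunLike.congr_fun hs a.1).symm.trans a.2
    have hρ : ∀ a : (actionGroupoid K Z).algebroid 𝓘(ℝ, E) (𝓘(ℝ, F).prod 𝓘(ℝ, E)) z,
        (actionGroupoid K Z).anchor 𝓘(ℝ, E) (𝓘(ℝ, F).prod 𝓘(ℝ, E)) z a =
          orbitMap F K z a.1.1 := by
      intro a
      refine (mfderiv_act ((1 : K), z) a.1).trans ((translate_one z _).trans ?_)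
      refine (congrArg₂ (fun a b : TangentSpace 𝓘(ℝ, E) z => a + b)
        (congrArg (orbitMap F K z) (leftTriv_one _)) (ha a)).trans ?_
      exact add_zero _
    refine isQuasiIso_flat σ η z _ ?_ ?_
    · intro a b hab
      rw [hρ, hρ] at hab
      exact Subtype.ext (Prod.ext (h.injective_orbitMap z hab) ((ha a).trans (ha b).symm))
    · intro v
      rw [← h.mem_orbit_iff]
      constructor
      · rintro ⟨a, rfl⟩
        exact ⟨a.1.1, (hρ a).symm⟩
      · rintro ⟨ξ, rfl⟩
        have hmem : ((ξ, 0) : F × E) ∈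
            (actionGroupoid K Z).algebroid 𝓘(ℝ, E) (𝓘(ℝ, F).prod 𝓘(ℝ, E)) z := by
          exact DFunLike.congr_fun hs ((ξ, 0) : F × E)
        exact ⟨⟨(ξ, 0), hmem⟩, hρ ⟨(ξ, 0), hmem⟩⟩

end IsTransverselyCosymplectic

end Action

/-! ### Slices for locally free actions -/

section Slice

/-- An injective linear map can be completed to an isomorphism. -/
theorem exists_bijective_coprod {A T G : Type*} [AddCommGroup T] [Module ℝ T]
    [FiniteDimensional ℝ T] [AddCommGroup A] [Module ℝ A]
    [AddCommGroup G] [Module ℝ G] [FiniteDimensional ℝ G] (ρ : A →ₗ[ℝ] T)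
    (hρ : Function.Injective ρ)
    (hd : Module.finrank ℝ T = Module.finrank ℝ A + Module.finrank ℝ G) :
    ∃ L : G →ₗ[ℝ] T, Function.Bijective (ρ.coprod L) := by
  have : FiniteDimensional ℝ A := Module.Finite.of_injective ρ hρ
  obtain ⟨C, hC⟩ := (LinearMap.range ρ).exists_isCompl
  have h1 : Module.finrank ℝ G = Module.finrank ℝ C := by
    have := Submodule.finrank_add_eq_of_isCompl hC
    rw [LinearMap.finrank_range_of_inj hρ] at this
    omega
  let e : G ≃ₗ[ℝ] C := LinearEquiv.ofFinrankEq _ _ h1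
  refine ⟨C.subtype ∘ₗ e.toLinearMap, ?_⟩
  have hinj : Function.Injective (ρ.coprod (C.subtype ∘ₗ e.toLinearMap)) := by
    rw [← LinearMap.ker_eq_bot, LinearMap.ker_eq_bot']
    rintro ⟨a, g⟩ hag
    have h2 : ρ a + e g = 0 := hag
    have h3 : ρ a ∈ C := by
      rw [eq_neg_of_add_eq_zero_left h2]
      exact C.neg_mem (e g).2
    have h4 : ρ a = 0 := Submodule.disjoint_def.1 hC.disjoint _ ⟨a, rfl⟩ h3
    have h5 : a = 0 := hρ (by rw [h4, map_zero])
    rw [h4, zero_add] at h2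
    have h6 : g = 0 := by
      have : e g = 0 := Subtype.ext h2
      simpa using this
    rw [h5, h6]; rfl
  exact ⟨hinj, (LinearMap.injective_iff_surjective_of_finrank_eq_finrank
    (by rw [hd, Module.finrank_prod])).1 hinj⟩

variable {E : Type*} [NormedAddCommGroup E] [NormedSpace ℝ E] [FiniteDimensional ℝ E]
  {F : Type*} [NormedAddCommGroup F] [NormedSpace ℝ F] [FiniteDimensional ℝ F]
  {G : Type*} [NormedAddCommGroup G] [NormedSpace ℝ G] [FiniteDimensional ℝ G]
  {K : Type*} [Group K] [TopologicalSpace K] [ChartedSpace F K] [LieGroup 𝓘(ℝ, F) ∞ K]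
  {Z : Type*} [TopologicalSpace Z] [ChartedSpace E Z] [IsManifold 𝓘(ℝ, E) ∞ Z]
  [MulAction K Z] [ContMDiffSMul 𝓘(ℝ, F) 𝓘(ℝ, E) ∞ K Z]

/-- There is a smooth map with a given differential at the origin. -/
theorem exists_contMDiffOn_derivTo_eq (z : Z) (L : G →ₗ[ℝ] TangentSpace 𝓘(ℝ, E) z) :
    ∃ (s : G → Z) (D : Set G), IsOpen D ∧ (0 : G) ∈ D ∧ ContMDiffOn 𝓘(ℝ, G) 𝓘(ℝ, E) ∞ s D ∧
      s 0 = z ∧ ∀ v, derivTo 𝓘(ℝ, G) 𝓘(ℝ, E) s 0 z v = L v := by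
  let φ := extChartDiffeo 𝓘(ℝ, E) z
  have hz : z ∈ φ.source := mem_extChartAt_source z
  have hφz : φ.symm (φ z) = z := φ.left_inv hz
  let d : TangentSpace 𝓘(ℝ, E) z →ₗ[ℝ] E := (mfderiv 𝓘(ℝ, E) 𝓘(ℝ, E) φ z).toLinearMap
  let A : G →L[ℝ] E := LinearMap.toContinuousLinearMap (d ∘ₗ L)
  let a : G → E := fun u => φ z + A u
  have ha : ContDiff ℝ ∞ a := by fun_prop
  have ha0 : a 0 = φ z := by simp [a]
  have hD : IsOpen (a ⁻¹' φ.target) := φ.open_target.preimage ha.continuous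
  have h0 : (0 : G) ∈ a ⁻¹' φ.target := by
    rw [mem_preimage, ha0]; exact φ.map_source hz
  refine ⟨fun u => φ.symm (a u), a ⁻¹' φ.target, hD, h0,
    φ.symm.contMDiffOn.comp ha.contMDiff.contMDiffOn fun _ h => h, ?_, fun v => ?_⟩
  · change φ.symm (a 0) = z
    rw [ha0, hφz]
  · have hs : MDifferentiableAt 𝓘(ℝ, E) 𝓘(ℝ, E) φ.symm (φ z) :=
      φ.symm.mdifferentiableAt (by simp) (φ.map_source hz)
    have hφ : MDifferentiableAt 𝓘(ℝ, E) 𝓘(ℝ, E) φ z := φ.mdifferentiableAt (by simp) hz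
    have h1 : derivTo 𝓘(ℝ, G) 𝓘(ℝ, E) a 0 (φ z) v =
        derivTo 𝓘(ℝ, E) 𝓘(ℝ, E) φ z (φ z) (L v) := by
      have : HasFDerivAt a A 0 := (A.hasFDerivAt).const_add _
      change mfderiv 𝓘(ℝ, G) 𝓘(ℝ, E) a 0 v = _
      rw [mfderiv_eq_fderiv, this.fderiv]
      rfl
    refine (derivTo_comp (f := a) (g := φ.symm) (y := φ z) ha0 hs
      (ha.contMDiff.mdifferentiable (by simp) 0) v).trans ?_
    rw [h1]
    refine (derivTo_comp (f := φ) (g := φ.symm) rfl hs hφ (L v)).symm.trans ?_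
    have hev : φ.symm ∘ φ =ᶠ[𝓝 z] id := by
      filter_upwards [φ.open_source.mem_nhds hz] with y hy using φ.left_inv hy
    rw [derivTo_congr hev, derivTo_id]

/-- The differential of `(k, x) ↦ k • ι x`. -/
theorem derivTo_smul_comp {H' : Type*} [TopologicalSpace H'] {J : ModelWithCorners ℝ G H'}
    {X : Type*} [TopologicalSpace X] [ChartedSpace H' X] {ι : X → Z} {x : X}
    (hι : MDifferentiableAt J 𝓘(ℝ, E) ι x) (k : K)
    (v : TangentSpace (𝓘(ℝ, F).prod J) (k, x)) :
    mfderiv (𝓘(ℝ, F).prod J) 𝓘(ℝ, E) (fun p : K × X => p.1 • ι p.2) (k, x) v =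
      translate E k (ι x) (orbitMap F K (ι x) (leftTriv F k v.1) +
        mfderiv J 𝓘(ℝ, E) ι x v.2) := by
  have h1 : HasMFDerivAt (𝓘(ℝ, F).prod J) (𝓘(ℝ, F).prod 𝓘(ℝ, E))
      (fun p : K × X => (p.1, ι p.2)) (k, x)
      ((ContinuousLinearMap.fst ℝ (TangentSpace 𝓘(ℝ, F) k) (TangentSpace J x)).prod
        ((mfderiv J 𝓘(ℝ, E) ι x).comp
          (ContinuousLinearMap.snd ℝ (TangentSpace 𝓘(ℝ, F) k) (TangentSpace J x)))) :=
    (hasMFDerivAt_fst (k, x)).prodMk (hι.hasMFDerivAt.comp (k, x) (hasMFDerivAt_snd (k, x)))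
  have h2 := ((contMDiff_act E F K Z).mdifferentiable (by simp) (k, ι x)).hasMFDerivAt.comp
    (k, x) h1
  have h3 := h2.mfderiv
  refine (DFunLike.congr_fun h3 v).trans ?_
  exact mfderiv_act (k, ι x) _

/-- The slice theorem for locally free actions: near `z`, the manifold is parametrized by
`(k, u) ↦ k • s u`, for a section `s` transverse to the orbit. -/
theorem exists_slice (z : Z) (hz : Function.Injective (orbitMap (E := E) F K z))
    (hd : Module.finrank ℝ E = Module.finrank ℝ F + Module.finrank ℝ G)
    {W₀ : Set K} (hW₀ : W₀ ∈ 𝓝 (1 : K)) :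
    ∃ (Ψ : PartialDiffeomorph (𝓘(ℝ, F).prod 𝓘(ℝ, G)) 𝓘(ℝ, E) (K × G) Z ∞) (s : G → Z)
      (W : Set K) (D : Set G), IsOpen W ∧ IsOpen D ∧ W ⊆ W₀ ∧ (1 : K) ∈ W ∧ (0 : G) ∈ D ∧
      Ψ.source = W ×ˢ D ∧ ContMDiffOn 𝓘(ℝ, G) 𝓘(ℝ, E) ∞ s D ∧ s 0 = z ∧
      ∀ k ∈ W, ∀ u ∈ D, Ψ (k, u) = k • s u := by
  obtain ⟨L, hL⟩ := exists_bijective_coprod (G := G) (orbitMap (E := E) F K z).toLinearMap hz hd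
  obtain ⟨s, D, hD, h0, hs, hs0, hsd⟩ := exists_contMDiffOn_derivTo_eq z L
  subst hs0
  have hf : ContMDiffOn (𝓘(ℝ, F).prod 𝓘(ℝ, G)) 𝓘(ℝ, E) ∞ (fun p : K × G => p.1 • s p.2)
      (univ ×ˢ D) :=
    (contMDiff_act E F K Z).comp_contMDiffOn
      (contMDiff_fst.contMDiffOn.prodMk (hs.comp contMDiff_snd.contMDiffOn fun p hp => hp.2))
  have hb : Function.Bijective (mfderiv (𝓘(ℝ, F).prod 𝓘(ℝ, G)) 𝓘(ℝ, E)
      (fun p : K × G => p.1 • s p.2) (1, 0)) := by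
    have e : ∀ v, mfderiv (𝓘(ℝ, F).prod 𝓘(ℝ, G)) 𝓘(ℝ, E)
        (fun p : K × G => p.1 • s p.2) (1, 0) v =
        (orbitMap (E := E) F K (s 0)).toLinearMap.coprod L v := by
      intro v
      refine (derivTo_smul_comp ((hs.contMDiffAt (hD.mem_nhds h0)).mdifferentiableAt (by simp))
        1 v).trans ((translate_one _ _).trans ?_)
      exact congrArg₂ (fun a b : TangentSpace 𝓘(ℝ, E) (s 0) => a + b)
        (congrArg (orbitMap F K (s 0)) (leftTriv_one _)) (hsd v.2)
    have e' : ⇑(mfderiv (𝓘(ℝ, F).prod 𝓘(ℝ, G)) 𝓘(ℝ, E)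
        (fun p : K × G => p.1 • s p.2) (1, 0)) =
        ⇑((orbitMap (E := E) F K (s 0)).toLinearMap.coprod L) := funext e
    rw [e']
    exact hL
  obtain ⟨Φ, h1Φ, hΦ⟩ := isLocalDiffeomorphAt_of_bijective_mfderiv (isOpen_univ.prod hD) hf
    (x := (1, 0)) ⟨mem_univ _, h0⟩ hb
  obtain ⟨W₁, D₁, hW₁, h1W₁, hD₁, h0D₁, hsub⟩ := mem_nhds_prod_iff'.1 (Φ.open_source.mem_nhds h1Φ)
  obtain ⟨W₂, hW₂, hW₂o, h1W₂⟩ := mem_nhds_iff.1 hW₀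
  have hopen : IsOpen ((W₁ ∩ W₂) ×ˢ (D₁ ∩ D)) := (hW₁.inter hW₂o).prod (hD₁.inter hD)
  refine ⟨restrDiffeo Φ _ hopen, s, W₁ ∩ W₂, D₁ ∩ D, hW₁.inter hW₂o, hD₁.inter hD,
    fun k hk => hW₂ hk.2, ⟨h1W₁, h1W₂⟩, ⟨h0D₁, h0⟩, ?_, hs.mono inter_subset_right, rfl, ?_⟩
  · rw [restrDiffeo_source]
    refine inter_eq_right.2 fun p hp => hsub ⟨hp.1.1, hp.2.1⟩
  · intro k hk u hu
    exact (hΦ (hsub ⟨hk.1, hu.1⟩)).symm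

end Slice

/-! ### Morita maps -/

section MoritaGeneral

variable {E : Type*} [NormedAddCommGroup E] [NormedSpace ℝ E]
  {H : Type*} [TopologicalSpace H]
  {E' : Type*} [NormedAddCommGroup E'] [NormedSpace ℝ E'] {H' : Type*} [TopologicalSpace H']
  {E'' : Type*} [NormedAddCommGroup E''] [NormedSpace ℝ E''] {H'' : Type*} [TopologicalSpace H'']
  {I : ModelWithCorners ℝ E H} {I' : ModelWithCorners ℝ E' H'} {I'' : ModelWithCorners ℝ E'' H''}
  {M : Type*} [TopologicalSpace M] [ChartedSpace H M]
  {N : Type*} [TopologicalSpace N] [ChartedSpace H' N]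
  {P : Type*} [TopologicalSpace P] [ChartedSpace H'' P]

/-- A smooth map is an embedding if its composite with some smooth map is. -/
theorem IsEmbedding.of_comp {f : M → N} {g : N → P} (hf : ContMDiff I I' ∞ f)
    (hg : ContMDiff I' I'' ∞ g) (hgf : IsEmbedding I I'' (g ∘ f)) : IsEmbedding I I' f where
  contMDiff := hf
  injective_mfderiv x v w hvw := by
    have h := mfderiv_comp x (hg.mdifferentiable (by simp) _) (hf.mdifferentiable (by simp) x)
    apply hgf.injective_mfderiv x
    rw [h]
    exact congrArg (mfderiv I' I'' g (f x)) hvw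
  isEmbedding := Topology.IsEmbedding.of_comp hf.continuous hg.continuous hgf.isEmbedding

theorem isEmbedding_id : IsEmbedding I I (id : M → M) where
  contMDiff := contMDiff_id
  injective_mfderiv x v w hvw := by
    rw [mfderiv_id] at hvw
    exact hvw
  isEmbedding := Topology.IsEmbedding.id

/-- The identity of a Lie groupoid is a Morita map. -/
theorem isMoritaMap_id {𝒢 : GroupoidData M N} (h : 𝒢.IsLieGroupoid I I') :
    𝒢.IsMoritaMap I I' I I' 𝒢 id id where
  smooth_obj := contMDiff_id
  smooth_arr := contMDiff_id
  map_s _ := rfl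
  map_t _ := rfl
  map_u _ := rfl
  map_m _ _ _ := rfl
  ess_surjective y := ⟨y, 𝒢.u y, (h.s_u y).symm, h.t_u y⟩
  ess_submersion x g hx z := by
    obtain ⟨w, hw⟩ := h.submersion_t.surjective_mfderiv g z
    refine ⟨derivTo I' I 𝒢.s g x w, w, ?_, hw⟩
    have hx' : 𝒢.s g = x := hx.symm
    subst hx'
    rw [derivTo_id]
    rfl
  ff_embedding := by
    refine IsEmbedding.of_comp (g := fun p : M × M × N => p.2.2) (I'' := I') ?_ ?_ isEmbedding_id
    · exact h.submersion_s.contMDiff.prodMk (h.submersion_t.contMDiff.prodMk contMDiff_id)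
    · exact contMDiff_snd.comp contMDiff_snd
  ff_range := by
    ext ⟨x, y, g⟩
    constructor
    · rintro ⟨g', hg'⟩
      obtain ⟨rfl, rfl, rfl⟩ : 𝒢.s g' = x ∧ 𝒢.t g' = y ∧ g' = g := by simpa using hg'
      exact ⟨rfl, rfl⟩
    · rintro ⟨h1, h2⟩
      refine ⟨g, ?_⟩
      have h1' : x = 𝒢.s g := h1
      have h2' : y = 𝒢.t g := h2
      rw [h1', h2']
      rfl

end MoritaGeneral

/-! ### The restriction of an action groupoid to a complete transversal -/

section Transversal

variable {E : Type*} [NormedAddCommGroup E] [NormedSpace ℝ E] [FiniteDimensional ℝ E]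
  {F : Type*} [NormedAddCommGroup F] [NormedSpace ℝ F] [FiniteDimensional ℝ F]
  {G : Type*} [NormedAddCommGroup G] [NormedSpace ℝ G] [FiniteDimensional ℝ G]
  {K : Type*} [Group K] [TopologicalSpace K] [ChartedSpace F K] [LieGroup 𝓘(ℝ, F) ∞ K]
  {Z : Type*} [TopologicalSpace Z] [ChartedSpace E Z] [IsManifold 𝓘(ℝ, E) ∞ Z]
  [MulAction K Z] [ContMDiffSMul 𝓘(ℝ, F) 𝓘(ℝ, E) ∞ K Z]
  {X : Type*} [TopologicalSpace X] [ChartedSpace G X] [IsManifold 𝓘(ℝ, G) ∞ X]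

variable (E F G K) in
/-- A complete transversal to the orbits: a smooth map `ι` to `Z` which meets all orbits, and whose
tangent spaces are complementary to those of the orbits. -/
structure IsCompleteTransversal (ι : X → Z) : Prop where
  contMDiff : ContMDiff 𝓘(ℝ, G) 𝓘(ℝ, E) ∞ ι
  bijective : ∀ x : X, Function.Bijective
    ((orbitMap (E := E) F K (ι x)).coprod (mfderiv 𝓘(ℝ, G) 𝓘(ℝ, E) ι x))
  exists_smul : ∀ z : Z, ∃ (k : K) (x : X), k • ι x = z

variable (K) in
/-- The arrows of the action groupoid between points of a transversal: triples `(x, k, y)` with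
`k • ι x = ι y`. -/
def restrictedArrows (ι : X → Z) : Set (X × K × X) := {p | p.2.1 • ι p.1 = ι p.2.2}

open Classical in
variable (K) in
/-- The restriction of the action groupoid to a transversal. The arrow `(x, k, y)` goes from `x` to
`y`; the product of arrows which are not composable is a junk value. -/
def restrictedGroupoid (ι : X → Z) : GroupoidData X (restrictedArrows K ι) where
  s p := p.1.1
  t p := p.1.2.2
  u x := ⟨(x, 1, x), one_smul K (ι x)⟩
  i p := ⟨(p.1.2.2, p.1.2.1⁻¹, p.1.1), inv_smul_eq_iff.2 (show _ = _ from p.2).symm⟩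
  m p q := if h : p.1.1 = q.1.2.2 then ⟨(q.1.1, p.1.2.1 * q.1.2.1, p.1.2.2), by
    have h1 : q.1.2.1 • ι q.1.1 = ι q.1.2.2 := q.2
    have h2 : p.1.2.1 • ι p.1.1 = ι p.1.2.2 := p.2
    change (p.1.2.1 * q.1.2.1) • ι q.1.1 = ι p.1.2.2
    rw [mul_smul, h1, ← h, h2]⟩ else p

theorem restrictedGroupoid_m_val {ι : X → Z} (p q : restrictedArrows K ι) (h : p.1.1 = q.1.2.2) :
    ((restrictedGroupoid K ι).m p q).1 = (q.1.1, p.1.2.1 * q.1.2.1, p.1.2.2) :=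
  congrArg Subtype.val (dif_pos h)

variable (F) in
/-- The right trivialization `T_k K → T_1 K`. -/
def rightTriv (k : K) : TangentSpace 𝓘(ℝ, F) k →L[ℝ] GroupLieAlgebra 𝓘(ℝ, F) K :=
  derivTo 𝓘(ℝ, F) 𝓘(ℝ, F) (fun h : K => h * k⁻¹) k 1

theorem contMDiff_mul_right' (k : K) : ContMDiff 𝓘(ℝ, F) 𝓘(ℝ, F) ∞ fun h : K => h * k :=
  contMDiff_mul_right

theorem injective_rightTriv (k : K) : Function.Injective (rightTriv F k) := by
  have hk := (contMDiff_mul_right' (F := F) k).mdifferentiable (by simp)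
  have hk' := (contMDiff_mul_right' (F := F) k⁻¹).mdifferentiable (by simp)
  have h1 : ∀ v, derivTo 𝓘(ℝ, F) 𝓘(ℝ, F) (fun h : K => h * k) 1 k (rightTriv F k v) = v := by
    intro v
    refine (derivTo_comp (f := fun h : K => h * k⁻¹) (g := fun h : K => h * k) (x := k)
      (y := 1) (z := k) (by simp) (hk _) (hk' _) v).symm.trans ?_
    have e : (fun h : K => h * k) ∘ (fun h : K => h * k⁻¹) = id := by
      funext h; simp
    rw [e, derivTo_id]
  exact Function.LeftInverse.injective h1

/-- Fundamental fields are equivariant: `k` moves `ξ_Z(z)` to `(Ad_k ξ)_Z(k • z)`. Here `Ad_k` appears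
as the passage from the left to the right trivialization of `T_k K`. -/
theorem translate_orbitMap_leftTriv (k : K) (z : Z) (κ : TangentSpace 𝓘(ℝ, F) k) :
    translate E k z (orbitMap F K z (leftTriv F k κ)) =
      orbitMap F K (k • z) (rightTriv F k κ) := by
  rw [← mfderiv_orbit]
  have ho := (contMDiff_orbit E F K (k • z)).mdifferentiable (by simp)
  have hl := (contMDiff_mul_right' (F := F) k⁻¹).mdifferentiable (by simp)
  have e : (fun h : K => h • z) = (fun h : K => h • (k • z)) ∘ fun h : K => h * k⁻¹ := by
    funext h
    simp [smul_smul]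
  change derivTo 𝓘(ℝ, F) 𝓘(ℝ, E) (fun h : K => h • z) k (k • z) κ = _
  conv_lhs => rw [e]
  rw [derivTo_comp (y := 1) (by simp) (ho 1) (hl k)]
  rfl

namespace IsCompleteTransversal

variable {ι : X → Z} (h : IsCompleteTransversal E F G K ι)

include h

theorem finrank_eq (x : X) :
    Module.finrank ℝ E = Module.finrank ℝ F + Module.finrank ℝ G := by
  have := (LinearEquiv.ofBijective ((orbitMap (E := E) F K (ι x)).coprod
    (mfderiv 𝓘(ℝ, G) 𝓘(ℝ, E) ι x)).toLinearMap (h.bijective x)).finrank_eq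
  rw [Module.finrank_prod] at this
  exact this.symm

theorem eq_zero_of_add_eq_zero {x : X} {ξ : GroupLieAlgebra 𝓘(ℝ, F) K}
    {v : TangentSpace 𝓘(ℝ, G) x}
    (h0 : orbitMap (E := E) F K (ι x) ξ + mfderiv 𝓘(ℝ, G) 𝓘(ℝ, E) ι x v = 0) : ξ = 0 ∧ v = 0 := by
  have h1 : ((ξ, v) : GroupLieAlgebra 𝓘(ℝ, F) K × TangentSpace 𝓘(ℝ, G) x) = 0 :=
    (h.bijective x).1 ((show (orbitMap (E := E) F K (ι x)).coprod
      (mfderiv 𝓘(ℝ, G) 𝓘(ℝ, E) ι x) (ξ, v) = 0 from h0).trans (map_zero _).symm)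
  exact ⟨congrArg Prod.fst h1, congrArg Prod.snd h1⟩

/-- The differential of the map `(x, k, y) ↦ k • ι x`. -/
theorem mfderiv_target (p : X × K × X)
    (v : TangentSpace (𝓘(ℝ, G).prod (𝓘(ℝ, F).prod 𝓘(ℝ, G))) p) :
    mfderiv (𝓘(ℝ, G).prod (𝓘(ℝ, F).prod 𝓘(ℝ, G))) 𝓘(ℝ, E)
      (fun p : X × K × X => p.2.1 • ι p.1) p v =
      translate E p.2.1 (ι p.1) (orbitMap F K (ι p.1) (leftTriv F p.2.1 v.2.1) +
        mfderiv 𝓘(ℝ, G) 𝓘(ℝ, E) ι p.1 v.1) := by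
  have h1 : HasMFDerivAt (𝓘(ℝ, G).prod (𝓘(ℝ, F).prod 𝓘(ℝ, G))) (𝓘(ℝ, F).prod 𝓘(ℝ, G))
      (fun p : X × K × X => (p.2.1, p.1)) p _ :=
    ((hasMFDerivAt_fst p.2).comp p (hasMFDerivAt_snd p)).prodMk (hasMFDerivAt_fst p)
  have h2 : MDifferentiable (𝓘(ℝ, F).prod 𝓘(ℝ, G)) 𝓘(ℝ, E)
      (fun q : K × X => q.1 • ι q.2) :=
    ((contMDiff_act E F K Z).comp
      (contMDiff_fst.prodMk (h.contMDiff.comp contMDiff_snd))).mdifferentiable (by simp)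
  have h3 := ((h2 (p.2.1, p.1)).hasMFDerivAt.comp p h1).mfderiv
  refine (DFunLike.congr_fun h3 v).trans ?_
  exact derivTo_smul_comp (h.contMDiff.mdifferentiable (by simp) p.1) p.2.1 _

theorem contMDiff_target : ContMDiff (𝓘(ℝ, G).prod (𝓘(ℝ, F).prod 𝓘(ℝ, G))) 𝓘(ℝ, E) ∞
    (fun p : X × K × X => p.2.1 • ι p.1) :=
  (contMDiff_act E F K Z).comp ((contMDiff_fst.comp contMDiff_snd).prodMk
    (h.contMDiff.comp contMDiff_fst))

theorem contMDiff_end : ContMDiff (𝓘(ℝ, G).prod (𝓘(ℝ, F).prod 𝓘(ℝ, G))) 𝓘(ℝ, E) ∞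
    (fun p : X × K × X => ι p.2.2) :=
  h.contMDiff.comp (contMDiff_snd.comp contMDiff_snd)

/-- The arrows between points of a transversal form a submanifold, which has the dimension of the
transversal. -/
theorem exists_isRegularEmbedding_arrows :
    ∃ (_ : ChartedSpace G (restrictedArrows K ι)) (_ : IsManifold 𝓘(ℝ, G) ∞ (restrictedArrows K ι)),
      IsRegularEmbedding 𝓘(ℝ, G) (𝓘(ℝ, G).prod (𝓘(ℝ, F).prod 𝓘(ℝ, G)))
        (Subtype.val : restrictedArrows K ι → X × K × X) := by
  by_cases hX : Nonempty X
  swap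
  · -- without points, the dimensions of the model spaces are unrelated, and nothing is to be shown
    refine exists_isRegularEmbedding_of_sliceCharts (V := E) _ fun p => (hX ⟨p.1⟩).elim
  obtain ⟨x₀⟩ := hX
  have hdim := h.finrank_eq x₀
  refine exists_isRegularEmbedding_of_regular (V := E) ?_ _ fun p hp => ?_
  · rw [Module.finrank_prod, Module.finrank_prod]
    omega
  -- in a chart of `Z` near `ι y`, the equation `k • ι x = ι y` becomes `f = 0`
  let φ := extChartDiffeo 𝓘(ℝ, E) (ι p.2.2)
  let f : X × K × X → E := fun q => φ (q.2.1 • ι q.1) - φ (ι q.2.2)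
  let U : Set (X × K × X) := (fun q => q.2.1 • ι q.1) ⁻¹' φ.source ∩ (fun q => ι q.2.2) ⁻¹' φ.source
  have hU : IsOpen U := (φ.open_source.preimage h.contMDiff_target.continuous).inter
    (φ.open_source.preimage h.contMDiff_end.continuous)
  have hp' : p.2.1 • ι p.1 = ι p.2.2 := hp
  have hy : ι p.2.2 ∈ φ.source := mem_extChartAt_source _
  have hpU : p ∈ U := ⟨by rw [mem_preimage, hp']; exact hy, hy⟩
  have hf1 : ContMDiffOn (𝓘(ℝ, G).prod (𝓘(ℝ, F).prod 𝓘(ℝ, G))) 𝓘(ℝ, E) ∞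
      (fun q : X × K × X => φ (q.2.1 • ι q.1)) U :=
    φ.contMDiffOn.comp h.contMDiff_target.contMDiffOn fun q hq => hq.1
  have hf2 : ContMDiffOn (𝓘(ℝ, G).prod (𝓘(ℝ, F).prod 𝓘(ℝ, G))) 𝓘(ℝ, E) ∞
      (fun q : X × K × X => φ (ι q.2.2)) U :=
    φ.contMDiffOn.comp h.contMDiff_end.contMDiffOn fun q hq => hq.2
  have hf : ContMDiffOn (𝓘(ℝ, G).prod (𝓘(ℝ, F).prod 𝓘(ℝ, G))) 𝓘(ℝ, E) ∞ f U := hf1.sub hf2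
  refine ⟨f, U, hU, hpU, hf, ?_, fun q hq => ?_⟩
  · intro w
    -- vary `x` and `k` only
    have hφb := bijective_mfderiv_of_isLocalDiffeomorphAt (φ.isLocalDiffeomorphAt _ _ _ hy)
    obtain ⟨w₁, hw₁⟩ := hφb.2 w
    have hk := bijective_translate (K := K) (Z := Z)
      (ContMDiffSMul.contMDiff_const_smul (I := 𝓘(ℝ, F)) (I' := 𝓘(ℝ, E))) p.2.1 (ι p.1)
    obtain ⟨w₂, hw₂⟩ := hk.2 w₁
    obtain ⟨⟨ξ, v⟩, hv⟩ := (h.bijective p.1).2 w₂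
    obtain ⟨κ, hκ⟩ := (bijective_leftTriv (F := F) p.2.1).2 ξ
    refine ⟨((v, κ, 0) : G × F × G), ?_⟩
    have e1 := (hf1.contMDiffAt (hU.mem_nhds hpU)).mdifferentiableAt (by simp)
    have e2 := (hf2.contMDiffAt (hU.mem_nhds hpU)).mdifferentiableAt (by simp)
    have e3 : mfderiv (𝓘(ℝ, G).prod (𝓘(ℝ, F).prod 𝓘(ℝ, G))) 𝓘(ℝ, E) f p = _ := mfderiv_sub e1 e2
    refine (DFunLike.congr_fun e3 _).trans ?_
    have hφd : MDifferentiableAt 𝓘(ℝ, E) 𝓘(ℝ, E) φ (ι p.2.2) := φ.mdifferentiableAt (by simp) hy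
    have e4 : derivTo (𝓘(ℝ, G).prod (𝓘(ℝ, F).prod 𝓘(ℝ, G))) 𝓘(ℝ, E)
        (fun q : X × K × X => φ (q.2.1 • ι q.1)) p (φ (ι p.2.2)) ((v, κ, 0) : G × F × G) = w := by
      refine (derivTo_comp (f := fun q : X × K × X => q.2.1 • ι q.1) (g := φ) (y := ι p.2.2) hp'
        hφd (h.contMDiff_target.mdifferentiable (by simp) p) ((v, κ, 0) : G × F × G)).trans ?_
      refine Eq.trans (congrArg (mfderiv 𝓘(ℝ, E) 𝓘(ℝ, E) φ (ι p.2.2)) ?_) hw₁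
      refine (h.mfderiv_target p ((v, κ, 0) : G × F × G)).trans (Eq.trans ?_ hw₂)
      refine congrArg (translate E p.2.1 (ι p.1)) (Eq.trans ?_ hv)
      exact congrArg (fun ζ => orbitMap (E := E) F K (ι p.1) ζ +
        mfderiv 𝓘(ℝ, G) 𝓘(ℝ, E) ι p.1 v) hκ
    have e5 : derivTo (𝓘(ℝ, G).prod (𝓘(ℝ, F).prod 𝓘(ℝ, G))) 𝓘(ℝ, E)
        (fun q : X × K × X => φ (ι q.2.2)) p (φ (ι p.2.2)) ((v, κ, 0) : G × F × G) = 0 := by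
      have hφι : MDifferentiableAt 𝓘(ℝ, G) 𝓘(ℝ, E) (φ ∘ ι) p.2.2 :=
        hφd.comp _ (h.contMDiff.mdifferentiable (by simp) _)
      refine (derivTo_comp (f := fun q : X × K × X => q.2.2) (g := φ ∘ ι) (y := p.2.2) rfl
        hφι ((contMDiff_snd.comp contMDiff_snd).mdifferentiable (n := ∞) (by simp) p)
        ((v, κ, 0) : G × F × G)).trans ?_
      refine Eq.trans (congrArg _ ?_) (map_zero _)
      have := ((hasMFDerivAt_snd (I := 𝓘(ℝ, F)) (I' := 𝓘(ℝ, G)) p.2).comp p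
        (hasMFDerivAt_snd (I := 𝓘(ℝ, G)) (I' := 𝓘(ℝ, F).prod 𝓘(ℝ, G)) p)).mfderiv
      exact DFunLike.congr_fun this ((v, κ, 0) : G × F × G)
    exact (congrArg₂ (fun a b : E => a - b) e4 e5).trans (sub_zero w)
  · change q.2.1 • ι q.1 = ι q.2.2 ↔ φ (q.2.1 • ι q.1) - φ (ι q.2.2) = 0
    rw [sub_eq_zero]
    exact ⟨fun e => by rw [e], fun e => φ.injOn hq.1 hq.2 e⟩

end IsCompleteTransversal

end Transversal

/-! ### The étale groupoid of a transversal -/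

section Etale

variable {E : Type*} [NormedAddCommGroup E] [NormedSpace ℝ E] [FiniteDimensional ℝ E]
  {F : Type*} [NormedAddCommGroup F] [NormedSpace ℝ F] [FiniteDimensional ℝ F]
  {G : Type*} [NormedAddCommGroup G] [NormedSpace ℝ G] [FiniteDimensional ℝ G]
  {K : Type*} [Group K] [TopologicalSpace K] [ChartedSpace F K] [LieGroup 𝓘(ℝ, F) ∞ K]
  {Z : Type*} [TopologicalSpace Z] [ChartedSpace E Z] [IsManifold 𝓘(ℝ, E) ∞ Z]
  [MulAction K Z] [ContMDiffSMul 𝓘(ℝ, F) 𝓘(ℝ, E) ∞ K Z]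
  {X : Type*} [TopologicalSpace X] [ChartedSpace G X] [IsManifold 𝓘(ℝ, G) ∞ X]
  {ι : X → Z} [ChartedSpace G (restrictedArrows K ι)]
  [IsManifold 𝓘(ℝ, G) ∞ (restrictedArrows K ι)]

namespace IsCompleteTransversal

variable (h : IsCompleteTransversal E F G K ι)
  (hA : IsRegularEmbedding 𝓘(ℝ, G) (𝓘(ℝ, G).prod (𝓘(ℝ, F).prod 𝓘(ℝ, G)))
    (Subtype.val : restrictedArrows K ι → X × K × X))

include hA in
theorem contMDiff_restricted_s : ContMDiff 𝓘(ℝ, G) 𝓘(ℝ, G) ∞ (restrictedGroupoid K ι).s :=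
  contMDiff_fst.comp hA.contMDiff

include hA in
theorem contMDiff_restricted_k :
    ContMDiff 𝓘(ℝ, G) 𝓘(ℝ, F) ∞ (fun a : restrictedArrows K ι => a.1.2.1) :=
  (contMDiff_fst.comp contMDiff_snd).comp hA.contMDiff

include hA in
theorem contMDiff_restricted_t : ContMDiff 𝓘(ℝ, G) 𝓘(ℝ, G) ∞ (restrictedGroupoid K ι).t :=
  (contMDiff_snd.comp contMDiff_snd).comp hA.contMDiff

include hA in
theorem mfderiv_restricted_s (a : restrictedArrows K ι) (V : TangentSpace 𝓘(ℝ, G) a) :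
    mfderiv 𝓘(ℝ, G) 𝓘(ℝ, G) (restrictedGroupoid K ι).s a V =
      (mfderiv 𝓘(ℝ, G) (𝓘(ℝ, G).prod (𝓘(ℝ, F).prod 𝓘(ℝ, G))) Subtype.val a V).1 := by
  have h1 := ((hasMFDerivAt_fst (I := 𝓘(ℝ, G)) (I' := 𝓘(ℝ, F).prod 𝓘(ℝ, G)) a.1).comp a
    (hA.contMDiff.mdifferentiable (by simp) a).hasMFDerivAt).mfderiv
  exact DFunLike.congr_fun h1 V

include hA in
theorem mfderiv_restricted_t (a : restrictedArrows K ι) (V : TangentSpace 𝓘(ℝ, G) a) :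
    mfderiv 𝓘(ℝ, G) 𝓘(ℝ, G) (restrictedGroupoid K ι).t a V =
      (mfderiv 𝓘(ℝ, G) (𝓘(ℝ, G).prod (𝓘(ℝ, F).prod 𝓘(ℝ, G))) Subtype.val a V).2.2 := by
  have h0 := (hasMFDerivAt_snd (I := 𝓘(ℝ, F)) (I' := 𝓘(ℝ, G)) a.1.2).comp a.1
    (hasMFDerivAt_snd (I := 𝓘(ℝ, G)) (I' := 𝓘(ℝ, F).prod 𝓘(ℝ, G)) a.1)
  have h1 := (HasMFDerivAt.comp (f := Subtype.val) a h0
    (hA.contMDiff.mdifferentiable (by simp) a).hasMFDerivAt).mfderiv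
  exact DFunLike.congr_fun h1 V

include h hA

/-- The equation satisfied by the tangent vectors `(v, κ, w)` to the arrows, obtained by
differentiating `k • ι x = ι y`. -/
theorem tangent_arrow (a : restrictedArrows K ι) (V : TangentSpace 𝓘(ℝ, G) a) :
    ∃ (v : TangentSpace 𝓘(ℝ, G) a.1.1) (κ : TangentSpace 𝓘(ℝ, F) a.1.2.1)
      (w : TangentSpace 𝓘(ℝ, G) a.1.2.2),
      mfderiv 𝓘(ℝ, G) (𝓘(ℝ, G).prod (𝓘(ℝ, F).prod 𝓘(ℝ, G))) Subtype.val a V =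
        ((v, κ, w) : G × F × G) ∧
      mfderiv 𝓘(ℝ, G) 𝓘(ℝ, G) (restrictedGroupoid K ι).s a V = v ∧
      mfderiv 𝓘(ℝ, G) 𝓘(ℝ, G) (restrictedGroupoid K ι).t a V = w ∧
      translate E a.1.2.1 (ι a.1.1) (orbitMap F K (ι a.1.1) (leftTriv F a.1.2.1 κ) +
        mfderiv 𝓘(ℝ, G) 𝓘(ℝ, E) ι a.1.1 v) =
        derivTo 𝓘(ℝ, G) 𝓘(ℝ, E) ι a.1.2.2 (a.1.2.1 • ι a.1.1) w := by
  refine ⟨_, _, _, rfl, mfderiv_restricted_s hA a V, mfderiv_restricted_t hA a V, ?_⟩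
  have hval := hA.contMDiff.mdifferentiable (by simp) a
  have e : (fun p : X × K × X => p.2.1 • ι p.1) ∘ (Subtype.val : restrictedArrows K ι → X × K × X) =
      ι ∘ (restrictedGroupoid K ι).t := funext fun b => b.2
  have h1 := derivTo_comp (f := (Subtype.val : restrictedArrows K ι → X × K × X))
    (g := fun p : X × K × X => p.2.1 • ι p.1) (x := a) (z := a.1.2.1 • ι a.1.1) rfl
    (h.contMDiff_target.mdifferentiable (by simp) a.1) hval V
  have h2 := derivTo_comp (f := (restrictedGroupoid K ι).t)
    (g := ι) (x := a) (z := a.1.2.1 • ι a.1.1) rfl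
    (h.contMDiff.mdifferentiable (by simp) a.1.2.2)
    ((contMDiff_restricted_t hA).mdifferentiable (by simp) a) V
  have h3 := h.mfderiv_target a.1
    (mfderiv 𝓘(ℝ, G) (𝓘(ℝ, G).prod (𝓘(ℝ, F).prod 𝓘(ℝ, G))) Subtype.val a V)
  refine h3.symm.trans (h1.symm.trans (Eq.trans ?_ (h2.trans
    (congrArg (derivTo 𝓘(ℝ, G) 𝓘(ℝ, E) ι a.1.2.2 (a.1.2.1 • ι a.1.1))
      (mfderiv_restricted_t hA a V)))))
  rw [e]

/-- A tangent vector `(0, κ, w)` to the arrows vanishes: it makes `dι w` tangent to the orbit, so that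
`w` and `κ` are zero by transversality. Likewise for the target map. -/
theorem injective_mfderiv_restricted_s (a : restrictedArrows K ι) :
    Function.Injective (mfderiv 𝓘(ℝ, G) 𝓘(ℝ, G) (restrictedGroupoid K ι).s a) := by
  rw [injective_iff_map_eq_zero]
  intro V hV
  obtain ⟨v, κ, w, hval, hs, ht, h1⟩ := h.tangent_arrow hA a V
  have hv : v = 0 := hs.symm.trans hV
  subst hv
  -- move the orbit direction at `ι x` to the point `k • ι x = ι y`, where `w` lives
  rw [map_zero, add_zero, translate_orbitMap_leftTriv] at h1
  have ha : a.1.2.1 • ι a.1.1 = ι a.1.2.2 := a.2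
  rw [ha] at h1
  have h2 := h.eq_zero_of_add_eq_zero (x := a.1.2.2)
    (ξ := rightTriv F a.1.2.1 κ) (v := -w) (by
      rw [map_neg]
      exact (congrArg (· + _) h1).trans (add_neg_cancel _))
  have h3 : κ = 0 := injective_rightTriv a.1.2.1 (h2.1.trans (map_zero _).symm)
  have h4 : w = 0 := neg_eq_zero.1 h2.2
  subst h3 h4
  exact hA.injective_mfderiv a (hval.trans (map_zero _).symm)

theorem injective_mfderiv_restricted_t (a : restrictedArrows K ι) :
    Function.Injective (mfderiv 𝓘(ℝ, G) 𝓘(ℝ, G) (restrictedGroupoid K ι).t a) := by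
  rw [injective_iff_map_eq_zero]
  intro V hV
  obtain ⟨v, κ, w, hval, hs, ht, h1⟩ := h.tangent_arrow hA a V
  have hw : w = 0 := ht.symm.trans hV
  subst hw
  have hk := bijective_translate (K := K) (Z := Z)
      (ContMDiffSMul.contMDiff_const_smul (I := 𝓘(ℝ, F)) (I' := 𝓘(ℝ, E))) a.1.2.1 (ι a.1.1)
  have h2 := h.eq_zero_of_add_eq_zero (hk.1 (h1.trans ((map_zero _).trans (map_zero _).symm)))
  have h3 : κ = 0 := (bijective_leftTriv a.1.2.1).1 (h2.1.trans (map_zero _).symm)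
  have h4 : v = 0 := h2.2
  subst h3 h4
  exact hA.injective_mfderiv a (hval.trans (map_zero _).symm)

theorem bijective_mfderiv_restricted_s (a : restrictedArrows K ι) :
    Function.Bijective (mfderiv 𝓘(ℝ, G) 𝓘(ℝ, G) (restrictedGroupoid K ι).s a) :=
  ⟨h.injective_mfderiv_restricted_s hA a,
    (LinearMap.injective_iff_surjective_of_finrank_eq_finrank
      (f := (mfderiv 𝓘(ℝ, G) 𝓘(ℝ, G) (restrictedGroupoid K ι).s a).toLinearMap) rfl).1
      (h.injective_mfderiv_restricted_s hA a)⟩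

theorem surjective_mfderiv_restricted_t (a : restrictedArrows K ι) :
    Function.Surjective (mfderiv 𝓘(ℝ, G) 𝓘(ℝ, G) (restrictedGroupoid K ι).t a) :=
  (LinearMap.injective_iff_surjective_of_finrank_eq_finrank
      (f := (mfderiv 𝓘(ℝ, G) 𝓘(ℝ, G) (restrictedGroupoid K ι).t a).toLinearMap) rfl).1
      (h.injective_mfderiv_restricted_t hA a)

/-- The restriction to a complete transversal is étale. -/
theorem isLocalDiffeomorph_restricted_s :
    IsLocalDiffeomorph 𝓘(ℝ, G) 𝓘(ℝ, G) ∞ (restrictedGroupoid K ι).s := fun a =>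
  isLocalDiffeomorphAt_of_bijective_mfderiv isOpen_univ
    (contMDiff_restricted_s hA).contMDiffOn (mem_univ a) (h.bijective_mfderiv_restricted_s hA a)

theorem isLieGroupoid_restricted :
    (restrictedGroupoid K ι).IsLieGroupoid 𝓘(ℝ, G) 𝓘(ℝ, G) where
  s_u _ := rfl
  t_u _ := rfl
  s_m p q hpq := by
    change ((restrictedGroupoid K ι).m p q).1.1 = q.1.1
    rw [restrictedGroupoid_m_val p q hpq]
  t_m p q hpq := by
    change ((restrictedGroupoid K ι).m p q).1.2.2 = p.1.2.2
    rw [restrictedGroupoid_m_val p q hpq]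
  m_assoc p q r hpq hqr := by
    have hpq' : p.1.1 = q.1.2.2 := hpq
    have hqr' : q.1.1 = r.1.2.2 := hqr
    have e1 := restrictedGroupoid_m_val p q hpq'
    have e2 := restrictedGroupoid_m_val q r hqr'
    apply Subtype.ext
    have e3 := restrictedGroupoid_m_val ((restrictedGroupoid K ι).m p q) r (by rw [e1]; exact hqr')
    have e4 := restrictedGroupoid_m_val p ((restrictedGroupoid K ι).m q r) (by rw [e2]; exact hpq')
    rw [e3, e4, e1, e2, mul_assoc]
  m_u p := by
    apply Subtype.ext
    rw [restrictedGroupoid_m_val _ _ rfl]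
    exact Prod.ext rfl (Prod.ext (mul_one _) rfl)
  u_m p := by
    apply Subtype.ext
    rw [restrictedGroupoid_m_val _ _ rfl]
    exact Prod.ext rfl (Prod.ext (one_mul _) rfl)
  s_i _ := rfl
  t_i _ := rfl
  m_i p := by
    apply Subtype.ext
    rw [restrictedGroupoid_m_val _ _ rfl]
    exact Prod.ext rfl (Prod.ext (mul_inv_cancel _) rfl)
  i_m p := by
    apply Subtype.ext
    rw [restrictedGroupoid_m_val _ _ rfl]
    exact Prod.ext rfl (Prod.ext (inv_mul_cancel _) rfl)
  submersion_s := ⟨contMDiff_restricted_s hA, fun a => (h.bijective_mfderiv_restricted_s hA a).2⟩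
  submersion_t := ⟨contMDiff_restricted_t hA, h.surjective_mfderiv_restricted_t hA⟩
  smooth_u := hA.contMDiff_of_comp (contMDiff_id.prodMk (contMDiff_const.prodMk contMDiff_id))
  smooth_i := hA.contMDiff_of_comp ((contMDiff_restricted_t hA).prodMk
    ((contMDiff_restricted_k hA).inv.prodMk (contMDiff_restricted_s hA)))
  smooth_m := by
    intro p hp
    have hs := contMDiff_restricted_s hA
    have ht := contMDiff_restricted_t hA
    have hk := contMDiff_restricted_k hA
    have h1 : ContMDiff (𝓘(ℝ, G).prod 𝓘(ℝ, G)) (𝓘(ℝ, G).prod (𝓘(ℝ, F).prod 𝓘(ℝ, G))) ∞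
        (fun p : restrictedArrows K ι × restrictedArrows K ι =>
          (p.2.1.1, p.1.1.2.1 * p.2.1.2.1, p.1.1.2.2)) :=
      (hs.comp contMDiff_snd).prodMk (((hk.comp contMDiff_fst).mul (hk.comp contMDiff_snd)).prodMk
        (ht.comp contMDiff_fst))
    refine hA.contMDiffWithinAt ((h1 p).contMDiffWithinAt.congr ?_ ?_)
    · exact fun q hq => restrictedGroupoid_m_val q.1 q.2 hq
    · exact restrictedGroupoid_m_val p.1 p.2 hp

/-- The inclusion of the restricted groupoid into the action groupoid is a Morita map. -/
theorem isMoritaMap_restricted :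
    (restrictedGroupoid K ι).IsMoritaMap 𝓘(ℝ, G) 𝓘(ℝ, G) 𝓘(ℝ, E) (𝓘(ℝ, F).prod 𝓘(ℝ, E))
      (actionGroupoid K Z) ι (fun a => (a.1.2.1, ι a.1.1)) where
  smooth_obj := h.contMDiff
  smooth_arr := (contMDiff_restricted_k hA).prodMk (h.contMDiff.comp (contMDiff_restricted_s hA))
  map_s _ := rfl
  map_t a := a.2
  map_u _ := rfl
  map_m p q hpq := by
    change (((restrictedGroupoid K ι).m p q).1.2.1, ι ((restrictedGroupoid K ι).m p q).1.1) = _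
    rw [restrictedGroupoid_m_val p q hpq]
    rfl
  ess_surjective z := by
    obtain ⟨k, x, hx⟩ := h.exists_smul z
    exact ⟨x, (k, ι x), rfl, hx⟩
  ess_submersion x g hg ζ := by
    obtain ⟨k, z⟩ := g
    have hg' : ι x = z := hg
    subst hg'
    have hk := bijective_translate (K := K) (Z := Z)
      (ContMDiffSMul.contMDiff_const_smul (I := 𝓘(ℝ, F)) (I' := 𝓘(ℝ, E))) k (ι x)
    obtain ⟨w, hw⟩ := hk.2 ζ
    obtain ⟨⟨ξ, v⟩, hv⟩ := (h.bijective x).2 w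
    obtain ⟨κ, hκ⟩ := (bijective_leftTriv (F := F) k).2 ξ
    refine ⟨v, ((κ, mfderiv 𝓘(ℝ, G) 𝓘(ℝ, E) ι x v) : F × E), ?_, ?_⟩
    · have hs := mfderiv_snd (I := 𝓘(ℝ, F)) (I' := 𝓘(ℝ, E)) (x := (k, ι x))
      exact (DFunLike.congr_fun hs ((κ, mfderiv 𝓘(ℝ, G) 𝓘(ℝ, E) ι x v) : F × E)).symm
    · refine (mfderiv_act (k, ι x) ((κ, mfderiv 𝓘(ℝ, G) 𝓘(ℝ, E) ι x v) : F × E)).trans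
        (Eq.trans (congrArg (translate E k (ι x)) ?_) hw)
      exact (congrArg (fun ζ => orbitMap (E := E) F K (ι x) ζ +
        mfderiv 𝓘(ℝ, G) 𝓘(ℝ, E) ι x v) hκ).trans hv
  ff_embedding := by
    -- the arrow `(x, k, y)` can be read off from its end points and its image `(k, ι x)`
    refine IsEmbedding.of_comp (g := fun p : X × X × K × Z => (p.1, p.2.2.1, p.2.1))
      (I'' := 𝓘(ℝ, G).prod (𝓘(ℝ, F).prod 𝓘(ℝ, G))) ?_ ?_ hA.toIsEmbedding
    · exact (contMDiff_restricted_s hA).prodMk ((contMDiff_restricted_t hA).prodMk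
        ((contMDiff_restricted_k hA).prodMk (h.contMDiff.comp (contMDiff_restricted_s hA))))
    · exact contMDiff_fst.prodMk ((contMDiff_fst.comp (contMDiff_snd.comp contMDiff_snd)).prodMk
        (contMDiff_fst.comp contMDiff_snd))
  ff_range := by
    ext ⟨x, y, k, z⟩
    constructor
    · rintro ⟨a, ha⟩
      obtain ⟨rfl, rfl, rfl, rfl⟩ : (restrictedGroupoid K ι).s a = x ∧
          (restrictedGroupoid K ι).t a = y ∧ a.1.2.1 = k ∧ ι a.1.1 = z := by
        simpa using ha
      exact ⟨rfl, (show a.1.2.1 • ι a.1.1 = ι a.1.2.2 from a.2).symm⟩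
    · rintro ⟨h1, h2⟩
      have h1' : ι x = z := h1
      have h2' : ι y = k • z := h2
      subst h1'
      exact ⟨⟨(x, k, y), h2'.symm⟩, rfl⟩

/-- The restriction of the action groupoid of a proper action is proper, being a pullback. -/
theorem isProperMap_restricted [ProperSMul K Z] :
    IsProperMap fun a => ((restrictedGroupoid K ι).s a, (restrictedGroupoid K ι).t a) := by
  have hs := (contMDiff_restricted_s hA).continuous
  have ht := (contMDiff_restricted_t hA).continuous
  have hι := h.contMDiff.continuous
  have hk := (contMDiff_restricted_k hA).continuous
  rw [isProperMap_iff_ultrafilter]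
  refine ⟨hs.prodMk ht, ?_⟩
  rintro 𝒰 ⟨x, y⟩ hxy
  rw [Prod.tendsto_iff] at hxy
  obtain ⟨hx, hy⟩ := hxy
  let j : restrictedArrows K ι → K × Z := fun a => (a.1.2.1, ι a.1.1)
  have hp := (isProperMap_iff_ultrafilter.1 (ProperSMul.isProperMap_smul_pair (G := K) (X := Z))).2
    (𝒰 := 𝒰.map j) (y := (ι y, ι x)) (by
      rw [Ultrafilter.coe_map, Filter.tendsto_map'_iff]
      refine Filter.Tendsto.prodMk_nhds ?_ ((hι.tendsto x).comp hx)
      refine ((hι.tendsto y).comp hy).congr fun a => ?_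
      exact (show a.1.2.1 • ι a.1.1 = ι a.1.2.2 from a.2).symm)
  obtain ⟨⟨k, z⟩, hkz, hlim⟩ := hp
  have h1 : k • z = ι y := congrArg Prod.fst hkz
  have h2 : z = ι x := congrArg Prod.snd hkz
  subst h2
  refine ⟨⟨(x, k, y), h1⟩, rfl, ?_⟩
  have hk' : Filter.Tendsto (fun a : restrictedArrows K ι => a.1.2.1) 𝒰 (𝓝 k) := by
    have h3 : Filter.Tendsto j 𝒰 (𝓝 (k, ι x)) := by
      rw [Filter.Tendsto, ← Ultrafilter.coe_map]
      exact hlim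
    exact (continuous_fst.tendsto _).comp h3
  rw [← Filter.tendsto_id', hA.isEmbedding.tendsto_nhds_iff]
  exact hx.prodMk_nhds (hk'.prodMk_nhds hy)

end IsCompleteTransversal

end Etale

/-! ### The cosymplectic structure of a transversal -/

section PullbackEval

variable {E : Type*} [NormedAddCommGroup E] [NormedSpace ℝ E] {H : Type*} [TopologicalSpace H]
  {E' : Type*} [NormedAddCommGroup E'] [NormedSpace ℝ E'] {H' : Type*} [TopologicalSpace H']
  {I : ModelWithCorners ℝ E H} {I' : ModelWithCorners ℝ E' H'}
  {M : Type*} [TopologicalSpace M] [ChartedSpace H M]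
  {N : Type*} [TopologicalSpace N] [ChartedSpace H' N]

theorem Form.pullback_two (f : M → N) (α : Form I' N 2) (x : M) (v w : TangentSpace I x) :
    (Form.pullback f α : Form I M 2) x ![v, w] =
      α (f x) ![mfderiv I I' f x v, mfderiv I I' f x w] := by
  rw [Form.pullback_apply]
  congr 1
  ext i; fin_cases i <;> rfl

theorem Form.pullback_one (f : M → N) (α : Form I' N 1) (x : M) (v : TangentSpace I x) :
    (Form.pullback f α : Form I M 1) x ![v] = α (f x) ![mfderiv I I' f x v] := by
  rw [Form.pullback_apply]
  congr 1
  ext i; fin_cases i; rfl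

end PullbackEval

section TransversalForms

variable {E : Type*} [NormedAddCommGroup E] [NormedSpace ℝ E] [FiniteDimensional ℝ E]
  {F : Type*} [NormedAddCommGroup F] [NormedSpace ℝ F] [FiniteDimensional ℝ F]
  {G : Type*} [NormedAddCommGroup G] [NormedSpace ℝ G] [FiniteDimensional ℝ G]
  {K : Type*} [Group K] [TopologicalSpace K] [ChartedSpace F K] [LieGroup 𝓘(ℝ, F) ∞ K]
  {Z : Type*} [TopologicalSpace Z] [ChartedSpace E Z] [IsManifold 𝓘(ℝ, E) ∞ Z]
  [MulAction K Z] [ContMDiffSMul 𝓘(ℝ, F) 𝓘(ℝ, E) ∞ K Z]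
  {X : Type*} [TopologicalSpace X] [ChartedSpace G X] [IsManifold 𝓘(ℝ, G) ∞ X]
  {ι : X → Z} {σ : Form 𝓘(ℝ, E) Z 2} {η : Form 𝓘(ℝ, E) Z 1}

namespace IsCompleteTransversal

variable (h : IsCompleteTransversal E F G K ι) (hση : IsTransverselyCosymplectic F K σ η)

include h

theorem exists_orbit_add (x : X) (w : TangentSpace 𝓘(ℝ, E) (ι x)) :
    ∃ ξ v, orbitMap F K (ι x) ξ + mfderiv 𝓘(ℝ, G) 𝓘(ℝ, E) ι x v = w := by
  obtain ⟨⟨ξ, v⟩, hv⟩ := (h.bijective x).2 w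
  exact ⟨ξ, v, hv⟩

include hση

/-- No tangent vector of the transversal lies in the kernels of both forms, as these kernels meet
in the tangent space of the orbit. -/
theorem eq_zero_of_mem_ker (x : X) (v : TangentSpace 𝓘(ℝ, G) x)
    (h1 : (Form.pullback ι η : Form 𝓘(ℝ, G) X 1) x ![v] = 0)
    (h2 : ∀ w, (Form.pullback ι σ : Form 𝓘(ℝ, G) X 2) x ![v, w] = 0) : v = 0 := by
  rw [Form.pullback_one] at h1
  have h3 : ∀ w, σ (ι x) ![mfderiv 𝓘(ℝ, G) 𝓘(ℝ, E) ι x v, w] = 0 := by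
    intro w
    obtain ⟨ξ, u, rfl⟩ := h.exists_orbit_add x w
    have h4 := hση.two_add_orbit (ι x) 0 ξ (mfderiv 𝓘(ℝ, G) 𝓘(ℝ, E) ι x v)
      (mfderiv 𝓘(ℝ, G) 𝓘(ℝ, E) ι x u)
    rw [map_zero, zero_add] at h4
    rw [h4, ← Form.pullback_two, h2]
  obtain ⟨ξ, hξ⟩ := (hση.mem_orbit_iff (ι x) _).2 ⟨h1, h3⟩
  refine (h.eq_zero_of_add_eq_zero (x := x) (ξ := -ξ) (v := v) ?_).2
  rw [map_neg, hξ, neg_add_cancel]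

/-- A Reeb vector of `Z`, corrected by an orbit direction, is tangent to the transversal. -/
theorem exists_reeb (x : X) :
    ∃ R, (Form.pullback ι η : Form 𝓘(ℝ, G) X 1) x ![R] = 1 ∧
      ∀ w, (Form.pullback ι σ : Form 𝓘(ℝ, G) X 2) x ![R, w] = 0 := by
  obtain ⟨R, hR1, hR2⟩ := hση.exists_reeb (ι x)
  obtain ⟨ξ, v, rfl⟩ := h.exists_orbit_add x R
  refine ⟨v, ?_, fun w => ?_⟩
  · rw [Form.pullback_one, ← hR1, hση.one_add_orbit]
  · rw [Form.pullback_two, ← hR2 (mfderiv 𝓘(ℝ, G) 𝓘(ℝ, E) ι x w)]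
    have := hση.two_add_orbit (ι x) ξ 0 (mfderiv 𝓘(ℝ, G) 𝓘(ℝ, E) ι x v)
      (mfderiv 𝓘(ℝ, G) 𝓘(ℝ, E) ι x w)
    rw [map_zero, zero_add] at this
    exact this.symm

theorem one_ne_zero (x : X) : (Form.pullback ι η : Form 𝓘(ℝ, G) X 1) x ≠ 0 := by
  obtain ⟨R, hR, -⟩ := h.exists_reeb hση x
  intro h0
  rw [h0] at hR
  exact zero_ne_one hR

theorem isCosymplectic : IsCosymplectic (Form.pullback ι σ : Form 𝓘(ℝ, G) X 2)
    (Form.pullback ι η : Form 𝓘(ℝ, G) X 1) where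
  smooth_two := hση.smooth_two.pullback h.contMDiff
  smooth_one := hση.smooth_one.pullback h.contMDiff
  closed_two := hση.closed_two.pullback hση.smooth_two h.contMDiff
  closed_one := hση.closed_one.pullback hση.smooth_one h.contMDiff
  one_ne_zero := h.one_ne_zero hση
  isCompl_ker x := by
    obtain ⟨R, hR1, hR2⟩ := h.exists_reeb hση x
    exact isCompl_ker_of_reeb _ _ x R hR1 hR2 (h.eq_zero_of_mem_ker hση x)

variable [ChartedSpace G (restrictedArrows K ι)]
  [IsManifold 𝓘(ℝ, G) ∞ (restrictedArrows K ι)]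
  (hA : IsRegularEmbedding 𝓘(ℝ, G) (𝓘(ℝ, G).prod (𝓘(ℝ, F).prod 𝓘(ℝ, G)))
    (Subtype.val : restrictedArrows K ι → X × K × X))

omit hση in
include hA in
/-- Basic forms restrict to basic forms, as the inclusion is a functor. -/
theorem isBasic_pullback {k : ℕ} {α : Form 𝓘(ℝ, E) Z k}
    (hα : (actionGroupoid K Z).IsBasic (𝓘(ℝ, F).prod 𝓘(ℝ, E)) α) :
    (restrictedGroupoid K ι).IsBasic 𝓘(ℝ, G) (Form.pullback ι α : Form 𝓘(ℝ, G) X k) := by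
  let j : restrictedArrows K ι → K × Z := fun a => (a.1.2.1, ι a.1.1)
  have hM := h.isMoritaMap_restricted hA
  have hj : MDifferentiable 𝓘(ℝ, G) (𝓘(ℝ, F).prod 𝓘(ℝ, E)) j :=
    hM.smooth_arr.mdifferentiable (by simp)
  have hL := isLieGroupoid_actionGroupoid E F K Z
  have hι := h.contMDiff.mdifferentiable (by simp)
  have ht := (contMDiff_restricted_t hA).mdifferentiable (by simp)
  have hs := (contMDiff_restricted_s hA).mdifferentiable (by simp)
  have et : ι ∘ (restrictedGroupoid K ι).t = (actionGroupoid K Z).t ∘ j :=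
    funext fun a => (hM.map_t a).symm
  have es : ι ∘ (restrictedGroupoid K ι).s = (actionGroupoid K Z).s ∘ j :=
    funext fun a => (hM.map_s a).symm
  unfold GroupoidData.IsBasic
  rw [← Form.pullback_comp hι ht, ← Form.pullback_comp hι hs, et, es,
    Form.pullback_comp (hL.submersion_t.contMDiff.mdifferentiable (by simp)) hj,
    Form.pullback_comp (hL.submersion_s.contMDiff.mdifferentiable (by simp)) hj, hα]

include hA in
/-- The tangent complex of an étale groupoid is concentrated in degree `0`, so that a cosymplectic
structure on the objects induces a quasi-isomorphism. -/
theorem isZeroShiftedCosymplectic_restricted :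
    (restrictedGroupoid K ι).IsZeroShiftedCosymplectic 𝓘(ℝ, G)
      (Form.pullback ι σ : Form 𝓘(ℝ, G) X 2) (Form.pullback ι η : Form 𝓘(ℝ, G) X 1) where
  smooth_two := hση.smooth_two.pullback h.contMDiff
  smooth_one := hση.smooth_one.pullback h.contMDiff
  closed_two := hση.closed_two.pullback hση.smooth_two h.contMDiff
  closed_one := hση.closed_one.pullback hση.smooth_one h.contMDiff
  basic_two := h.isBasic_pullback hA hση.isBasic_two
  basic_one := h.isBasic_pullback hA hση.isBasic_one
  one_ne_zero := h.one_ne_zero hση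
  quasiIso x := by
    have h0 : ∀ a : (restrictedGroupoid K ι).algebroid 𝓘(ℝ, G) 𝓘(ℝ, G) x, a = 0 := fun a =>
      Subtype.ext (h.injective_mfderiv_restricted_s hA ((restrictedGroupoid K ι).u x)
        ((LinearMap.mem_ker.1 a.2).trans (map_zero _).symm))
    refine isQuasiIso_flat _ _ x _ (fun a b _ => (h0 a).trans (h0 b).symm) fun v => ?_
    constructor
    · rintro ⟨a, rfl⟩
      rw [h0 a, map_zero]
      exact ⟨(Form.pullback ι η : Form 𝓘(ℝ, G) X 1) x |>.map_coord_zero (m := ![0]) 0 rfl,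
        fun w => (Form.pullback ι σ : Form 𝓘(ℝ, G) X 2) x |>.map_coord_zero (m := ![0, w]) 0 rfl⟩
    · rintro ⟨h1, h2⟩
      exact ⟨0, by rw [map_zero, h.eq_zero_of_mem_ker hση x v h1 h2]⟩

end IsCompleteTransversal

end TransversalForms

section Orbifold

universe u v w

variable {E : Type*} [NormedAddCommGroup E] [NormedSpace ℝ E] [FiniteDimensional ℝ E]
  {F : Type*} [NormedAddCommGroup F] [NormedSpace ℝ F] [FiniteDimensional ℝ F]
  {K : Type w} [Group K] [TopologicalSpace K] [ChartedSpace F K] [LieGroup 𝓘(ℝ, F) ∞ K]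
  [T2Space K] [SecondCountableTopology K]
  {Z : Type u} [TopologicalSpace Z] [ChartedSpace E Z] [IsManifold 𝓘(ℝ, E) ∞ Z]
  [MulAction K Z] [ContMDiffSMul 𝓘(ℝ, F) 𝓘(ℝ, E) ∞ K Z]
  {σ : Form 𝓘(ℝ, E) Z 2} {η : Form 𝓘(ℝ, E) Z 1}

/-- A proper action with a complete transversal presents an orbifold: the restriction of the action
groupoid to the transversal is proper, étale, and Morita equivalent to the action groupoid. -/
theorem IsCompleteTransversal.isCosymplecticOrbifold {c : ℕ} {X : Type u} [TopologicalSpace X]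
    [ChartedSpace (EuclideanSpace ℝ (Fin c)) X] [IsManifold (𝓡 c) ∞ X] [T2Space X]
    [SecondCountableTopology X] {ι : X → Z}
    (h : IsCompleteTransversal E F (EuclideanSpace ℝ (Fin c)) K ι)
    (hση : IsTransverselyCosymplectic F K σ η) (hK : ProperSMul K Z) :
    IsCosymplecticOrbifold.{u, max u w} (𝓘(ℝ, F).prod 𝓘(ℝ, E)) (actionGroupoid K Z) σ η := by
  obtain ⟨_, _, hA⟩ := h.exists_isRegularEmbedding_arrows
  have hL := h.isLieGroupoid_restricted hA
  have hι := h.contMDiff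
  -- the restricted groupoid serves as its own roof, mapping to itself by the identity
  refine ⟨⟨X, c⟩, ⟨restrictedArrows K ι, c⟩, restrictedGroupoid K ι, Form.pullback ι σ,
    Form.pullback ι η, ⟨X, c⟩, ⟨restrictedArrows K ι, c⟩, restrictedGroupoid K ι, ι,
    (fun a => (a.1.2.1, ι a.1.1)), id, id, hL, h.isLocalDiffeomorph_restricted_s hA,
    h.isProperMap_restricted hA, h.isCosymplectic hση,
    h.isZeroShiftedCosymplectic_restricted hση hA, hL, h.isMoritaMap_restricted hA,
    isMoritaMap_id hL, (Form.pullback_id _).symm, (Form.pullback_id _).symm⟩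

end Orbifold

/-! ### Complete transversals -/

section SectionLemma

variable {E : Type*} [NormedAddCommGroup E] [NormedSpace ℝ E] {H : Type*} [TopologicalSpace H]
  {E' : Type*} [NormedAddCommGroup E'] [NormedSpace ℝ E'] {H' : Type*} [TopologicalSpace H']
  {I : ModelWithCorners ℝ E H} {I' : ModelWithCorners ℝ E' H'}
  {M : Type*} [TopologicalSpace M] [ChartedSpace H M]
  {N : Type*} [TopologicalSpace N] [ChartedSpace H' N]

/-- A map with a local section through `x` is submersive at `x`. -/
theorem surjective_mfderiv_of_section {f : M → N} {g : N → M} {x : M}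
    (hf : MDifferentiableAt I I' f x) (hg : MDifferentiableAt I' I g (f x)) (hgx : g (f x) = x)
    (h : f ∘ g =ᶠ[𝓝 (f x)] id) : Function.Surjective (mfderiv I I' f x) := by
  intro w
  refine ⟨derivTo I' I g (f x) x w, ?_⟩
  refine (derivTo_comp (f := g) (g := f) (z := f x) hgx hf hg w).symm.trans ?_
  rw [derivTo_congr h, derivTo_id]

end SectionLemma

section Slices

variable {E : Type*} [NormedAddCommGroup E] [NormedSpace ℝ E] [FiniteDimensional ℝ E]
  {F : Type*} [NormedAddCommGroup F] [NormedSpace ℝ F] [FiniteDimensional ℝ F]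
  {G : Type*} [NormedAddCommGroup G] [NormedSpace ℝ G] [FiniteDimensional ℝ G]
  {K : Type*} [Group K] [TopologicalSpace K] [ChartedSpace F K] [LieGroup 𝓘(ℝ, F) ∞ K]
  {Z : Type*} [TopologicalSpace Z] [ChartedSpace E Z] [IsManifold 𝓘(ℝ, E) ∞ Z]
  [MulAction K Z] [ContMDiffSMul 𝓘(ℝ, F) 𝓘(ℝ, E) ∞ K Z]

/-- A slice: a smooth map `s` on an open set `D` such that `(k, u) ↦ k • s u` is, on the product of
a neighbourhood `W` of `1` with `D`, the diffeomorphism `Ψ` onto an open set. -/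
structure IsSlice (Ψ : PartialDiffeomorph (𝓘(ℝ, F).prod 𝓘(ℝ, G)) 𝓘(ℝ, E) (K × G) Z ∞)
    (s : G → Z) (W : Set K) (D : Set G) : Prop where
  isOpen_left : IsOpen W
  isOpen_right : IsOpen D
  one_mem : (1 : K) ∈ W
  source_eq : Ψ.source = W ×ˢ D
  contMDiffOn : ContMDiffOn 𝓘(ℝ, G) 𝓘(ℝ, E) ∞ s D
  apply_eq : ∀ k ∈ W, ∀ u ∈ D, Ψ (k, u) = k • s u

namespace IsSlice

variable {Ψ : PartialDiffeomorph (𝓘(ℝ, F).prod 𝓘(ℝ, G)) 𝓘(ℝ, E) (K × G) Z ∞}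
    {s : G → Z} {W : Set K} {D : Set G} (h : IsSlice Ψ s W D)

include h

theorem apply_one {u : G} (hu : u ∈ D) : Ψ (1, u) = s u := by
  rw [h.apply_eq 1 h.one_mem u hu, one_smul]

theorem mk_mem_source {k : K} {u : G} (hk : k ∈ W) (hu : u ∈ D) : (k, u) ∈ Ψ.source := by
  rw [h.source_eq]
  exact ⟨hk, hu⟩

theorem smul_mem_target {k : K} {u : G} (hk : k ∈ W) (hu : u ∈ D) : k • s u ∈ Ψ.target := by
  rw [← h.apply_eq k hk u hu]
  exact Ψ.map_source (h.mk_mem_source hk hu)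

theorem mem_target {u : G} (hu : u ∈ D) : s u ∈ Ψ.target := by
  have := h.smul_mem_target h.one_mem hu
  rwa [one_smul] at this

theorem symm_smul {k : K} {u : G} (hk : k ∈ W) (hu : u ∈ D) : Ψ.symm (k • s u) = (k, u) := by
  rw [← h.apply_eq k hk u hu]
  exact Ψ.left_inv (h.mk_mem_source hk hu)

theorem symm_apply {u : G} (hu : u ∈ D) : Ψ.symm (s u) = (1, u) := by
  have := h.symm_smul h.one_mem hu
  rwa [one_smul] at this

theorem symm_mem {z : Z} (hz : z ∈ Ψ.target) : (Ψ.symm z).1 ∈ W ∧ (Ψ.symm z).2 ∈ D := by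
  have : Ψ.symm z ∈ Ψ.source := Ψ.map_target hz
  rw [h.source_eq] at this
  exact this

theorem smul_symm {z : Z} (hz : z ∈ Ψ.target) : (Ψ.symm z).1 • s (Ψ.symm z).2 = z := by
  rw [← h.apply_eq _ (h.symm_mem hz).1 _ (h.symm_mem hz).2]
  exact Ψ.right_inv hz

theorem contMDiffOn_fst : ContMDiffOn 𝓘(ℝ, E) 𝓘(ℝ, F) ∞ (fun z => (Ψ.symm z).1) Ψ.target :=
  contMDiff_fst.comp_contMDiffOn Ψ.symm.contMDiffOn

theorem contMDiffOn_snd : ContMDiffOn 𝓘(ℝ, E) 𝓘(ℝ, G) ∞ (fun z => (Ψ.symm z).2) Ψ.target :=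
  contMDiff_snd.comp_contMDiffOn Ψ.symm.contMDiffOn

theorem contMDiffAt {u : G} (hu : u ∈ D) : ContMDiffAt 𝓘(ℝ, G) 𝓘(ℝ, E) ∞ s u :=
  h.contMDiffOn.contMDiffAt (h.isOpen_right.mem_nhds hu)

/-- The tangent spaces of the slice and of the orbits span the tangent space. -/
theorem exists_orbit_add {u : G} (hu : u ∈ D) (w : TangentSpace 𝓘(ℝ, E) (s u)) :
    ∃ ξ v, orbitMap F K (s u) ξ + mfderiv 𝓘(ℝ, G) 𝓘(ℝ, E) s u v = w := by
  have hev : Ψ =ᶠ[𝓝 ((1 : K), u)] fun p => p.1 • s p.2 := by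
    filter_upwards [Ψ.open_source.mem_nhds (h.mk_mem_source h.one_mem hu)] with p hp
    rw [h.source_eq] at hp
    exact h.apply_eq p.1 hp.1 p.2 hp.2
  have hb := bijective_mfderiv_of_isLocalDiffeomorphAt
    (Ψ.isLocalDiffeomorphAt _ _ _ (h.mk_mem_source h.one_mem hu))
  obtain ⟨p, hp⟩ := hb.2 w
  have h1 := derivTo_smul_comp (F := F) ((h.contMDiffAt hu).mdifferentiableAt (by simp)) (1 : K) p
  have h2 : mfderiv (𝓘(ℝ, F).prod 𝓘(ℝ, G)) 𝓘(ℝ, E) (fun p : K × G => p.1 • s p.2) (1, u) p = w :=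
    (DFunLike.congr_fun hev.mfderiv_eq p).symm.trans hp
  exact ⟨_, _, (translate_one _ _).symm.trans (h1.symm.trans h2)⟩

end IsSlice

theorem exists_isSlice (z : Z) (hz : Function.Injective (orbitMap (E := E) F K z))
    (hd : Module.finrank ℝ E = Module.finrank ℝ F + Module.finrank ℝ G)
    {W₀ : Set K} (hW₀ : W₀ ∈ 𝓝 (1 : K)) :
    ∃ (Ψ : PartialDiffeomorph (𝓘(ℝ, F).prod 𝓘(ℝ, G)) 𝓘(ℝ, E) (K × G) Z ∞) (s : G → Z)
      (W : Set K) (D : Set G), IsSlice Ψ s W D ∧ W ⊆ W₀ ∧ (0 : G) ∈ D ∧ s 0 = z := by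
  obtain ⟨Ψ, s, W, D, hW, hD, hsub, h1, h0, hs, hsm, hs0, he⟩ := exists_slice z hz hd hW₀
  exact ⟨Ψ, s, W, D, ⟨hW, hD, h1, hs, hsm, he⟩, hsub, h0, hs0⟩

/-- The disjoint union of countably many slices, realized as a submanifold of `ℝ × Z`. -/
def sliceUnion (s : ℕ → G → Z) (D : ℕ → Set G) : Set (ℝ × Z) :=
  {p | ∃ i : ℕ, p.1 = (i : ℝ) ∧ ∃ u ∈ D i, s i u = p.2}

variable {Ψ : ℕ → PartialDiffeomorph (𝓘(ℝ, F).prod 𝓘(ℝ, G)) 𝓘(ℝ, E) (K × G) Z ∞}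
  {s : ℕ → G → Z} {W : ℕ → Set K} {D : ℕ → Set G}

/-- The union of the slices `{i} × s i (D i)` is a submanifold of `ℝ × Z`. Near the `i`-th slice it is
the zero set of `(r, k • s i u) ↦ (r - i, φ k - φ 1)`, for a chart `φ` of `K` at `1`; hence each `W i`
is taken in the domain of that chart. -/
theorem exists_isRegularEmbedding_sliceUnion (h : ∀ i, IsSlice (Ψ i) (s i) (W i) (D i))
    (hW : ∀ i, W i ⊆ (chartAt F (1 : K)).source)
    (hd : Module.finrank ℝ E = Module.finrank ℝ F + Module.finrank ℝ G) :
    ∃ (_ : ChartedSpace G (sliceUnion s D)) (_ : IsManifold 𝓘(ℝ, G) ∞ (sliceUnion s D)),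
      IsRegularEmbedding 𝓘(ℝ, G) (𝓘(ℝ, ℝ).prod 𝓘(ℝ, E))
        (Subtype.val : sliceUnion s D → ℝ × Z) := by
  refine exists_isRegularEmbedding_of_regular (V := ℝ × F) ?_ _ ?_
  · simp only [Module.finrank_prod]
    omega
  rintro ⟨r, z⟩ ⟨i, hr, u, hu, hz⟩
  have hr' : r = (i : ℝ) := hr
  have hz' : s i u = z := hz
  subst hr' hz'
  let φ := extChartDiffeo 𝓘(ℝ, F) (1 : K)
  have hφ1 : (1 : K) ∈ φ.source := mem_extChartAt_source _
  have hφs : ∀ k ∈ W i, k ∈ φ.source := fun k hk => by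
    have h1 := hW i hk
    rw [← extChartAt_source 𝓘(ℝ, F)] at h1
    exact h1
  let U : Set (ℝ × Z) := Metric.ball (i : ℝ) (1 / 2) ×ˢ (Ψ i).target
  have hU : IsOpen U := Metric.isOpen_ball.prod (Ψ i).open_target
  have hxU : ((i : ℝ), s i u) ∈ U := ⟨Metric.mem_ball_self (by norm_num), (h i).mem_target hu⟩
  let f : ℝ × Z → ℝ × F := fun p => (p.1 - i, φ ((Ψ i).symm p.2).1 - φ 1)
  have hf : ContMDiffOn (𝓘(ℝ, ℝ).prod 𝓘(ℝ, E)) 𝓘(ℝ, ℝ × F) ∞ f U := by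
    refine ContMDiffOn.prodMk_space ?_ ?_
    · exact (contMDiff_fst.sub contMDiff_const).contMDiffOn
    · refine ContMDiffOn.sub (φ.contMDiffOn.comp ((h i).contMDiffOn_fst.comp
        contMDiff_snd.contMDiffOn fun p hp => hp.2) fun p hp => ?_) contMDiffOn_const
      exact hφs _ ((h i).symm_mem hp.2).1
  have hfx : f ((i : ℝ), s i u) = 0 := by
    simp only [f, (h i).symm_apply hu, sub_self, Prod.mk_zero_zero]
  refine ⟨f, U, hU, hxU, hf, ?_, ?_⟩
  · -- the local section of `f` which keeps the coordinate in the slice fixed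
    let g : ℝ × F → ℝ × Z := fun q => (q.1 + i, Ψ i (φ.symm (q.2 + φ 1), u))
    have hc : ContMDiff 𝓘(ℝ, ℝ × F) 𝓘(ℝ, F) ∞ fun q : ℝ × F => q.2 + φ 1 :=
      (contDiff_snd.add contDiff_const).contMDiff
    have hc0 : (0 : ℝ × F).2 + φ 1 = φ 1 := by simp
    have hsymm : ContMDiffAt 𝓘(ℝ, ℝ × F) 𝓘(ℝ, F) ∞ (fun q : ℝ × F => φ.symm (q.2 + φ 1)) 0 := by
      refine ContMDiffAt.comp (g := φ.symm) _ ?_ hc.contMDiffAt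
      rw [hc0]
      exact φ.symm.contMDiffOn.contMDiffAt (φ.open_target.mem_nhds (φ.map_source hφ1))
    have hsymm0 : φ.symm ((0 : ℝ × F).2 + φ 1) = 1 := by
      rw [Prod.snd_zero, zero_add]
      exact φ.left_inv hφ1
    have hg : ContMDiffAt 𝓘(ℝ, ℝ × F) (𝓘(ℝ, ℝ).prod 𝓘(ℝ, E)) ∞ g 0 := by
      refine ContMDiffAt.prodMk (contDiff_fst.add contDiff_const).contMDiff.contMDiffAt ?_
      refine ContMDiffAt.comp (g := Ψ i) (f := fun q : ℝ × F => (φ.symm (q.2 + φ 1), u)) _ ?_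
        (hsymm.prodMk (I' := 𝓘(ℝ, F)) (J' := 𝓘(ℝ, G)) (contMDiffAt_const (c := u)))
      rw [hsymm0]
      exact (Ψ i).contMDiffOn.contMDiffAt
        ((Ψ i).open_source.mem_nhds ((h i).mk_mem_source (h i).one_mem hu))
    have hg0 : g 0 = ((i : ℝ), s i u) := by
      simp only [g, hsymm0, (h i).apply_one hu, Prod.fst_zero, zero_add]
    refine surjective_mfderiv_of_section (g := g)
      ((hf.contMDiffAt (hU.mem_nhds hxU)).mdifferentiableAt (by simp)) ?_ ?_ ?_
    · rw [hfx]
      exact hg.mdifferentiableAt (by simp)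
    · rw [hfx, hg0]
    · rw [hfx]
      have h1 : ∀ᶠ q : ℝ × F in 𝓝 0, q.2 + φ 1 ∈ φ.target := by
        refine hc.continuous.continuousAt.eventually_mem ?_
        rw [hc0]
        exact φ.open_target.mem_nhds (φ.map_source hφ1)
      have h2 : ∀ᶠ q : ℝ × F in 𝓝 0, φ.symm (q.2 + φ 1) ∈ W i := by
        refine hsymm.continuousAt.eventually_mem ?_
        rw [hsymm0]
        exact (h i).isOpen_left.mem_nhds (h i).one_mem
      filter_upwards [h1, h2] with q hq1 hq2
      have h3 : (Ψ i).symm (Ψ i (φ.symm (q.2 + φ 1), u)) = (φ.symm (q.2 + φ 1), u) :=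
        (Ψ i).left_inv ((h i).mk_mem_source hq2 hu)
      have h4 : φ (φ.symm (q.2 + φ 1)) = q.2 + φ 1 := φ.right_inv hq1
      simp only [f, g, Function.comp_apply, h3, h4, add_sub_cancel_right, Prod.mk.eta, id]
  · rintro ⟨r, z⟩ ⟨hr, hz⟩
    have hr' : |r - i| < 1 / 2 := hr
    constructor
    · rintro ⟨j, hj, v, hv, hvz⟩
      have hj' : r = j := hj
      have hvz' : s j v = z := hvz
      subst hvz' hj'
      -- distinct slices lie at distance at least 1 from each other
      have hji : j = i := by
        have h1 : |((j : ℤ) - (i : ℤ) : ℤ)| < 1 := by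
          have : |(((j : ℤ) - (i : ℤ) : ℤ) : ℝ)| < 1 := by
            push_cast
            linarith
          exact_mod_cast this
        have := Int.abs_lt_one_iff.1 h1
        omega
      subst hji
      simp only [f, (h j).symm_apply hv, sub_self, Prod.mk_zero_zero]
    · intro hfz
      have h1 : r - i = 0 := congrArg Prod.fst hfz
      have h2 : φ ((Ψ i).symm z).1 - φ 1 = 0 := congrArg Prod.snd hfz
      have h3 : ((Ψ i).symm z).1 = 1 :=
        φ.injOn (hφs _ ((h i).symm_mem hz).1) hφ1 (sub_eq_zero.1 h2)
      refine ⟨i, sub_eq_zero.1 h1, ((Ψ i).symm z).2, ((h i).symm_mem hz).2, ?_⟩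
      have h4 := (h i).smul_symm hz
      rwa [h3, one_smul] at h4

/-- The projection of the union of the slices to `Z` is transverse to the orbits, as each slice is, and
meets all orbits if the saturated neighbourhoods of the slices cover `Z`. -/
theorem isCompleteTransversal_sliceUnion (h : ∀ i, IsSlice (Ψ i) (s i) (W i) (D i))
    (hd : Module.finrank ℝ E = Module.finrank ℝ F + Module.finrank ℝ G)
    (hcover : ∀ z, ∃ i, z ∈ (Ψ i).target)
    [ChartedSpace G (sliceUnion s D)] [IsManifold 𝓘(ℝ, G) ∞ (sliceUnion s D)]
    (hX : IsRegularEmbedding 𝓘(ℝ, G) (𝓘(ℝ, ℝ).prod 𝓘(ℝ, E))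
        (Subtype.val : sliceUnion s D → ℝ × Z)) :
    IsCompleteTransversal E F G K (fun x : sliceUnion s D => x.1.2) where
  contMDiff := contMDiff_snd.comp hX.contMDiff
  bijective := by
    rintro ⟨⟨r, z⟩, hx⟩
    obtain ⟨i, hr, u, hu, hz⟩ := id hx
    have hr' : r = (i : ℝ) := hr
    have hz' : s i u = z := hz
    subst hr' hz'
    classical
    -- the parametrization of the `i`-th slice, extended by a constant outside `D i`
    let j : G → sliceUnion s D := fun v => if hv : v ∈ D i then ⟨((i : ℝ), s i v), i, rfl, v, hv, rfl⟩
      else ⟨((i : ℝ), s i u), hx⟩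
    have hjD : ∀ v ∈ D i, (j v).1 = ((i : ℝ), s i v) := fun v hv => by simp only [j, dif_pos hv]
    have hju : j u = ⟨((i : ℝ), s i u), hx⟩ := Subtype.ext (hjD u hu)
    have hnhds := (h i).isOpen_right.mem_nhds hu
    have hj : ContMDiffAt 𝓘(ℝ, G) 𝓘(ℝ, G) ∞ j u := by
      refine hX.contMDiffAt ?_
      refine ((contMDiffAt_const (c := (i : ℝ))).prodMk
        ((h i).contMDiffAt hu)).congr_of_eventuallyEq ?_
      filter_upwards [hnhds] with v hv using hjD v hv
    have hι : MDifferentiable 𝓘(ℝ, G) 𝓘(ℝ, E) (fun x : sliceUnion s D => x.1.2) :=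
      (contMDiff_snd.comp hX.contMDiff).mdifferentiable (by simp)
    have hsurj : Function.Surjective ((orbitMap (E := E) F K (s i u)).coprod
        (mfderiv 𝓘(ℝ, G) 𝓘(ℝ, E) (fun x : sliceUnion s D => x.1.2)
          ⟨((i : ℝ), s i u), hx⟩)) := by
      intro w
      obtain ⟨ξ, v, hv⟩ := (h i).exists_orbit_add hu w
      refine ⟨(ξ, derivTo 𝓘(ℝ, G) 𝓘(ℝ, G) j u ⟨((i : ℝ), s i u), hx⟩ v), Eq.trans ?_ hv⟩
      refine congrArg (orbitMap F K (s i u) ξ + ·) ?_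
      have hev : (fun x : sliceUnion s D => x.1.2) ∘ j =ᶠ[𝓝 u] s i := by
        filter_upwards [hnhds] with v hv
        rw [Function.comp_apply, hjD v hv]
      have h1 := derivTo_comp (f := j) (g := fun x : sliceUnion s D => x.1.2) (z := s i u) hju
        (hι _) (hj.mdifferentiableAt (by simp)) v
      rw [derivTo_congr hev] at h1
      exact h1.symm
    refine ⟨(LinearMap.injective_iff_surjective_of_finrank_eq_finrank
      (f := ((orbitMap (E := E) F K (s i u)).coprod
        (mfderiv 𝓘(ℝ, G) 𝓘(ℝ, E) (fun x : sliceUnion s D => x.1.2)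
          ⟨((i : ℝ), s i u), hx⟩)).toLinearMap) ?_).2 hsurj, hsurj⟩
    rw [Module.finrank_prod]
    exact hd.symm
  exists_smul z := by
    obtain ⟨i, hi⟩ := hcover z
    exact ⟨((Ψ i).symm z).1, ⟨((i : ℝ), s i ((Ψ i).symm z).2), i, rfl, _, ((h i).symm_mem hi).2,
      rfl⟩, (h i).smul_symm hi⟩

end Slices

section Existence

universe u

variable (E : Type*) [NormedAddCommGroup E] [NormedSpace ℝ E] [FiniteDimensional ℝ E]
  (F : Type*) [NormedAddCommGroup F] [NormedSpace ℝ F] [FiniteDimensional ℝ F]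
  (K : Type*) [Group K] [TopologicalSpace K] [ChartedSpace F K] [LieGroup 𝓘(ℝ, F) ∞ K]
  (Z : Type u) [TopologicalSpace Z] [ChartedSpace E Z] [IsManifold 𝓘(ℝ, E) ∞ Z]
  [MulAction K Z] [ContMDiffSMul 𝓘(ℝ, F) 𝓘(ℝ, E) ∞ K Z]

/-- A locally free action has a complete transversal: the disjoint union of countably many
slices. -/
theorem exists_isCompleteTransversal [T2Space Z] [SecondCountableTopology Z]
    (hinj : ∀ z : Z, Function.Injective (orbitMap (E := E) F K z)) :
    ∃ (c : ℕ) (X : Type u) (_ : TopologicalSpace X) (_ : ChartedSpace (EuclideanSpace ℝ (Fin c)) X)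
      (_ : IsManifold (𝓡 c) ∞ X) (_ : T2Space X) (_ : SecondCountableTopology X) (ι : X → Z),
      IsCompleteTransversal E F (EuclideanSpace ℝ (Fin c)) K ι := by
  by_cases hZ : Nonempty Z
  swap
  · -- for empty `Z`, whose model spaces may have any dimensions, take the empty transversal
    have hempty : IsEmpty (∅ : Set Z) := inferInstance
    let _ := ChartedSpace.empty (EuclideanSpace ℝ (Fin 0)) (∅ : Set Z)
    refine ⟨0, (∅ : Set Z), inferInstance, inferInstance, ?_, inferInstance, inferInstance,
      Subtype.val, fun x => x.2.elim, fun x => x.2.elim, fun z => (hZ ⟨z⟩).elim⟩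
    exact { compatible := fun {e e'} he _ => by cases he }
  obtain ⟨z₀⟩ := hZ
  obtain ⟨c, hc⟩ := Nat.exists_eq_add_of_le
    (LinearMap.finrank_le_finrank_of_injective (f := (orbitMap (E := E) F K z₀).toLinearMap)
      (hinj z₀))
  have hd : Module.finrank ℝ E =
      Module.finrank ℝ F + Module.finrank ℝ (EuclideanSpace ℝ (Fin c)) := by
    rw [finrank_euclideanSpace_fin]
    exact hc
  have hslice := fun z : Z => exists_isSlice (G := EuclideanSpace ℝ (Fin c)) z (hinj z) hd
    (chart_source_mem_nhds F (1 : K))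
  choose Ψ s W D h hW h0 hs0 using hslice
  obtain ⟨T, hTc, hT⟩ := TopologicalSpace.countable_cover_nhds (f := fun z => (Ψ z).target)
    fun z => (Ψ z).open_target.mem_nhds (by
      have := (h z).mem_target (h0 z)
      rwa [hs0] at this)
  have hne : T.Nonempty := by
    have : z₀ ∈ ⋃ z ∈ T, (Ψ z).target := hT ▸ mem_univ _
    obtain ⟨z, hz, -⟩ := mem_iUnion₂.1 this
    exact ⟨z, hz⟩
  obtain ⟨e, rfl⟩ := hTc.exists_eq_range hne
  have hcover : ∀ z, ∃ i, z ∈ (Ψ (e i)).target := by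
    intro z
    have : z ∈ ⋃ z ∈ range e, (Ψ z).target := hT ▸ mem_univ _
    obtain ⟨_, ⟨i, rfl⟩, hz⟩ := mem_iUnion₂.1 this
    exact ⟨i, hz⟩
  obtain ⟨_, _, hX⟩ := exists_isRegularEmbedding_sliceUnion (fun i => h (e i)) (fun i => hW (e i)) hd
  exact ⟨c, _, inferInstance, _, ‹_›, inferInstance, inferInstance, _,
    isCompleteTransversal_sliceUnion (fun i => h (e i)) hd hcover hX⟩

end Existence

/-! ### Orbit spaces of free proper actions -/

section Quotient

variable {E : Type*} [NormedAddCommGroup E] [NormedSpace ℝ E] [FiniteDimensional ℝ E]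
  {F : Type*} [NormedAddCommGroup F] [NormedSpace ℝ F] [FiniteDimensional ℝ F]
  {G : Type*} [NormedAddCommGroup G] [NormedSpace ℝ G] [FiniteDimensional ℝ G]
  {K : Type*} [Group K] [TopologicalSpace K] [ChartedSpace F K] [LieGroup 𝓘(ℝ, F) ∞ K]
  {Z : Type*} [TopologicalSpace Z] [ChartedSpace E Z] [IsManifold 𝓘(ℝ, E) ∞ Z]
  [MulAction K Z] [ContMDiffSMul 𝓘(ℝ, F) 𝓘(ℝ, E) ∞ K Z]

variable (K Z) in
/-- The projection onto the orbit space. -/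
abbrev orbitProj : Z → MulAction.orbitRel.Quotient K Z := Quotient.mk _

theorem orbitProj_smul (k : K) (z : Z) : orbitProj K Z (k • z) = orbitProj K Z z :=
  Quotient.sound ⟨k, rfl⟩

theorem exists_smul_of_orbitProj_eq {y z : Z} (h : orbitProj K Z y = orbitProj K Z z) :
    ∃ k : K, k • z = y := Quotient.exact h

include E F in
variable (E F K Z) in
theorem isOpenMap_orbitProj : IsOpenMap (orbitProj K Z) := by
  have : ContinuousConstSMul K Z := ⟨fun k =>
    (ContMDiffSMul.contMDiff_const_smul (I := 𝓘(ℝ, F)) (I' := 𝓘(ℝ, E)) (n := ∞) k).continuous⟩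
  exact isOpenMap_quotient_mk'_mul

theorem continuous_orbitProj : Continuous (orbitProj K Z) := continuous_quotient_mk'

/-- Near a point with trivial stabilizer, a proper action moves points to nearby points only by
elements near `1`. -/
theorem exists_nhds_smul_mem [ProperSMul K Z] {z : Z} (hz : ∀ k : K, k • z = z → k = 1) {W : Set K}
    (hW : IsOpen W) (h1 : (1 : K) ∈ W) :
    ∃ N : Set Z, IsOpen N ∧ z ∈ N ∧ ∀ (k : K), ∀ y ∈ N, k • y ∈ N → k ∈ W := by
  have hc : IsClosed ((fun p : K × Z => (p.1 • p.2, p.2)) '' (Wᶜ ×ˢ univ)) :=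
    (ProperSMul.isProperMap_smul_pair (G := K) (X := Z)).isClosedMap _
      (hW.isClosed_compl.prod isClosed_univ)
  have hmem : (z, z) ∈ ((fun p : K × Z => (p.1 • p.2, p.2)) '' (Wᶜ ×ˢ univ))ᶜ := by
    rintro ⟨⟨k, y⟩, ⟨hk, -⟩, hky⟩
    have e1 : k • y = z := congrArg Prod.fst hky
    have e2 : y = z := congrArg Prod.snd hky
    subst e2
    rw [hz k e1] at hk
    exact hk h1
  obtain ⟨N₁, N₂, hN₁, hz₁, hN₂, hz₂, hsub⟩ := mem_nhds_prod_iff'.1 (hc.isOpen_compl.mem_nhds hmem)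
  refine ⟨N₁ ∩ N₂, hN₁.inter hN₂, ⟨hz₁, hz₂⟩, fun k y hy hky => ?_⟩
  by_contra hk
  exact hsub (show (k • y, y) ∈ N₁ ×ˢ N₂ from ⟨hky.1, hy.2⟩) ⟨(k, y), ⟨hk, mem_univ _⟩, rfl⟩

/-- A slice may be shrunk. -/
theorem IsSlice.restrict {Ψ : PartialDiffeomorph (𝓘(ℝ, F).prod 𝓘(ℝ, G)) 𝓘(ℝ, E) (K × G) Z ∞}
    {s : G → Z} {W : Set K} {D : Set G} (h : IsSlice Ψ s W D) {D' : Set G} (hD' : IsOpen D')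
    (hsub : D' ⊆ D) :
    IsSlice (restrDiffeo Ψ (W ×ˢ D') (h.isOpen_left.prod hD')) s W D' where
  isOpen_left := h.isOpen_left
  isOpen_right := hD'
  one_mem := h.one_mem
  source_eq := by
    rw [restrDiffeo_source, h.source_eq]
    exact inter_eq_right.2 (prod_mono_right hsub)
  contMDiffOn := h.contMDiffOn.mono hsub
  apply_eq k hk u hu := h.apply_eq k hk u (hsub hu)

/-- For a free proper action, sufficiently small slices meet each orbit at most once. -/
theorem exists_isSlice_injOn [ProperSMul K Z] (z : Z)
    (hinj : Function.Injective (orbitMap (E := E) F K z)) (hz : ∀ k : K, k • z = z → k = 1)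
    (hd : Module.finrank ℝ E = Module.finrank ℝ F + Module.finrank ℝ G) :
    ∃ (Ψ : PartialDiffeomorph (𝓘(ℝ, F).prod 𝓘(ℝ, G)) 𝓘(ℝ, E) (K × G) Z ∞) (s : G → Z)
      (W : Set K) (D : Set G), IsSlice Ψ s W D ∧ (0 : G) ∈ D ∧ s 0 = z ∧
      InjOn (fun u => orbitProj K Z (s u)) D := by
  obtain ⟨Ψ, s, W, D, h, -, h0, rfl⟩ := exists_isSlice (G := G) z hinj hd Filter.univ_mem
  obtain ⟨N, hN, hzN, hNW⟩ := exists_nhds_smul_mem hz h.isOpen_left h.one_mem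
  have hD' : IsOpen (D ∩ s ⁻¹' N) := h.contMDiffOn.continuousOn.isOpen_inter_preimage
    h.isOpen_right hN
  refine ⟨_, s, W, _, h.restrict hD' inter_subset_left, ⟨h0, hzN⟩, rfl, fun u hu v hv huv => ?_⟩
  obtain ⟨k, hk⟩ := exists_smul_of_orbitProj_eq huv
  have hkW : k ∈ W := hNW k (s v) hv.2 (by rw [hk]; exact hu.2)
  have e1 := h.symm_smul hkW hv.1
  rw [hk, h.symm_apply hu.1] at e1
  exact congrArg Prod.snd e1

/-- A chart `c` of the orbit space coming from a smooth local section `s` of the projection. -/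
structure IsQuotientChart (c : OpenPartialHomeomorph (MulAction.orbitRel.Quotient K Z) G)
    (s : G → Z) : Prop where
  contMDiffOn_section : ContMDiffOn 𝓘(ℝ, G) 𝓘(ℝ, E) ∞ s c.target
  symm_apply : ∀ u ∈ c.target, c.symm u = orbitProj K Z (s u)
  contMDiffOn_comp : ContMDiffOn 𝓘(ℝ, E) 𝓘(ℝ, G) ∞ (c ∘ orbitProj K Z) (orbitProj K Z ⁻¹' c.source)

/-- A slice which meets each orbit at most once gives a chart of the orbit space. -/
theorem exists_isQuotientChart [ProperSMul K Z] (z : Z)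
    (hinj : Function.Injective (orbitMap (E := E) F K z)) (hz : ∀ k : K, k • z = z → k = 1)
    (hd : Module.finrank ℝ E = Module.finrank ℝ F + Module.finrank ℝ G) :
    ∃ (c : OpenPartialHomeomorph (MulAction.orbitRel.Quotient K Z) G) (s : G → Z),
      IsQuotientChart (E := E) c s ∧ orbitProj K Z z ∈ c.source := by
  obtain ⟨Ψ, s, W, D, h, h0, rfl, hsD⟩ := exists_isSlice_injOn (G := G) z hinj hz hd
  let e : PartialEquiv G (MulAction.orbitRel.Quotient K Z) := hsD.toPartialEquiv _ _
  have hes : e.source = D := rfl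
  have hcont : ContinuousOn e e.source :=
    continuous_orbitProj.comp_continuousOn h.contMDiffOn.continuousOn
  have hopen : IsOpenMap (e.source.domRestrict e) := by
    -- the image of `V ⊆ D` is also the image of the open subset `W • s(V)` of `Z`
    intro V hV
    obtain ⟨V', hV', rfl⟩ := isOpen_induced_iff.1 hV
    have e1 : e.source.domRestrict e '' (Subtype.val ⁻¹' V') =
        orbitProj K Z '' (Ψ.target ∩ (fun z => (Ψ.symm z).2) ⁻¹' V') := by
      ext q
      constructor
      · rintro ⟨⟨u, hu⟩, huV, rfl⟩
        refine ⟨s u, ⟨h.mem_target hu, ?_⟩, rfl⟩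
        rw [mem_preimage, h.symm_apply hu]
        exact huV
      · rintro ⟨y, ⟨hy, hyV⟩, rfl⟩
        refine ⟨⟨(Ψ.symm y).2, (h.symm_mem hy).2⟩, hyV, ?_⟩
        change orbitProj K Z (s (Ψ.symm y).2) = orbitProj K Z y
        conv_rhs => rw [← h.smul_symm hy]
        rw [orbitProj_smul]
    rw [e1]
    exact isOpenMap_orbitProj E F K Z _
      (h.contMDiffOn_snd.continuousOn.isOpen_inter_preimage Ψ.open_target hV')
  let c := (OpenPartialHomeomorph.ofContinuousOpenRestrict e hcont hopen h.isOpen_right).symm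
  have hct : c.target = D := rfl
  have hsymm : ∀ u, c.symm u = orbitProj K Z (s u) := fun u => rfl
  have hcs : ∀ u ∈ D, orbitProj K Z (s u) ∈ c.source ∧ c (orbitProj K Z (s u)) = u := fun u hu =>
    ⟨c.map_target hu, c.right_inv hu⟩
  have hcΨ : ∀ y ∈ Ψ.target, c (orbitProj K Z y) = (Ψ.symm y).2 := by
    intro y hy
    conv_lhs => rw [← h.smul_symm hy]
    rw [orbitProj_smul]
    exact (hcs _ (h.symm_mem hy).2).2
  refine ⟨c, s, ⟨h.contMDiffOn, fun u _ => hsymm u, fun y hy => ?_⟩, (hcs 0 h0).1⟩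
  -- move `y` into the slice
  have hu : c (orbitProj K Z y) ∈ D := c.map_source hy
  have hy' : orbitProj K Z (s (c (orbitProj K Z y))) = orbitProj K Z y := c.left_inv hy
  obtain ⟨k, hk⟩ := exists_smul_of_orbitProj_eq hy'
  have hkt : k • y ∈ Ψ.target := by rw [hk]; exact h.mem_target hu
  have hks := ContMDiffSMul.contMDiff_const_smul (I := 𝓘(ℝ, F)) (I' := 𝓘(ℝ, E)) (n := ∞) (M := Z) k
  have h1 : ContMDiffAt 𝓘(ℝ, E) 𝓘(ℝ, G) ∞ ((fun z => (Ψ.symm z).2) ∘ fun z => k • z) y :=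
    ContMDiffAt.comp y (h.contMDiffOn_snd.contMDiffAt (Ψ.open_target.mem_nhds hkt)) (hks y)
  refine (h1.congr_of_eventuallyEq ?_).contMDiffWithinAt
  filter_upwards [hks.continuous.continuousAt.eventually_mem (Ψ.open_target.mem_nhds hkt)] with x hx
  rw [Function.comp_apply, Function.comp_apply, ← hcΨ _ hx, orbitProj_smul]

/-- Two smooth maps with the same projection to the orbit space differ by a smooth map to the
group. -/
theorem exists_contMDiffAt_smul_eq [ProperSMul K Z]
    {E' : Type*} [NormedAddCommGroup E'] [NormedSpace ℝ E'] {H' : Type*} [TopologicalSpace H']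
    {I' : ModelWithCorners ℝ E' H'} {N : Type*} [TopologicalSpace N] [ChartedSpace H' N]
    {f g : N → Z} {y : N} (hf : ContMDiffAt I' 𝓘(ℝ, E) ∞ f y) (hg : ContMDiffAt I' 𝓘(ℝ, E) ∞ g y)
    (hfg : ∀ᶠ x in 𝓝 y, orbitProj K Z (f x) = orbitProj K Z (g x))
    (hinj : Function.Injective (orbitMap (E := E) F K (f y)))
    (hfree : ∀ k : K, k • f y = f y → k = 1) :
    ∃ κ : N → K, ContMDiffAt I' 𝓘(ℝ, F) ∞ κ y ∧ ∀ᶠ x in 𝓝 y, g x = κ x • f x := by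
  obtain ⟨c, hc⟩ := Nat.exists_eq_add_of_le
    (LinearMap.finrank_le_finrank_of_injective (f := (orbitMap (E := E) F K (f y)).toLinearMap) hinj)
  have hd : Module.finrank ℝ E =
      Module.finrank ℝ F + Module.finrank ℝ (EuclideanSpace ℝ (Fin c)) := by
    rw [finrank_euclideanSpace_fin]
    exact hc
  obtain ⟨Ψ, s, W, D, h, h0, hs0, hsD⟩ := exists_isSlice_injOn (f y) hinj hfree hd
  obtain ⟨k, hk⟩ := exists_smul_of_orbitProj_eq hfg.self_of_nhds
  have hks := ContMDiffSMul.contMDiff_const_smul (I := 𝓘(ℝ, F)) (I' := 𝓘(ℝ, E)) (n := ∞) (M := Z) k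
  have hft : f y ∈ Ψ.target := hs0 ▸ h.mem_target h0
  have hkg : ContMDiffAt I' 𝓘(ℝ, E) ∞ (fun x => k • g x) y := (hks (g y)).comp y hg
  have hgt : k • g y ∈ Ψ.target := hk ▸ hft
  have ha : ContMDiffAt I' 𝓘(ℝ, F) ∞ (fun x => (Ψ.symm (f x)).1) y :=
    ContMDiffAt.comp (g := fun z => (Ψ.symm z).1) y
      (h.contMDiffOn_fst.contMDiffAt (Ψ.open_target.mem_nhds hft)) hf
  have hb : ContMDiffAt I' 𝓘(ℝ, F) ∞ (fun x => (Ψ.symm (k • g x)).1) y :=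
    ContMDiffAt.comp (g := fun z => (Ψ.symm z).1) y
      (h.contMDiffOn_fst.contMDiffAt (Ψ.open_target.mem_nhds hgt)) hkg
  -- with `k • g y = f y`, the points `f x` and `k • g x` lie over the same point of the slice
  refine ⟨fun x => k⁻¹ * ((Ψ.symm (k • g x)).1 * (Ψ.symm (f x)).1⁻¹),
    contMDiffAt_const.mul (hb.mul ha.inv), ?_⟩
  filter_upwards [hfg, hf.continuousAt.eventually_mem (Ψ.open_target.mem_nhds hft),
    hkg.continuousAt.eventually_mem (Ψ.open_target.mem_nhds hgt)] with x hx hfx hgx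
  have e1 := h.smul_symm hfx
  have e2 := h.smul_symm hgx
  have e3 : (Ψ.symm (k • g x)).2 = (Ψ.symm (f x)).2 := by
    refine hsD (h.symm_mem hgx).2 (h.symm_mem hfx).2 ?_
    change orbitProj K Z (s (Ψ.symm (k • g x)).2) = orbitProj K Z (s (Ψ.symm (f x)).2)
    calc orbitProj K Z (s (Ψ.symm (k • g x)).2)
        = orbitProj K Z (k • g x) := by
          conv_rhs => rw [← e2]
          rw [orbitProj_smul]
      _ = orbitProj K Z (f x) := by rw [orbitProj_smul, hx]
      _ = orbitProj K Z (s (Ψ.symm (f x)).2) := by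
        conv_lhs => rw [← e1]
        rw [orbitProj_smul]
  rw [e3] at e2
  have e4 : (Ψ.symm (f x)).1⁻¹ • f x = s (Ψ.symm (f x)).2 := inv_smul_eq_iff.2 e1.symm
  rw [mul_smul, mul_smul, eq_inv_smul_iff, e4, e2]

end Quotient

/-! ### The cosymplectic structure of the orbit space -/

section QuotientManifold

variable {E : Type*} [NormedAddCommGroup E] [NormedSpace ℝ E] [FiniteDimensional ℝ E]
  {F : Type*} [NormedAddCommGroup F] [NormedSpace ℝ F] [FiniteDimensional ℝ F]
  {G : Type*} [NormedAddCommGroup G] [NormedSpace ℝ G] [FiniteDimensional ℝ G]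
  {K : Type*} [Group K] [TopologicalSpace K] [ChartedSpace F K] [LieGroup 𝓘(ℝ, F) ∞ K]
  {Z : Type*} [TopologicalSpace Z] [ChartedSpace E Z] [IsManifold 𝓘(ℝ, E) ∞ Z]
  [MulAction K Z] [ContMDiffSMul 𝓘(ℝ, F) 𝓘(ℝ, E) ∞ K Z]

variable (E G K Z) in
/-- The manifold structure of the orbit space is the quotient structure: the projection is smooth
and has smooth local sections through all points. -/
structure IsOrbitManifold [ChartedSpace G (MulAction.orbitRel.Quotient K Z)] : Prop where
  contMDiff : ContMDiff 𝓘(ℝ, E) 𝓘(ℝ, G) ∞ (orbitProj K Z)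
  exists_section : ∀ z : Z, ∃ (g : MulAction.orbitRel.Quotient K Z → Z)
    (U : Set (MulAction.orbitRel.Quotient K Z)), IsOpen U ∧ orbitProj K Z z ∈ U ∧
      ContMDiffOn 𝓘(ℝ, G) 𝓘(ℝ, E) ∞ g U ∧ g (orbitProj K Z z) = z ∧ ∀ q ∈ U, orbitProj K Z (g q) = q

variable (E F G K Z) in
/-- The orbit space of a free proper action is a manifold. -/
theorem exists_isOrbitManifold [ProperSMul K Z]
    (hinj : ∀ z : Z, Function.Injective (orbitMap (E := E) F K z))
    (hfree : ∀ (k : K) (z : Z), k • z = z → k = 1)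
    (hd : Nonempty Z → Module.finrank ℝ E = Module.finrank ℝ F + Module.finrank ℝ G) :
    ∃ (_ : ChartedSpace G (MulAction.orbitRel.Quotient K Z))
      (_ : IsManifold 𝓘(ℝ, G) ∞ (MulAction.orbitRel.Quotient K Z)), IsOrbitManifold E G K Z := by
  have hex : ∀ q : MulAction.orbitRel.Quotient K Z,
      ∃ (c : OpenPartialHomeomorph (MulAction.orbitRel.Quotient K Z) G) (s : G → Z),
      IsQuotientChart (E := E) c s ∧ q ∈ c.source := by
    intro q
    obtain ⟨z, rfl⟩ := Quotient.exists_rep q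
    exact exists_isQuotientChart z (hinj z) (fun k => hfree k z) (hd ⟨z⟩)
  choose c s hcs hc using hex
  let cs := chartedSpaceOfCharts c hc
  have hm : IsManifold 𝓘(ℝ, G) ∞ (MulAction.orbitRel.Quotient K Z) := by
    refine isManifold_chartedSpaceOfCharts c hc fun x y => ?_
    rw [← contMDiffOn_iff_contDiffOn]
    refine ((hcs y).contMDiffOn_comp.comp
      ((hcs x).contMDiffOn_section.mono inter_subset_left) fun u hu => ?_).congr fun u hu => ?_
    · change orbitProj K Z (s x u) ∈ (c y).source
      rw [← (hcs x).symm_apply u hu.1]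
      exact hu.2
    · rw [Function.comp_apply, Function.comp_apply, Function.comp_apply,
        (hcs x).symm_apply u hu.1]
  have hproj : ContMDiff 𝓘(ℝ, E) 𝓘(ℝ, G) ∞ (orbitProj K Z) := by
    intro z
    rw [contMDiffAt_iff_target]
    refine ⟨continuous_orbitProj.continuousAt, ?_⟩
    exact (hcs (orbitProj K Z z)).contMDiffOn_comp.contMDiffAt
      (((c (orbitProj K Z z)).open_source.preimage continuous_orbitProj).mem_nhds
        (hc (orbitProj K Z z)))
  refine ⟨cs, hm, hproj, fun z => ?_⟩
  let q := orbitProj K Z z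
  have hq : orbitProj K Z (s q (c q q)) = orbitProj K Z z := by
    rw [← (hcs q).symm_apply _ ((c q).map_source (hc q))]
    exact (c q).left_inv (hc q)
  obtain ⟨k, hk⟩ := exists_smul_of_orbitProj_eq hq.symm
  refine ⟨fun p => k • s q (c q p), (c q).source, (c q).open_source, hc q, ?_, hk, fun p hp => ?_⟩
  · refine (ContMDiffSMul.contMDiff_const_smul (I := 𝓘(ℝ, F)) (I' := 𝓘(ℝ, E)) (n := ∞)
      k).comp_contMDiffOn ((hcs q).contMDiffOn_section.comp ?_ fun p hp => (c q).map_source hp)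
    exact contMDiffOn_chart (I := 𝓘(ℝ, G)) (x := q)
  · rw [orbitProj_smul, ← (hcs q).symm_apply _ ((c q).map_source hp)]
    exact (c q).left_inv hp

/-- A basic form has the same pullbacks by maps with the same projection to the orbit space. -/
theorem pullback_eq_of_isBasic [ProperSMul K Z]
    (hinj : ∀ z : Z, Function.Injective (orbitMap (E := E) F K z))
    (hfree : ∀ (k : K) (z : Z), k • z = z → k = 1) {n : ℕ} {α : Form 𝓘(ℝ, E) Z n}
    (hα : (actionGroupoid K Z).IsBasic (𝓘(ℝ, F).prod 𝓘(ℝ, E)) α)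
    {E' : Type*} [NormedAddCommGroup E'] [NormedSpace ℝ E'] {H' : Type*} [TopologicalSpace H']
    {I' : ModelWithCorners ℝ E' H'} {N : Type*} [TopologicalSpace N] [ChartedSpace H' N]
    {f g : N → Z} {y : N} (hf : ContMDiffAt I' 𝓘(ℝ, E) ∞ f y) (hg : ContMDiffAt I' 𝓘(ℝ, E) ∞ g y)
    (hfg : ∀ᶠ x in 𝓝 y, orbitProj K Z (f x) = orbitProj K Z (g x)) :
    (Form.pullback g α : Form I' N n) y = Form.pullback f α y := by
  obtain ⟨κ, hκ, hev⟩ := exists_contMDiffAt_smul_eq hf hg hfg (hinj _) fun k => hfree k _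
  have hL := isLieGroupoid_actionGroupoid E F K Z
  let j : N → K × Z := fun x => (κ x, f x)
  have hj : MDifferentiableAt I' (𝓘(ℝ, F).prod 𝓘(ℝ, E)) j y :=
    (hκ.prodMk hf).mdifferentiableAt (by simp)
  have h1 : g =ᶠ[𝓝 y] (actionGroupoid K Z).t ∘ j := hev
  rw [Form.pullback_congr h1, Form.pullback_comp_apply
    (hL.submersion_t.contMDiff.mdifferentiable (by simp) _) hj, hα,
    ← Form.pullback_comp_apply (hL.submersion_s.contMDiff.mdifferentiable (by simp) _) hj]
  rfl

variable [ChartedSpace G (MulAction.orbitRel.Quotient K Z)]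

/-- If a form on the orbit space is defined by pulling back a basic form by local sections, its
pullback by any map is the pullback of the basic form by any lift of that map. -/
theorem pullback_eq_of_lift [ProperSMul K Z]
    (hinj : ∀ z : Z, Function.Injective (orbitMap (E := E) F K z))
    (hfree : ∀ (k : K) (z : Z), k • z = z → k = 1) {n : ℕ} {α : Form 𝓘(ℝ, E) Z n}
    (hα : (actionGroupoid K Z).IsBasic (𝓘(ℝ, F).prod 𝓘(ℝ, E)) α)
    {αQ : Form 𝓘(ℝ, G) (MulAction.orbitRel.Quotient K Z) n}
    (hQ : ∀ q, ∃ g, ContMDiffAt 𝓘(ℝ, G) 𝓘(ℝ, E) ∞ g q ∧ (∀ᶠ p in 𝓝 q, orbitProj K Z (g p) = p) ∧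
      αQ q = Form.pullback g α q)
    {E' : Type*} [NormedAddCommGroup E'] [NormedSpace ℝ E'] {H' : Type*} [TopologicalSpace H']
    {I' : ModelWithCorners ℝ E' H'} {N : Type*} [TopologicalSpace N] [ChartedSpace H' N]
    {p : N → MulAction.orbitRel.Quotient K Z} {f : N → Z} {y : N}
    (hp : ContMDiffAt I' 𝓘(ℝ, G) ∞ p y) (hf : ContMDiffAt I' 𝓘(ℝ, E) ∞ f y)
    (hpf : ∀ᶠ x in 𝓝 y, orbitProj K Z (f x) = p x) :
    (Form.pullback p αQ : Form I' N n) y = Form.pullback f α y := by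
  obtain ⟨g, hg, hgp, hgα⟩ := hQ (p y)
  have h1 : (Form.pullback p αQ : Form I' N n) y = Form.pullback (g ∘ p) α y := by
    rw [Form.pullback_comp_apply (hg.mdifferentiableAt (by simp)) (hp.mdifferentiableAt (by simp))]
    exact congrArg (fun β => ContinuousAlternatingMap.compContinuousLinearMap β
      (mfderiv I' 𝓘(ℝ, G) p y)) hgα
  rw [h1]
  refine pullback_eq_of_isBasic hinj hfree hα hf (hg.comp y hp) ?_
  filter_upwards [hpf, hp.continuousAt.eventually hgp] with x hx hxg
  rw [hx, Function.comp_apply, hxg]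

namespace IsOrbitManifold

variable [IsManifold 𝓘(ℝ, G) ∞ (MulAction.orbitRel.Quotient K Z)] (h : IsOrbitManifold E G K Z)

include h

theorem isSubmersion : IsSubmersion 𝓘(ℝ, E) 𝓘(ℝ, G) (orbitProj K Z) where
  contMDiff := h.contMDiff
  surjective_mfderiv z := by
    obtain ⟨g, U, hU, hzU, hg, hgz, hπ⟩ := h.exists_section z
    refine surjective_mfderiv_of_section (h.contMDiff.mdifferentiable (by simp) z)
      ((hg.contMDiffAt (hU.mem_nhds hzU)).mdifferentiableAt (by simp)) hgz ?_
    filter_upwards [hU.mem_nhds hzU] with q hq using hπ q hq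

/-- Basic forms descend to the orbit space. -/
theorem exists_pullback_eq [ProperSMul K Z]
    (hinj : ∀ z : Z, Function.Injective (orbitMap (E := E) F K z))
    (hfree : ∀ (k : K) (z : Z), k • z = z → k = 1) {n : ℕ} {α : Form 𝓘(ℝ, E) Z n}
    (hα : (actionGroupoid K Z).IsBasic (𝓘(ℝ, F).prod 𝓘(ℝ, E)) α) (hsm : α.IsSmooth)
    (hcl : α.IsClosed) :
    ∃ αQ : Form 𝓘(ℝ, G) (MulAction.orbitRel.Quotient K Z) n, αQ.IsSmooth ∧ αQ.IsClosed ∧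
      Form.pullback (orbitProj K Z) αQ = α := by
  -- the value at `q` is obtained by pulling back by any local section through `q`
  have hsec := fun q : MulAction.orbitRel.Quotient K Z => h.exists_section q.out
  choose g U hU hqU hg hgq hπ using hsec
  have hout : ∀ q : MulAction.orbitRel.Quotient K Z, orbitProj K Z q.out = q := fun q => q.out_eq
  have hqU' : ∀ q, q ∈ U q := fun q => by
    have := hqU q
    rwa [hout] at this
  let αQ : Form 𝓘(ℝ, G) (MulAction.orbitRel.Quotient K Z) n := fun q => Form.pullback (g q) α q
  have hgAt : ∀ q, ContMDiffAt 𝓘(ℝ, G) 𝓘(ℝ, E) ∞ (g q) q := fun q =>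
    (hg q).contMDiffAt ((hU q).mem_nhds (hqU' q))
  have key := fun (q : MulAction.orbitRel.Quotient K Z) =>
    (⟨g q, hgAt q, Filter.mem_of_superset ((hU q).mem_nhds (hqU' q)) (hπ q), rfl⟩ :
      ∃ g, ContMDiffAt 𝓘(ℝ, G) 𝓘(ℝ, E) ∞ g q ∧ (∀ᶠ p in 𝓝 q, orbitProj K Z (g p) = p) ∧
        αQ q = Form.pullback g α q)
  -- local expressions in charts
  have hchart : ∀ (x₀ : MulAction.orbitRel.Quotient K Z), ∀ y ∈ (chartAt G x₀).target,
      ∃ (f : G → Z) (V : Set G), IsOpen V ∧ y ∈ V ∧ ContMDiffOn 𝓘(ℝ, G) 𝓘(ℝ, E) ∞ f V ∧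
        ∀ u ∈ V, αQ.inChart x₀ u = (Form.pullback f α : Form 𝓘(ℝ, G) G n) u := by
    intro x₀ y hy
    let c := chartAt G x₀
    have hcs : ContMDiffOn 𝓘(ℝ, G) 𝓘(ℝ, G) ∞ c.symm c.target := contMDiffOn_chart_symm
    let V := c.target ∩ c.symm ⁻¹' U (c.symm y)
    have hV : IsOpen V := c.symm.isOpen_inter_preimage (hU (c.symm y))
    have hfV : ContMDiffOn 𝓘(ℝ, G) 𝓘(ℝ, E) ∞ (g (c.symm y) ∘ c.symm) V :=
      (hg (c.symm y)).comp (hcs.mono inter_subset_left) fun u hu => hu.2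
    refine ⟨g (c.symm y) ∘ c.symm, V, hV, ⟨hy, hqU' _⟩, hfV, fun u hu => ?_⟩
    refine pullback_eq_of_lift hinj hfree hα key (hcs.contMDiffAt (c.open_target.mem_nhds hu.1))
      (hfV.contMDiffAt (hV.mem_nhds hu)) ?_
    filter_upwards [hV.mem_nhds hu] with w hw using hπ (c.symm y) _ hw.2
  refine ⟨αQ, fun x₀ y hy => ?_, fun x₀ y hy => ?_, ?_⟩
  · obtain ⟨f, V, hV, hyV, hf, he⟩ := hchart x₀ y hy
    refine ContDiffAt.contDiffWithinAt
      (((hsm.contDiffOn_pullback hV hf).contDiffAt (hV.mem_nhds hyV)).congr_of_eventuallyEq ?_)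
    filter_upwards [hV.mem_nhds hyV] with u hu using he u hu
  · obtain ⟨f, V, hV, hyV, hf, he⟩ := hchart x₀ y hy
    have hev : αQ.inChart x₀ =ᶠ[𝓝 y] (Form.pullback f α : Form 𝓘(ℝ, G) G n) := by
      filter_upwards [hV.mem_nhds hyV] with u hu using he u hu
    rw [hev.extDeriv_eq]
    exact Form.IsClosed.extDeriv_pullback hsm hcl (hf.contMDiffAt (hV.mem_nhds hyV))
  · funext z
    rw [pullback_eq_of_lift hinj hfree hα key (h.contMDiff z) (f := id) contMDiffAt_id
      (Filter.Eventually.of_forall fun _ => rfl), Form.pullback_id]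

/-- The projection to the orbit space is constant along the orbits. -/
theorem mfderiv_orbitProj_orbitMap (z : Z) (ξ : GroupLieAlgebra 𝓘(ℝ, F) K) :
    mfderiv 𝓘(ℝ, E) 𝓘(ℝ, G) (orbitProj K Z) z (orbitMap F K z ξ) = 0 := by
  have h1 := derivTo_comp (f := fun k : K => k • z) (g := orbitProj K Z) (x := 1) (y := z)
    (z := orbitProj K Z z) (one_smul K z) (h.contMDiff.mdifferentiable (by simp) z)
    ((contMDiff_orbit E F K z).mdifferentiable (by simp) 1) ξ
  refine h1.symm.trans ?_
  have e : orbitProj K Z ∘ (fun k : K => k • z) = fun _ => orbitProj K Z z :=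
    funext fun k => orbitProj_smul k z
  rw [e]
  change mfderiv 𝓘(ℝ, F) 𝓘(ℝ, G) (fun _ : K => orbitProj K Z z) 1 ξ = 0
  rw [mfderiv_const]
  rfl

/-- The reduced forms are cosymplectic, as their common kernel on `Z` is tangent to the orbits. -/
theorem isCosymplectic {σ : Form 𝓘(ℝ, E) Z 2} {η : Form 𝓘(ℝ, E) Z 1}
    (hση : IsTransverselyCosymplectic F K σ η)
    {σQ : Form 𝓘(ℝ, G) (MulAction.orbitRel.Quotient K Z) 2}
    {ηQ : Form 𝓘(ℝ, G) (MulAction.orbitRel.Quotient K Z) 1}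
    (hσ1 : σQ.IsSmooth) (hσ2 : σQ.IsClosed) (hη1 : ηQ.IsSmooth) (hη2 : ηQ.IsClosed)
    (hσ : Form.pullback (orbitProj K Z) σQ = σ) (hη : Form.pullback (orbitProj K Z) ηQ = η) :
    IsCosymplectic σQ ηQ := by
  have h2 : ∀ z (v w : TangentSpace 𝓘(ℝ, E) z), σQ (orbitProj K Z z)
      ![mfderiv 𝓘(ℝ, E) 𝓘(ℝ, G) (orbitProj K Z) z v,
        mfderiv 𝓘(ℝ, E) 𝓘(ℝ, G) (orbitProj K Z) z w] = σ z ![v, w] := by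
    intro z v w
    rw [← hσ, Form.pullback_two]
  have h1 : ∀ z (v : TangentSpace 𝓘(ℝ, E) z), ηQ (orbitProj K Z z)
      ![mfderiv 𝓘(ℝ, E) 𝓘(ℝ, G) (orbitProj K Z) z v] = η z ![v] := by
    intro z v
    rw [← hη, Form.pullback_one]
  have hreeb : ∀ q, ∃ R, ηQ q ![R] = 1 ∧ ∀ w, σQ q ![R, w] = 0 := by
    intro q
    obtain ⟨z, rfl⟩ := Quotient.exists_rep q
    obtain ⟨R, hR1, hR2⟩ := hση.exists_reeb z
    refine ⟨_, (h1 z R).trans hR1, fun w => ?_⟩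
    obtain ⟨w, rfl⟩ := h.isSubmersion.surjective_mfderiv z w
    exact (h2 z R w).trans (hR2 w)
  refine ⟨hσ1, hη1, hσ2, hη2, fun q h0 => ?_, fun q => ?_⟩
  · obtain ⟨R, hR, -⟩ := hreeb q
    rw [h0] at hR
    exact zero_ne_one hR
  · obtain ⟨R, hR1, hR2⟩ := hreeb q
    refine isCompl_ker_of_reeb _ _ q R hR1 hR2 fun v hv1 hv2 => ?_
    obtain ⟨z, rfl⟩ := Quotient.exists_rep q
    obtain ⟨v, rfl⟩ := h.isSubmersion.surjective_mfderiv z v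
    obtain ⟨ξ, rfl⟩ := (hση.mem_orbit_iff z v).2
      ⟨(h1 z v).symm.trans hv1, fun w => (h2 z v w).symm.trans (hv2 _)⟩
    exact h.mfderiv_orbitProj_orbitMap z ξ

/-- The action groupoid of a free proper action is Morita equivalent to the orbit space: it is the
groupoid of pairs of points with the same projection. -/
theorem isMoritaMap [ProperSMul K Z]
    (hinj : ∀ z : Z, Function.Injective (orbitMap (E := E) F K z))
    (hfree : ∀ (k : K) (z : Z), k • z = z → k = 1) :
    (actionGroupoid K Z).IsMoritaMap 𝓘(ℝ, E) (𝓘(ℝ, F).prod 𝓘(ℝ, E)) 𝓘(ℝ, G) 𝓘(ℝ, G)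
      (unitGroupoid (MulAction.orbitRel.Quotient K Z)) (orbitProj K Z)
      (fun p => orbitProj K Z p.2) where
  smooth_obj := h.contMDiff
  smooth_arr := h.contMDiff.comp contMDiff_snd
  map_s _ := rfl
  map_t p := (orbitProj_smul p.1 p.2).symm
  map_u _ := rfl
  map_m p q hpq := by
    have hpq' : p.2 = q.1 • q.2 := hpq
    change orbitProj K Z q.2 = orbitProj K Z p.2
    rw [hpq', orbitProj_smul]
  ess_surjective q := by
    obtain ⟨z, rfl⟩ := Quotient.exists_rep q
    exact ⟨z, _, rfl, rfl⟩
  ess_submersion z q hq w := by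
    have hq' : orbitProj K Z z = q := hq
    subst hq'
    obtain ⟨v, hv⟩ := h.isSubmersion.surjective_mfderiv z w
    refine ⟨v, w, hv.trans ?_, ?_⟩
    · exact (derivTo_id _ _ w).symm
    · exact derivTo_id _ _ w
  ff_embedding := by
    refine IsEmbedding.of_comp (g := fun p : Z × Z × MulAction.orbitRel.Quotient K Z => (p.2.1, p.1))
      (I'' := 𝓘(ℝ, E).prod 𝓘(ℝ, E)) ?_ ?_ ?_
    · exact contMDiff_snd.prodMk ((contMDiff_act E F K Z).prodMk
        (h.contMDiff.comp contMDiff_snd))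
    · exact (contMDiff_fst.comp contMDiff_snd).prodMk contMDiff_fst
    · have hact := contMDiff_act E F K Z
      have hpm := ProperSMul.isProperMap_smul_pair (G := K) (X := Z)
      refine ⟨hact.prodMk contMDiff_snd, fun p => ?_,
        (Topology.IsClosedEmbedding.of_continuous_injective_isClosedMap hpm.continuous ?_
          hpm.isClosedMap).isEmbedding⟩
      · rw [injective_iff_map_eq_zero]
        intro V hV
        have h1 := (hact.mdifferentiable (by simp) p).hasMFDerivAt.prodMk
          (hasMFDerivAt_snd (I := 𝓘(ℝ, F)) (I' := 𝓘(ℝ, E)) p)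
        have h2 := (DFunLike.congr_fun h1.mfderiv V).symm.trans hV
        have h3 : tangentSnd V = 0 := congrArg (fun r : E × E => r.2) h2
        have h4 : mfderiv (𝓘(ℝ, F).prod 𝓘(ℝ, E)) 𝓘(ℝ, E) (fun p : K × Z => p.1 • p.2) p V = 0 :=
          congrArg (fun r : E × E => r.1) h2
        rw [mfderiv_act, h3, add_zero] at h4
        have hk := bijective_translate (K := K) (Z := Z)
          (ContMDiffSMul.contMDiff_const_smul (I := 𝓘(ℝ, F)) (I' := 𝓘(ℝ, E))) p.1 p.2
        have h5 := hinj p.2 ((hk.1 (h4.trans (map_zero _).symm)).trans (map_zero _).symm)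
        have h6 : tangentFst V = 0 := (bijective_leftTriv p.1).1 (h5.trans (map_zero _).symm)
        exact Prod.ext h6 h3
      · rintro ⟨k, y⟩ ⟨l, z⟩ hkl
        have e1 : k • y = l • z := congrArg Prod.fst hkl
        have e2 : y = z := congrArg Prod.snd hkl
        subst e2
        have e3 : l⁻¹ * k = 1 := hfree _ y (by rw [mul_smul, e1, inv_smul_smul])
        exact Prod.ext (inv_mul_eq_one.1 e3).symm rfl
  ff_range := by
    ext ⟨y, z, q⟩
    constructor
    · rintro ⟨⟨k, x⟩, hp⟩
      have e1 : x = y := congrArg (fun r => r.1) hp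
      have e2 : k • x = z := congrArg (fun r => r.2.1) hp
      have e3 : orbitProj K Z x = q := congrArg (fun r => r.2.2) hp
      subst e1 e2 e3
      exact ⟨rfl, orbitProj_smul k x⟩
    · rintro ⟨h1, h2⟩
      have h1' : orbitProj K Z y = q := h1
      have h2' : orbitProj K Z z = q := h2
      obtain ⟨k, rfl⟩ := exists_smul_of_orbitProj_eq (h2'.trans h1'.symm)
      subst h1'
      exact ⟨(k, y), rfl⟩

end IsOrbitManifold

/-- The orbit space of a free proper action with transversely cosymplectic forms is a cosymplectic
manifold. -/
theorem IsTransverselyCosymplectic.quotientIsCosymplecticManifold [SecondCountableTopology Z]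
    {σ : Form 𝓘(ℝ, E) Z 2} {η : Form 𝓘(ℝ, E) Z 1} (hση : IsTransverselyCosymplectic F K σ η)
    (hfree : ∀ (k : K) (z : Z), k • z = z → k = 1) (hK : ProperSMul K Z) :
    QuotientIsCosymplecticManifold (F := F) K Z σ η := by
  have hinj := hση.injective_orbitMap
  have : ContinuousConstSMul K Z := ⟨fun k =>
    (ContMDiffSMul.contMDiff_const_smul (I := 𝓘(ℝ, F)) (I' := 𝓘(ℝ, E)) (n := ∞) k).continuous⟩
  refine ⟨t2Space_quotient_mulAction_of_properSMul, ContinuousConstSMul.secondCountableTopology,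
    Module.finrank ℝ E - Module.finrank ℝ F, ?_⟩
  have hd : Nonempty Z → Module.finrank ℝ E = Module.finrank ℝ F + Module.finrank ℝ
      (EuclideanSpace ℝ (Fin (Module.finrank ℝ E - Module.finrank ℝ F))) := by
    rintro ⟨z⟩
    have h1 : Module.finrank ℝ F ≤ Module.finrank ℝ E :=
      LinearMap.finrank_le_finrank_of_injective (f := (orbitMap (E := E) F K z).toLinearMap) (hinj z)
    rw [finrank_euclideanSpace_fin]
    omega
  obtain ⟨cs, hm, h⟩ := exists_isOrbitManifold E F _ K Z hinj hfree hd
  obtain ⟨σQ, hσ1, hσ2, hσ⟩ := h.exists_pullback_eq hinj hfree hση.isBasic_two hση.smooth_two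
    hση.closed_two
  obtain ⟨ηQ, hη1, hη2, hη⟩ := h.exists_pullback_eq hinj hfree hση.isBasic_one hση.smooth_one
    hση.closed_one
  exact ⟨cs, hm, σQ, ηQ, h.isCosymplectic hση hσ1 hσ2 hη1 hη2 hσ hη, h.isSubmersion, hσ.symm,
    hη.symm, h.isMoritaMap hinj hfree⟩

end QuotientManifold

/-! ### The zero level of a moment map -/

section ZeroLevel

variable {E : Type*} [NormedAddCommGroup E] [NormedSpace ℝ E] [FiniteDimensional ℝ E]
  {M : Type*} [TopologicalSpace M] [ChartedSpace E M] [IsManifold 𝓘(ℝ, E) ∞ M]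
  {F : Type*} [NormedAddCommGroup F] [NormedSpace ℝ F] [FiniteDimensional ℝ F]
  {K : Type*} [Group K] [TopologicalSpace K] [ChartedSpace F K] [LieGroup 𝓘(ℝ, F) ∞ K]
  [MulAction K M] [ContMDiffSMul 𝓘(ℝ, F) 𝓘(ℝ, E) ∞ K M]
  {σ : Form 𝓘(ℝ, E) M 2} {η : Form 𝓘(ℝ, E) M 1} {μ : M → LieAlgebraDual F}

theorem finrank_lieAlgebraDual : Module.finrank ℝ (LieAlgebraDual F) = Module.finrank ℝ F :=
  (LinearMap.toContinuousLinearMap (𝕜 := ℝ) (E := F) (F' := ℝ)).finrank_eq.symm.trans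
    Subspace.dual_finrank_eq

namespace IsHamiltonian

variable (hμ : IsHamiltonian K σ η μ)

include hμ in
/-- The moment map condition `⟨dμ(v), ξ⟩ = ω(ξ_M, v)`. -/
theorem mfderiv_apply (x : M) (v : TangentSpace 𝓘(ℝ, E) x) (ξ : GroupLieAlgebra 𝓘(ℝ, F) K) :
    pair (show LieAlgebraDual F from mfderiv 𝓘(ℝ, E) 𝓘(ℝ, LieAlgebraDual F) μ x v) ξ =
      σ x ![fundamentalField M ξ x, v] := by
  rw [← hμ.hamilton]
  let L : (F →L[ℝ] ℝ) →L[ℝ] ℝ := ContinuousLinearMap.apply ℝ ℝ (show F from ξ)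
  have h1 := (HasMFDerivAt.comp x (L.hasMFDerivAt (x := μ x))
    (hμ.smooth.mdifferentiable (by simp) x).hasMFDerivAt).mfderiv
  exact (DFunLike.congr_fun h1 v).symm

variable (hreg : ∀ x : M, μ x = 0 →
  Function.Surjective (mfderiv 𝓘(ℝ, E) 𝓘(ℝ, LieAlgebraDual F) μ x))

include hreg

omit [IsManifold 𝓘(ℝ, E) ∞ M] [MulAction K M] [ContMDiffSMul 𝓘(ℝ, F) 𝓘(ℝ, E) ∞ K M] in
/-- The subtraction is not truncated once the zero level has a point. -/
theorem finrank_eq_of_regular {x : M} (hx : μ x = 0) : Module.finrank ℝ E =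
    Module.finrank ℝ F + (Module.finrank ℝ E - Module.finrank ℝ F) := by
  have h1 := LinearMap.finrank_le_finrank_of_surjective
    (f := (mfderiv 𝓘(ℝ, E) 𝓘(ℝ, LieAlgebraDual F) μ x).toLinearMap) (hreg x hx)
  have h2 : Module.finrank ℝ (LieAlgebraDual F) ≤ Module.finrank ℝ E := h1
  rw [finrank_lieAlgebraDual] at h2
  omega

/-- The zero level is a submanifold of dimension `dim M - dim K`. -/
theorem exists_isRegularEmbedding_zeroLevel :
    ∃ (_ : ChartedSpace (EuclideanSpace ℝ (Fin (Module.finrank ℝ E - Module.finrank ℝ F)))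
        (zeroLevel hμ))
      (_ : IsManifold (𝓡 (Module.finrank ℝ E - Module.finrank ℝ F)) ∞ (zeroLevel hμ)),
      IsRegularEmbedding (𝓡 (Module.finrank ℝ E - Module.finrank ℝ F)) 𝓘(ℝ, E)
        (Subtype.val : zeroLevel hμ → M) := by
  by_cases hne : ∃ x, μ x = 0
  · obtain ⟨x₀, hx₀⟩ := hne
    refine exists_isRegularEmbedding_of_regular (V := LieAlgebraDual F) ?_ (zeroLevel hμ : Set M)
      fun x hx => ⟨μ, univ, isOpen_univ, mem_univ x, hμ.smooth.contMDiffOn, hreg x hx,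
        fun y _ => Iff.rfl⟩
    rw [finrank_lieAlgebraDual, finrank_euclideanSpace_fin]
    exact finrank_eq_of_regular hreg hx₀
  · -- the empty level is a manifold of any dimension, also of the truncated difference
    exact exists_isRegularEmbedding_of_sliceCharts (V := E) (zeroLevel hμ : Set M)
      fun x hx => (hne ⟨x, hx⟩).elim

variable {G : Type*} [NormedAddCommGroup G] [NormedSpace ℝ G] [FiniteDimensional ℝ G]
  [ChartedSpace G (zeroLevel hμ)] [IsManifold 𝓘(ℝ, G) ∞ (zeroLevel hμ)]
  (hZ : IsRegularEmbedding 𝓘(ℝ, G) 𝓘(ℝ, E) (Subtype.val : zeroLevel hμ → M))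

include hZ

omit hreg in
theorem contMDiffSMul_zeroLevel : ContMDiffSMul 𝓘(ℝ, F) 𝓘(ℝ, G) ∞ K (zeroLevel hμ) where
  contMDiff_smul := hZ.contMDiff_of_comp
    ((contMDiff_act E F K M).comp (contMDiff_fst.prodMk (hZ.contMDiff.comp contMDiff_snd)))

omit hreg in
theorem mfderiv_mfderiv_val (z : zeroLevel hμ) (v : TangentSpace 𝓘(ℝ, G) z) :
    mfderiv 𝓘(ℝ, E) 𝓘(ℝ, LieAlgebraDual F) μ z.1
      (mfderiv 𝓘(ℝ, G) 𝓘(ℝ, E) Subtype.val z v) = 0 := by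
  have h1 := mfderiv_comp z (hμ.smooth.mdifferentiable (by simp) z.1)
    (hZ.contMDiff.mdifferentiable (by simp) z)
  have e : μ ∘ (Subtype.val : zeroLevel hμ → M) = fun _ => 0 := funext fun y => y.2
  rw [e, mfderiv_const] at h1
  exact (DFunLike.congr_fun h1 v).symm

/-- The tangent space of the zero level is the kernel of `dμ`. -/
theorem exists_mfderiv_val_eq
    (hd : Module.finrank ℝ E = Module.finrank ℝ F + Module.finrank ℝ G)
    (z : zeroLevel hμ) (w : TangentSpace 𝓘(ℝ, E) z.1)
    (hw : mfderiv 𝓘(ℝ, E) 𝓘(ℝ, LieAlgebraDual F) μ z.1 w = 0) :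
    ∃ v, mfderiv 𝓘(ℝ, G) 𝓘(ℝ, E) (Subtype.val : zeroLevel hμ → M) z v = w := by
  let i := (mfderiv 𝓘(ℝ, G) 𝓘(ℝ, E) (Subtype.val : zeroLevel hμ → M) z).toLinearMap
  let f := (mfderiv 𝓘(ℝ, E) 𝓘(ℝ, LieAlgebraDual F) μ z.1).toLinearMap
  have hle : LinearMap.range i ≤ LinearMap.ker f := by
    rintro _ ⟨v, rfl⟩
    exact hμ.mfderiv_mfderiv_val hZ z v
  have h1 : Module.finrank ℝ (LinearMap.range i) = Module.finrank ℝ G :=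
    LinearMap.finrank_range_of_inj (hZ.injective_mfderiv z)
  have h2 : Module.finrank ℝ (LinearMap.range f) + Module.finrank ℝ (LinearMap.ker f) =
    Module.finrank ℝ E := LinearMap.finrank_range_add_finrank_ker f
  have h3 : Module.finrank ℝ (LinearMap.range f) = Module.finrank ℝ F := by
    rw [LinearMap.range_eq_top.2 (hreg z.1 z.2), finrank_top]
    exact finrank_lieAlgebraDual
  have h4 := Submodule.eq_of_le_of_finrank_eq hle (by omega)
  have h5 : w ∈ LinearMap.range i := h4 ▸ hw
  exact h5

omit hreg in
/-- The fundamental fields of `Z` are the restrictions of those of `M`. -/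
theorem mfderiv_val_orbitMap (z : zeroLevel hμ) (ξ : GroupLieAlgebra 𝓘(ℝ, F) K) :
    mfderiv 𝓘(ℝ, G) 𝓘(ℝ, E) (Subtype.val : zeroLevel hμ → M) z (orbitMap F K z ξ) =
      fundamentalField M ξ z.1 := by
  have := hμ.contMDiffSMul_zeroLevel hZ
  have h1 := derivTo_comp (f := fun k : K => k • z) (g := (Subtype.val : zeroLevel hμ → M)) (x := 1)
    (y := z) (z := z.1) (one_smul K z) (hZ.contMDiff.mdifferentiable (by simp) z)
    ((contMDiff_orbit G F K z).mdifferentiable (by simp) 1) ξ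
  exact h1.symm

omit hreg in
/-- Invariant forms restrict to invariant forms on the zero level. -/
theorem pullback_val_preserved {n : ℕ} {α : Form 𝓘(ℝ, E) M n} (k : K)
    (hα : Form.pullback (fun x : M => k • x) α = α) :
    (Form.pullback (fun z : zeroLevel hμ => k • z)
      (Form.pullback Subtype.val α : Form 𝓘(ℝ, G) (zeroLevel hμ) n) :
      Form 𝓘(ℝ, G) (zeroLevel hμ) n) = Form.pullback Subtype.val α := by
  have := hμ.contMDiffSMul_zeroLevel hZ
  have h1 : MDifferentiable 𝓘(ℝ, G) 𝓘(ℝ, G) fun z : zeroLevel hμ => k • z :=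
    (ContMDiffSMul.contMDiff_const_smul (I := 𝓘(ℝ, F)) (I' := 𝓘(ℝ, G)) (n := ∞)
      k).mdifferentiable (by simp)
  have h2 : MDifferentiable 𝓘(ℝ, E) 𝓘(ℝ, E) fun x : M => k • x :=
    (ContMDiffSMul.contMDiff_const_smul (I := 𝓘(ℝ, F)) (I' := 𝓘(ℝ, E)) (n := ∞)
      k).mdifferentiable (by simp)
  have h3 := hZ.contMDiff.mdifferentiable (by simp)
  rw [← Form.pullback_comp h3 h1]
  have e : (Subtype.val : zeroLevel hμ → M) ∘ (fun z : zeroLevel hμ => k • z) =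
      (fun x : M => k • x) ∘ Subtype.val := rfl
  rw [e, Form.pullback_comp h2 h3, hα]

omit hreg [ChartedSpace G (zeroLevel hμ)] [IsManifold 𝓘(ℝ, G) ∞ (zeroLevel hμ)] hZ in
include hμ in
/-- A covector which vanishes on the kernel of `dμ` is of the form `dμ^ξ`. -/
theorem exists_two_fundamentalField_eq {x : M} (φ : Module.Dual ℝ (TangentSpace 𝓘(ℝ, E) x))
    (hφ : ∀ w, mfderiv 𝓘(ℝ, E) 𝓘(ℝ, LieAlgebraDual F) μ x w = 0 → φ w = 0) :
    ∃ ξ : GroupLieAlgebra 𝓘(ℝ, F) K, ∀ w, σ x ![fundamentalField M ξ x, w] = φ w := by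
  let f : TangentSpace 𝓘(ℝ, E) x →ₗ[ℝ] (F →L[ℝ] ℝ) :=
    (mfderiv 𝓘(ℝ, E) 𝓘(ℝ, LieAlgebraDual F) μ x).toLinearMap
  have h1 : φ ∈ (LinearMap.ker f).dualAnnihilator :=
    (Submodule.mem_dualAnnihilator _).2 fun w hw => hφ w hw
  rw [← LinearMap.range_dualMap_eq_dualAnnihilator_ker] at h1
  obtain ⟨ℓ, hℓ⟩ := h1
  let ξ : F := (Module.evalEquiv ℝ F).symm
    (ℓ ∘ₗ (LinearMap.toContinuousLinearMap (𝕜 := ℝ) (E := F) (F' := ℝ)).toLinearMap)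
  refine ⟨ξ, fun w => ?_⟩
  refine (hμ.mfderiv_apply x w ξ).symm.trans ?_
  rw [← hℓ]
  have h2 := Module.apply_evalEquiv_symm_apply (R := ℝ) (M := F)
    (f w).toLinearMap
    (ℓ ∘ₗ (LinearMap.toContinuousLinearMap (𝕜 := ℝ) (E := F) (F' := ℝ)).toLinearMap)
  exact h2

/-- The restrictions to the zero level are transversely cosymplectic: the common kernel of the
restricted forms is the symplectic orthogonal of `ker dμ`, that is, the tangent space of the
orbit. -/
theorem isTransverselyCosymplectic_zeroLevel (hcosymp : IsCosymplectic σ η)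
    (hd : Nonempty (zeroLevel hμ) → Module.finrank ℝ E = Module.finrank ℝ F + Module.finrank ℝ G) :
    IsTransverselyCosymplectic F K
      (Form.pullback Subtype.val σ : Form 𝓘(ℝ, G) (zeroLevel hμ) 2)
      (Form.pullback Subtype.val η : Form 𝓘(ℝ, G) (zeroLevel hμ) 1) where
  smooth_two := hcosymp.smooth_two.pullback hZ.contMDiff
  smooth_one := hcosymp.smooth_one.pullback hZ.contMDiff
  closed_two := hcosymp.closed_two.pullback hcosymp.smooth_two hZ.contMDiff
  closed_one := hcosymp.closed_one.pullback hcosymp.smooth_one hZ.contMDiff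
  preserves_two k := hμ.pullback_val_preserved hZ k (hμ.preserves_two k)
  preserves_one k := hμ.pullback_val_preserved hZ k (hμ.preserves_one k)
  injective_orbitMap z := by
    rw [injective_iff_map_eq_zero]
    intro ξ hξ
    have h1 : (fundamentalField M ξ z.1 : TangentSpace 𝓘(ℝ, E) z.1) = 0 := by
      rw [← hμ.mfderiv_val_orbitMap hZ, hξ, map_zero]
    -- every covector of `𝔨` is some `dμ(v)`, and `⟨dμ(v), ξ⟩ = ω(ξ_M, v) = 0`
    refine SeparatingDual.eq_zero_of_forall_dual_eq_zero (R := ℝ) (V := F) fun α => ?_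
    obtain ⟨v, rfl⟩ := hreg z.1 z.2 α
    refine (hμ.mfderiv_apply z.1 v ξ).trans ?_
    rw [h1]
    exact (σ z.1).map_coord_zero (m := ![0, v]) 0 rfl
  mem_orbit_iff z v := by
    constructor
    · rintro ⟨ξ, rfl⟩
      refine ⟨?_, fun w => ?_⟩
      · rw [Form.pullback_one, hμ.mfderiv_val_orbitMap hZ]
        exact hμ.horizontal ξ z.1
      · rw [Form.pullback_two, hμ.mfderiv_val_orbitMap hZ, ← hμ.mfderiv_apply,
          hμ.mfderiv_mfderiv_val hZ]
        rfl
    · rintro ⟨h1, h2⟩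
      rw [Form.pullback_one] at h1
      obtain ⟨ξ, hξ⟩ := hμ.exists_two_fundamentalField_eq (x := z.1)
        (flat σ η z.1 (mfderiv 𝓘(ℝ, G) 𝓘(ℝ, E) Subtype.val z v)) fun w hw => by
          obtain ⟨u, rfl⟩ := hμ.exists_mfderiv_val_eq hreg hZ (hd ⟨z⟩) z w hw
          rw [flat_apply, h1, zero_mul, add_zero, ← Form.pullback_two, h2]
      refine ⟨ξ, hZ.injective_mfderiv z ?_⟩
      rw [hμ.mfderiv_val_orbitMap hZ]
      -- the difference of the two vectors lies in both kernels
      refine sub_eq_zero.1 ((Submodule.disjoint_def.1 (hcosymp.isCompl_ker z.1).disjoint) _ ?_ ?_)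
      · intro w
        rw [sub_eq_add_neg, Form.two_add_left, Form.two_neg_left, hξ, flat_apply, h1]
        ring
      · change η z.1 ![_] = 0
        rw [sub_eq_add_neg, Form.one_add, Form.one_neg, hμ.horizontal, h1]
        ring
  exists_reeb z := by
    obtain ⟨R, hR1, hR2⟩ := hcosymp.exists_reeb z.1
    -- the Reeb vectors are tangent to the zero level
    have hR3 : mfderiv 𝓘(ℝ, E) 𝓘(ℝ, LieAlgebraDual F) μ z.1 R = 0 := by
      refine ContinuousLinearMap.ext fun ξ => ?_
      refine (hμ.mfderiv_apply z.1 R ξ).trans ?_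
      rw [Form.two_swap, hR2, neg_zero]
      rfl
    obtain ⟨r, rfl⟩ := hμ.exists_mfderiv_val_eq hreg hZ (hd ⟨z⟩) z R hR3
    refine ⟨r, ?_, fun w => ?_⟩
    · rw [Form.pullback_one, hR1]
    · rw [Form.pullback_two, hR2]

end IsHamiltonian

end ZeroLevel

end Cosymp

end

theorem mainTheorem4
    {E : Type*} [NormedAddCommGroup E] [NormedSpace ℝ E] [FiniteDimensional ℝ E]
    {M : Type*} [TopologicalSpace M] [ChartedSpace E M] [IsManifold 𝓘(ℝ, E) ∞ M]
    [T2Space M] [SecondCountableTopology M]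
    {F : Type*} [NormedAddCommGroup F] [NormedSpace ℝ F] [FiniteDimensional ℝ F]
    {K : Type*} [Group K] [TopologicalSpace K] [ChartedSpace F K] [LieGroup 𝓘(ℝ, F) ∞ K]
    [T2Space K] [SecondCountableTopology K]
    [MulAction K M] [ContMDiffSMul 𝓘(ℝ, F) 𝓘(ℝ, E) ∞ K M]
    (σ : Cosymp.Form 𝓘(ℝ, E) M 2) (η : Cosymp.Form 𝓘(ℝ, E) M 1)
    (hcosymp : Cosymp.IsCosymplectic σ η)
    (μ : M → Cosymp.LieAlgebraDual F)
    (hμ : Cosymp.IsHamiltonian K σ η μ)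
    (hreg : ∀ x : M, μ x = 0 →
      Function.Surjective (mfderiv 𝓘(ℝ, E) 𝓘(ℝ, Cosymp.LieAlgebraDual F) μ x)) :
    ∃ (d : ℕ) (_ : ChartedSpace (EuclideanSpace ℝ (Fin d)) (Cosymp.zeroLevel hμ))
      (_ : IsManifold (𝓡 d) ∞ (Cosymp.zeroLevel hμ))
      (σ₀ : Cosymp.Form (𝓡 d) (Cosymp.zeroLevel hμ) 2)
      (η₀ : Cosymp.Form (𝓡 d) (Cosymp.zeroLevel hμ) 1),
      Cosymp.IsEmbedding (𝓡 d) 𝓘(ℝ, E) (Subtype.val : Cosymp.zeroLevel hμ → M) ∧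
      σ₀ = Cosymp.Form.pullback (Subtype.val : Cosymp.zeroLevel hμ → M) σ ∧
      η₀ = Cosymp.Form.pullback (Subtype.val : Cosymp.zeroLevel hμ → M) η ∧
      ((Cosymp.actionGroupoid K (Cosymp.zeroLevel hμ)).IsLieGroupoid
          (𝓡 d) (𝓘(ℝ, F).prod (𝓡 d)) ∧
        (Cosymp.actionGroupoid K (Cosymp.zeroLevel hμ)).IsZeroShiftedCosymplectic
          (𝓘(ℝ, F).prod (𝓡 d)) σ₀ η₀) ∧
      (ProperSMul K (Cosymp.zeroLevel hμ) →
        Cosymp.IsCosymplecticOrbifold (𝓘(ℝ, F).prod (𝓡 d))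
          (Cosymp.actionGroupoid K (Cosymp.zeroLevel hμ)) σ₀ η₀) ∧
      ((∀ (k : K) (x : Cosymp.zeroLevel hμ), k • x = x → k = 1) →
        ProperSMul K (Cosymp.zeroLevel hμ) →
        Cosymp.QuotientIsCosymplecticManifold (F := F) K (Cosymp.zeroLevel hμ) σ₀ η₀) := by
  obtain ⟨cs, hm, hZ⟩ := hμ.exists_isRegularEmbedding_zeroLevel hreg
  have hd : Nonempty (Cosymp.zeroLevel hμ) → Module.finrank ℝ E = Module.finrank ℝ F +
      Module.finrank ℝ
        (EuclideanSpace ℝ (Fin (Module.finrank ℝ E - Module.finrank ℝ F))) := by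
    rintro ⟨z⟩
    rw [finrank_euclideanSpace_fin]
    exact Cosymp.IsHamiltonian.finrank_eq_of_regular hreg z.2
  have hcount : SecondCountableTopology (Cosymp.zeroLevel hμ) :=
    hZ.isEmbedding.secondCountableTopology
  have hsmul := hμ.contMDiffSMul_zeroLevel hZ
  have hT := hμ.isTransverselyCosymplectic_zeroLevel hreg hZ hcosymp hd
  refine ⟨_, cs, hm, _, _, hZ.toIsEmbedding, rfl, rfl,
    ⟨Cosymp.isLieGroupoid_actionGroupoid _ F K _, hT.isZeroShiftedCosymplectic⟩, fun hK => ?_,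
    fun hfree hK => hT.quotientIsCosymplecticManifold hfree hK⟩
  obtain ⟨c, X, _, _, _, _, _, ι, hι⟩ :=
    Cosymp.exists_isCompleteTransversal _ F K _ hT.injective_orbitMap
  exact hι.isCosymplecticOrbifold hT hK
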